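/- Fix $t$ and write $u,v$ for $u(\cdot,t),v(\cdot,t):\mathbb R\to\mathbb C$. Assume $u,v\in L^1(\mathbb R)\cap L^\infty(\mathbb R)$ and that $v$ has a weak derivative $v_x\in L^1(\mathbb R)$. Put $$Q_1=\begin{pmatrix}\frac i4(|u|^2+|v|^2)&-\frac i2\bar v\\ v_x+\frac i2|u|^2v+\frac i2u&-\frac i4(|u|^2+|v|^2)\end{pmatrix},\qquad Q_2=-\frac i2\begin{pmatrix}\bar uv&-\bar u\\ v+\bar uv^2&-\bar uv\end{pmatrix},$$ $\sigma_3=\mathrm{diag}(1,-1)$ and $e^{z\hat\sigma_3}X=e^{z\sigma_3}Xe^{-z\sigma_3}$, and consider, column by column, the Volterra equations for the $2\times2$ matrices $\Phi_\pm=(\Phi_{\pm1},\Phi_{\pm2})$, $$\Phi_\pm(x;\lambda)=I+\int_{\pm\infty}^x e^{\frac i4(\lambda-\lambda^{-1})(x-y)\hat\sigma_3}\big[(Q_1(y)+\lambda^{-1}Q_2(y))\Phi_\pm(y;\lambda)\big]\,dy .$$ Let $D$ be the domain $\{|\lambda|>1,\ \mathrm{Im}\,\lambda>0\}$ for the columns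 $\Phi_{+1},\Phi_{-2}$, and $\{|\lambda|>1,\ \mathrm{Im}\,\lambda<0\}$ for the columns $\Phi_{-1},\Phi_{+2}$. Then: 1. For every $\lambda\in\mathbb R\setminus[-1,1]$ each of the four column equations has a unique solution in $L^\infty(\mathbb R)$; the same holds, for each column, for every $\lambda$ in its domain $D$. 2. For every $x\in\mathbb R$ each column, as a function of $\lambda$, is analytic in its domain $D$ and continuous on $D\cup(\mathbb R\setminus[-1,1])$; that is, the columns on $\mathbb R\setminus[-1,1]$ continue analytically into $D$. 3. With $\Phi^\infty_{\pm1}(x)=e^{\frac i4\int_{\pm\infty}^x(|u|^2+|v|^2)dy}$ and $\Phi^\infty_{\pm2}(x)=e^{-\frac i4\int_{\pm\infty}^x(|u|^2+|v|^2)dy}$, for every $x\in\mathbb R$, as $\lambda\to\infty$ in $D$, $$\frac{\Phi_{\pm1}(x;\lambda)}{\Phi^\infty_{\pm1}(x)}\to e_1=(1,0)^{T},\qquad \frac{\Phi_{\pm2}(x;\lambda)}{\Phi^\infty_{\pm2}(x)}\to e_2=(0,1)^{T}.$$ 4. If moreover $v\in C^1(\mathbb R)$, put $J_\pm(x)=\int_{\pm\infty}^x\big[\bar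 v\,(v_x+\frac i2|u|^2v+\frac i2u)+\frac i2\bar uv\big]dy$. Then $$\lambda\Big[\frac{\Phi_{\pm1}(x;\lambda)}{\Phi^\infty_{\pm1}(x)}-e_1\Big]\to\begin{pmatrix}-J_\pm(x)\\-2iv_x(x)+|u(x)|^2v(x)+u(x)\end{pmatrix},\qquad \lambda\Big[\frac{\Phi_{\pm2}(x;\lambda)}{\Phi^\infty_{\pm2}(x)}-e_2\Big]\to\begin{pmatrix}\overline{v(x)}\\J_\pm(x)\end{pmatrix}.$$ The limits of the first component for $\Phi_{\pm1}$ and of both components for $\Phi_{\pm2}$ hold for every $x\in\mathbb R$ as $\lambda\to\infty$ in $D$. The limit of the second component for $\Phi_{\pm1}$ holds at every Lebesgue point $x$ of $u$ (hence for almost every $x$, and at every point of continuity of $u$) as $\lambda\to\infty$ non-tangentially in $D$, that is, inside $D\cap\{|\mathrm{Im}\,\lambda|\ge\varepsilon|\lambda|\}$ for each fixed $\varepsilon>0$. -/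

import Mathlib

open MeasureTheory Filter Topology
open scoped ENNReal ContDiff ComplexConjugate Matrix

noncomputable section

namespace MTM

/-- `w` is the weak (distributional) derivative of `v` on the real line. -/
def IsWeakDeriv (v w : ℝ → ℂ) : Prop :=
  ∀ φ : ℝ → ℝ, ContDiff ℝ ∞ φ → HasCompactSupport φ →
    ∫ x, ((deriv φ x : ℝ) : ℂ) * v x = -∫ x, ((φ x : ℝ) : ℂ) * w x

/-- The two ends of the line at which Jost functions are normalized. -/
inductive LineEnd
  | plus
  | minus

/-- The integral from `+∞` (resp. `-∞`) to `x`. -/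
def intFrom {E : Type*} [NormedAddCommGroup E] [NormedSpace ℝ E]
    (s : LineEnd) (x : ℝ) (f : ℝ → E) : E :=
  match s with
  | .plus => -∫ y in Set.Ioi x, f y
  | .minus => ∫ y in Set.Iic x, f y

/-- The matrix `Q₁`; here `vx` stands for the `x`-derivative of `v`. -/
def Q1 (u v vx : ℝ → ℂ) (y : ℝ) : Matrix (Fin 2) (Fin 2) ℂ :=
  !![Complex.I / 4 * ((‖u y‖ ^ 2 + ‖v y‖ ^ 2 : ℝ) : ℂ), -(Complex.I / 2) * conj (v y);
     vx y + Complex.I / 2 * ((‖u y‖ ^ 2 : ℝ) : ℂ) * v y + Complex.I / 2 * u y,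
       -(Complex.I / 4) * ((‖u y‖ ^ 2 + ‖v y‖ ^ 2 : ℝ) : ℂ)]

/-- The matrix `Q₂`. -/
def Q2 (u v : ℝ → ℂ) (y : ℝ) : Matrix (Fin 2) (Fin 2) ℂ :=
  (-(Complex.I / 2)) •
    !![conj (u y) * v y, -conj (u y);
       v y + conj (u y) * v y ^ 2, -(conj (u y) * v y)]

/-- `e^{z σ₃}`. -/
def expSigma3 (z : ℂ) : Matrix (Fin 2) (Fin 2) ℂ :=
  !![Complex.exp z, 0; 0, Complex.exp (-z)]

/-- `e^{z σ̂₃} X = e^{z σ₃} X e^{-z σ₃}`. -/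
def expSigmaHat (z : ℂ) (X : Matrix (Fin 2) (Fin 2) ℂ) : Matrix (Fin 2) (Fin 2) ℂ :=
  expSigma3 z * X * expSigma3 (-z)

/-- The `j`-th column of `e^{z σ̂₃} X`, as a function of the `j`-th column `c` of `X`. -/
def expSigmaHatCol (z : ℂ) (j : Fin 2) (c : Fin 2 → ℂ) : Fin 2 → ℂ :=
  expSigma3 (-z) j j • (expSigma3 z *ᵥ c)

theorem expSigmaHat_col (z : ℂ) (X : Matrix (Fin 2) (Fin 2) ℂ) (i j : Fin 2) :
    expSigmaHat z X i j = expSigmaHatCol z j (fun k => X k j) i := by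
  rw [expSigmaHat, Matrix.mul_apply, Fin.sum_univ_two, Matrix.mul_apply, Matrix.mul_apply,
    Fin.sum_univ_two, Fin.sum_univ_two]
  fin_cases i <;> fin_cases j <;>
    simp [expSigmaHatCol, expSigma3, mul_comm, Matrix.vecHead, Matrix.vecTail]

/-- The unit vector `e_j`. -/
def stdVec (j : Fin 2) : Fin 2 → ℂ := Pi.single j 1

/-- The right-hand side, at the point `x`, of the `j`-th column of the matrix Volterra equation
`Φ = I + ∫_{±∞}^x e^{(i/4)(l - l⁻¹)(x-y) σ̂₃} [(Q₁ + l⁻¹ Q₂) Φ](y) dy`. -/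
def volterraRHS (u v vx : ℝ → ℂ) (s : LineEnd) (j : Fin 2) (l : ℂ) (Ψ : ℝ → Fin 2 → ℂ)
    (x : ℝ) : Fin 2 → ℂ :=
  stdVec j + intFrom s x (fun y =>
    expSigmaHatCol (Complex.I / 4 * (l - l⁻¹) * ((x - y : ℝ) : ℂ)) j
      ((Q1 u v vx y + l⁻¹ • Q2 u v y) *ᵥ Ψ y))

/-- Which half plane: `1` for the upper half plane (first column at `+∞`, second column at `-∞`),
`-1` for the lower one (first column at `-∞`, second column at `+∞`). -/
def halfPlaneSign : LineEnd → Fin 2 → ℝ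
  | .plus, 0 => 1
  | .plus, 1 => -1
  | .minus, 0 => -1
  | .minus, 1 => 1

/-- The open domain `ℂ^± ∩ {|l| > 1}` attached to the `j`-th column normalized at the end `s`. -/
def openDomain (s : LineEnd) (j : Fin 2) : Set ℂ :=
  {l | 1 < ‖l‖ ∧ 0 < halfPlaneSign s j * l.im}

/-- The open domain together with its real boundary points, the points of `ℝ ∖ [-1,1]`. -/
def closedDomain (s : LineEnd) (j : Fin 2) : Set ℂ :=
  {l | 1 < ‖l‖ ∧ 0 ≤ halfPlaneSign s j * l.im}

/-- `l → ∞` in the domain of analyticity. -/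
def atInfinity (s : LineEnd) (j : Fin 2) : Filter ℂ :=
  Bornology.cobounded ℂ ⊓ 𝓟 (openDomain s j)

/-- `l → ∞` in the domain of analyticity, inside the sector `|Im l| ≥ ε |l|`. -/
def atInfinitySector (s : LineEnd) (j : Fin 2) (ε : ℝ) : Filter ℂ :=
  Bornology.cobounded ℂ ⊓ 𝓟 (openDomain s j ∩ {l | ε * ‖l‖ ≤ |l.im|})

/-- The scalar limits `Φ^∞_{±1} = e^{(i/4) ∫_{±∞}^x (|u|²+|v|²)}` (for `j = 0`) and
`Φ^∞_{±2} = e^{-(i/4) ∫_{±∞}^x (|u|²+|v|²)}` (for `j = 1`). -/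
def PhiInf (u v : ℝ → ℂ) (s : LineEnd) (j : Fin 2) (x : ℝ) : ℂ :=
  Complex.exp ((if j = 0 then 1 else -1) * (Complex.I / 4) *
    ((intFrom s x (fun y => ‖u y‖ ^ 2 + ‖v y‖ ^ 2) : ℝ) : ℂ))

/-- `∫_{±∞}^x [v̄ (v_x + (i/2)|u|² v + (i/2) u) + (i/2) ū v] dy`. -/
def corrInt (u v : ℝ → ℂ) (s : LineEnd) (x : ℝ) : ℂ :=
  intFrom s x (fun y =>
    conj (v y) * (deriv v y + Complex.I / 2 * ((‖u y‖ ^ 2 : ℝ) : ℂ) * v y + Complex.I / 2 * u y)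
      + Complex.I / 2 * conj (u y) * v y)

/-- `x` is a Lebesgue point of `u`; every point of continuity is one. -/
def IsLebesguePoint (u : ℝ → ℂ) (x : ℝ) : Prop :=
  Tendsto (fun r : ℝ => ⨍ y in Metric.closedBall x r, ‖u y - u x‖) (𝓝[>] 0) (𝓝 0)

end MTM

end

/-! In column `j` the conjugation by `e^{z σ₃}` leaves the entry `j` alone and multiplies the other
one by an exponential. After the reflection `x ↦ -x` when the normalization is at `+∞`, each of the
four column equations becomes one scalar system on `(-∞, x]`: `a = 1 + ∫ (A a + B b)`, `b = ∫
e^{θ(x-y)} (C a + D b)`, with `θ = κ (l - l⁻¹)`, `κ = ± i/2` and coefficients `A = A₁ + l⁻¹ A₂`,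
etc. The domains are exactly where `|l| > 1` and `Re θ ≤ 0` (or `< 0`), so that the kernel is
dominated by a fixed integrable weight. Picard iterates then decay like `m(x)^n / n!`, the Neumann
series converges uniformly in `x` and `l`, and continuity and holomorphy in `l` survive
(`IsVolterraKernel.exists_solution`). Uniqueness is Grönwall's inequality (`gronwall_Iic`).

For the leading limit, `a` is compared with `lim = exp ∫ A₁`, the solution of `a = 1 + ∫ A₁ a`. The
forcing terms are of size `l⁻¹`, except for the oscillatory integral of `C₁ lim`; this one tends to
zero uniformly in `x` by a Riemann–Lebesgue lemma in the left half plane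
(`exists_tendsto_zero_norm_oscInt_le`), and Grönwall concludes (`exists_leading_bound`).

At the next order `b ≈ -θ⁻¹ C₁ a`, so `B b` contributes `-θ⁻¹ B₁ C₁ a` and `l (a - lim) → lim · ∫
(A₂ - κ⁻¹ B₁ C₁)` (`exists_first_order_bound`). Justifying this takes one integration by parts, and
only the entry `-(i/2) v̄` of `Q₁` is differentiable. In the second column that entry is `C₁`: one
integrates by parts in the equation for `b` and obtains both components uniformly in `x`. In the
first column it is `B₁`: the parts formula is applied to `∫ B₁ b` instead, which controls `a`
without any regularity of `C₁`. There the limit of `l b` is pointwise: `-θ e^{θ(x-y)}` is an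
approximate identity when `θ → ∞` inside a sector, so the limit holds at Lebesgue points of `C₁`,
hence at those of `u` (`tendsto_mul_offdiag`). -/

namespace MTM

/-! ### Primitives of integrable functions on half-lines, and Grönwall's inequality. -/

section Primitive

variable {𝕜 : Type*} [RCLike 𝕜]

/-- Fubini on the triangle `z ≤ y ≤ x`, where `k (y - z)` is bounded by one and `f y * h z` is
integrable. It replaces almost everywhere differentiation in all that follows: with `k = 1` it
yields product rules for primitives, with an exponential `k` it yields integration by parts. -/
theorem integral_Iic_mul_integral_swap {f h k : ℝ → 𝕜} (hf : Integrable f) (hh : Integrable h)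
    (hk : Continuous k) (hk1 : ∀ t, 0 ≤ t → ‖k t‖ ≤ 1) (x : ℝ) :
    IntegrableOn (fun z => h z * ∫ y in Set.Ioc z x, k (y - z) * f y) (Set.Iic x) ∧
    ∫ y in Set.Iic x, f y * ∫ z in Set.Iic y, k (y - z) * h z =
      ∫ z in Set.Iic x, h z * ∫ y in Set.Ioc z x, k (y - z) * f y := by
  set S : Set (ℝ × ℝ) := {p | p.2 ≤ p.1 ∧ p.1 ≤ x} with hS
  have hSm : MeasurableSet S :=
    (measurableSet_le measurable_snd measurable_fst).inter
      (measurableSet_le measurable_fst measurable_const)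
  set F : ℝ × ℝ → 𝕜 := S.indicator (fun p => k (p.1 - p.2) * (f p.1 * h p.2)) with hF
  have hFi : Integrable F (volume.prod volume) := by
    have h0 : Integrable (fun p : ℝ × ℝ => f p.1 * h p.2) (volume.prod volume) := hf.mul_prod hh
    refine h0.norm.mono' ?_ (Eventually.of_forall fun p => ?_)
    · refine AEStronglyMeasurable.indicator ?_ hSm
      exact (hk.comp (continuous_fst.sub continuous_snd)).aestronglyMeasurable.mul h0.1
    · by_cases hp : p ∈ S
      · rw [hF, Set.indicator_of_mem hp, norm_mul]
        exact mul_le_of_le_one_left (norm_nonneg _) (hk1 _ (sub_nonneg.2 hp.1))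
      · rw [hF, Set.indicator_of_notMem hp, norm_zero]
        positivity
  have key := integral_integral_swap (f := fun y z => F (y, z)) hFi
  have hL : ∀ y, ∫ z, F (y, z) =
      (Set.Iic x).indicator (fun y => f y * ∫ z in Set.Iic y, k (y - z) * h z) y := by
    intro y
    by_cases hy : y ≤ x
    · rw [Set.indicator_of_mem (by exact hy), ← integral_const_mul,
        ← integral_indicator measurableSet_Iic]
      congr 1; ext z
      by_cases hz : z ≤ y
      · rw [hF, Set.indicator_of_mem (by exact ⟨hz, hy⟩), Set.indicator_of_mem (by exact hz)]
        ring
      · rw [hF, Set.indicator_of_notMem (fun h => hz h.1), Set.indicator_of_notMem (by exact hz)]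
    · rw [Set.indicator_of_notMem (by exact hy)]
      refine integral_eq_zero_of_ae (Eventually.of_forall fun z => ?_)
      exact Set.indicator_of_notMem (fun h => hy h.2) _
  have hR : ∀ z, ∫ y, F (y, z) =
      (Set.Iic x).indicator (fun z => h z * ∫ y in Set.Ioc z x, k (y - z) * f y) z := by
    intro z
    by_cases hz : z ≤ x
    · rw [Set.indicator_of_mem (by exact hz), ← integral_Icc_eq_integral_Ioc,
        ← integral_const_mul, ← integral_indicator measurableSet_Icc]
      congr 1; ext y
      by_cases hy : y ∈ Set.Icc z x
      · rw [hF, Set.indicator_of_mem (by exact hy), Set.indicator_of_mem hy]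
        ring
      · rw [Set.indicator_of_notMem hy, hF]
        exact Set.indicator_of_notMem (s := S) (fun h => hy h) _
    · rw [Set.indicator_of_notMem (by exact hz)]
      refine integral_eq_zero_of_ae (Eventually.of_forall fun y => ?_)
      exact Set.indicator_of_notMem (fun h => hz (h.1.trans h.2)) _
  refine ⟨(integrable_indicator_iff measurableSet_Iic).1
    (hFi.integral_prod_right.congr (Eventually.of_forall hR)), ?_⟩
  rwa [integral_congr_ae (Eventually.of_forall hL), integral_congr_ae (Eventually.of_forall hR),
    integral_indicator measurableSet_Iic, integral_indicator measurableSet_Iic] at key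

theorem continuous_primitive_Iic {E : Type*} [NormedAddCommGroup E] [NormedSpace ℝ E]
    {f : ℝ → E} (hf : Integrable f) : Continuous fun x => ∫ y in Set.Iic x, f y := by
  have : ∀ x, ∫ y in Set.Iic x, f y = (∫ y in Set.Iic 0, f y) + ∫ y in (0:ℝ)..x, f y := fun x => by
    rw [← intervalIntegral.integral_Iic_sub_Iic hf.integrableOn hf.integrableOn,
      add_sub_cancel]
  rw [funext this]
  exact continuous_const.add (intervalIntegral.continuous_primitive
    (fun a b => hf.intervalIntegrable) 0)

theorem norm_primitive_Iic_le {E : Type*} [NormedAddCommGroup E] [NormedSpace ℝ E]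
    {f : ℝ → E} (hf : Integrable f) (x : ℝ) : ‖∫ y in Set.Iic x, f y‖ ≤ ∫ y, ‖f y‖ :=
  (norm_integral_le_integral_norm _).trans
    (setIntegral_le_integral hf.norm (Eventually.of_forall fun _ => norm_nonneg _))

/-- A continuous function dominated by `C` times an integrable one has an integrable product. -/
theorem integrable_mul_of_continuous_bdd {f g : ℝ → 𝕜} (hf : Integrable f) (hg : Continuous g)
    {K : ℝ} (hK : ∀ x, ‖g x‖ ≤ K) : Integrable fun x => f x * g x :=
  hf.mul_bdd (c := K) hg.aestronglyMeasurable (Eventually.of_forall hK)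

/-- The square `y, z ≤ x` is cut along its diagonal into two triangles, so the product rule needs
integrability only. -/
theorem primitive_mul_primitive {f g : ℝ → 𝕜} (hf : Integrable f) (hg : Integrable g) (x : ℝ) :
    (∫ y in Set.Iic x, f y) * (∫ y in Set.Iic x, g y) =
      ∫ y in Set.Iic x, (f y * (∫ z in Set.Iic y, g z) + g y * ∫ z in Set.Iic y, f z) := by
  have h1 := (integral_Iic_mul_integral_swap hf hg (k := fun _ => (1 : 𝕜)) continuous_const
    (fun _ _ => by simp) x).2
  simp only [one_mul] at h1
  have i1 : Integrable fun y => f y * ∫ z in Set.Iic y, g z :=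
    integrable_mul_of_continuous_bdd hf (continuous_primitive_Iic hg) (norm_primitive_Iic_le hg)
  have i2 : Integrable fun y => g y * ∫ z in Set.Iic y, f z :=
    integrable_mul_of_continuous_bdd hg (continuous_primitive_Iic hf) (norm_primitive_Iic_le hf)
  rw [integral_add i1.integrableOn i2.integrableOn, h1]
  have h2 : ∀ z ∈ Set.Iic x, g z * ∫ y in Set.Ioc z x, f y =
      g z * (∫ y in Set.Iic x, f y) - g z * ∫ y in Set.Iic z, f y := fun z hz => by
    rw [← intervalIntegral.integral_of_le hz,
      ← intervalIntegral.integral_Iic_sub_Iic hf.integrableOn hf.integrableOn, mul_sub]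
  rw [setIntegral_congr_fun measurableSet_Iic h2,
    integral_sub (hg.mul_const _).integrableOn i2.integrableOn, integral_mul_const]
  ring

theorem integral_mul_primitive_pow {f : ℝ → 𝕜} (hf : Integrable f) (n : ℕ) (x : ℝ) :
    ∫ y in Set.Iic x, f y * (∫ z in Set.Iic y, f z) ^ n =
      (∫ y in Set.Iic x, f y) ^ (n + 1) / (n + 1) := by
  have hi : ∀ n : ℕ, Integrable fun y => f y * (∫ z in Set.Iic y, f z) ^ n := fun n =>
    integrable_mul_of_continuous_bdd hf ((continuous_primitive_Iic hf).pow n)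
      (K := (∫ y, ‖f y‖) ^ n) (fun x => by
        rw [norm_pow]; exact pow_le_pow_left₀ (norm_nonneg _) (norm_primitive_Iic_le hf x) n)
  induction n generalizing x with
  | zero => simp
  | succ n ih =>
    have hn : ((n : 𝕜) + 1) ≠ 0 := by exact_mod_cast Nat.succ_ne_zero n
    have hn' : ((n : 𝕜) + 1 + 1) ≠ 0 := by exact_mod_cast Nat.succ_ne_zero (n + 1)
    have h := primitive_mul_primitive hf (hi n) x
    simp_rw [ih] at h
    -- Both halves of the product rule are multiples of the same integrand, with factors `1 / (n +
    -- 1)` and `1`, which add up to `(n + 2) / (n + 1)`.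
    have h2 : ∀ y, f y * ((∫ y in Set.Iic y, f y) ^ (n + 1) / (n + 1)) +
        f y * (∫ z in Set.Iic y, f z) ^ n * ∫ z in Set.Iic y, f z =
        (f y * (∫ z in Set.Iic y, f z) ^ (n + 1)) * ((n + 1 + 1) / (n + 1)) := fun y => by
      field_simp; ring
    simp_rw [h2] at h
    rw [integral_mul_const] at h
    push_cast
    rw [eq_div_iff hn']
    field_simp at h
    rw [← h]; ring

/-- The exponential series is integrated term by term; the `n`-th term gives the `(n + 1)`-st term
of the series at `x`, hence the missing `1`. Thus `exp ∫ f` solves the scalar equation `E = 1 + ∫ f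
E`. -/
theorem integral_mul_exp_primitive {f : ℝ → ℂ} (hf : Integrable f) (x : ℝ) :
    ∫ y in Set.Iic x, f y * Complex.exp (∫ z in Set.Iic y, f z) =
      Complex.exp (∫ y in Set.Iic x, f y) - 1 := by
  set F : ℝ → ℂ := fun x => ∫ y in Set.Iic x, f y with hF
  set K := ∫ y, ‖f y‖ with hK
  have hK0 : 0 ≤ K := integral_nonneg fun _ => norm_nonneg _
  have hFc : Continuous F := continuous_primitive_Iic hf
  have hFK : ∀ x, ‖F x‖ ≤ K := norm_primitive_Iic_le hf
  have hb : ∀ n y, ‖f y * (F y ^ n / n.factorial)‖ ≤ ‖f y‖ * (K ^ n / n.factorial) := by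
    intro n y
    rw [norm_mul, norm_div, norm_pow, Complex.norm_natCast]
    gcongr
    exact hFK y
  have hi : ∀ n : ℕ, Integrable fun y => f y * (F y ^ n / n.factorial) := fun n =>
    (hf.norm.mul_const _).mono' (hf.1.mul ((hFc.pow n).div_const _).aestronglyMeasurable)
      (Eventually.of_forall (hb n))
  have hs := hasSum_integral_of_summable_integral_norm (μ := volume.restrict (Set.Iic x))
    (fun n => (hi n).integrableOn) (by
      refine Summable.of_nonneg_of_le (fun n => integral_nonneg fun _ => norm_nonneg _)
        (fun n => ?_) ((Real.summable_pow_div_factorial K).mul_left K)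
      calc ∫ y in Set.Iic x, ‖f y * (F y ^ n / n.factorial)‖
          ≤ ∫ y, ‖f y * (F y ^ n / n.factorial)‖ := setIntegral_le_integral (hi n).norm
              (Eventually.of_forall fun _ => norm_nonneg _)
        _ ≤ ∫ y, ‖f y‖ * (K ^ n / n.factorial) :=
              integral_mono (hi n).norm (hf.norm.mul_const _) (hb n)
        _ = K * (K ^ n / n.factorial) := integral_mul_const _ _)
  have h1 : ∀ n : ℕ, ∫ y in Set.Iic x, f y * (F y ^ n / n.factorial) =
      F x ^ (n + 1) / (n + 1).factorial := fun n => by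
    have h := integral_mul_primitive_pow hf n x
    simp_rw [← mul_div_assoc]
    rw [integral_div, h, div_div, Nat.factorial_succ]
    push_cast; rfl
  simp_rw [h1] at hs
  have hexp : ∀ z : ℂ, HasSum (fun n : ℕ => z ^ n / n.factorial) (Complex.exp z) := fun z => by
    rw [Complex.exp_eq_exp_ℂ]; exact NormedSpace.expSeries_div_hasSum_exp z
  have h2 : ∀ y, ∑' n : ℕ, f y * (F y ^ n / n.factorial) = f y * Complex.exp (F y) := fun y =>
    ((hexp (F y)).mul_left (f y)).tsum_eq
  simp_rw [h2] at hs
  have h3 := (hasSum_nat_add_iff' 1).2 (hexp (F x))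
  simp only [Finset.sum_range_one, pow_zero, Nat.factorial_zero, Nat.cast_one, div_one] at h3
  exact hs.unique h3

theorem integral_mul_rexp_primitive {f : ℝ → ℝ} (hf : Integrable f) (x : ℝ) :
    ∫ y in Set.Iic x, f y * Real.exp (∫ z in Set.Iic y, f z) =
      Real.exp (∫ y in Set.Iic x, f y) - 1 := by
  have h := integral_mul_exp_primitive (f := fun y => (f y : ℂ)) hf.ofReal x
  simp_rw [integral_complex_ofReal] at h
  apply Complex.ofReal_injective
  rw [← integral_complex_ofReal]
  push_cast
  exact h

end Primitive

/-- Grönwall's inequality on the line for a bounded function and an integrable weight. -/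
theorem gronwall_Iic {f g : ℝ → ℝ} {c M : ℝ} (hc : 0 ≤ c) (hf : AEStronglyMeasurable f)
    (hfM : ∀ᵐ x, |f x| ≤ M) (hg : Integrable g) (hg0 : ∀ x, 0 ≤ g x)
    (h : ∀ᵐ x, f x ≤ c + ∫ y in Set.Iic x, g y * f y) :
    ∀ᵐ x, f x ≤ c * Real.exp (∫ y in Set.Iic x, g y) := by
  set m : ℝ → ℝ := fun x => ∫ y in Set.Iic x, g y with hm
  have hmc : Continuous m := continuous_primitive_Iic hg
  have hmK : ∀ x, ‖m x‖ ≤ ∫ y, ‖g y‖ := norm_primitive_Iic_le hg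
  have hgf : Integrable fun y => g y * f y := hg.mul_bdd (c := M) hf hfM
  have i1 : ∀ n : ℕ, Integrable fun y => g y * m y ^ n := fun n =>
    integrable_mul_of_continuous_bdd hg (hmc.pow n) (K := (∫ y, ‖g y‖) ^ n) (fun x => by
        rw [norm_pow]; exact pow_le_pow_left₀ (norm_nonneg _) (hmK x) n)
  have i2 : Integrable fun y => g y * Real.exp (m y) :=
    integrable_mul_of_continuous_bdd hg (Real.continuous_exp.comp hmc)
      (K := Real.exp (∫ y, ‖g y‖)) (fun x => by
        rw [Real.norm_eq_abs, abs_of_pos (Real.exp_pos _)]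
        exact Real.exp_le_exp.2 ((le_abs_self _).trans (hmK x)))
  -- Inserting the bound into the hypothesis reproduces `c * exp m` and turns `m ^ n / n!` into the
  -- next term. The a priori bound `M` starts the induction and is gone in the limit `n → ∞`.
  have step : ∀ n : ℕ, ∀ᵐ x, f x ≤ c * Real.exp (m x) + M * (m x ^ n / n.factorial) := by
    intro n
    induction n with
    | zero =>
      filter_upwards [hfM] with x hx
      have hm0 : 0 ≤ m x := setIntegral_nonneg measurableSet_Iic fun y _ => hg0 y
      simp only [pow_zero, Nat.factorial_zero, Nat.cast_one, div_one, mul_one]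
      have h1 : f x ≤ M := (le_abs_self _).trans hx
      have := mul_nonneg hc (Real.exp_pos (m x)).le
      linarith
    | succ n ih =>
      filter_upwards [h] with x hx
      have hle : ∫ y in Set.Iic x, g y * f y ≤
          ∫ y in Set.Iic x, (c * (g y * Real.exp (m y)) +
            (M / n.factorial) * (g y * m y ^ n)) := by
        refine integral_mono_ae hgf.integrableOn
          (((i2.const_mul _).add ((i1 n).const_mul _)).integrableOn) ?_
        filter_upwards [ae_restrict_of_ae ih] with y hy
        calc g y * f y ≤ g y * (c * Real.exp (m y) + M * (m y ^ n / n.factorial)) :=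
              mul_le_mul_of_nonneg_left hy (hg0 y)
          _ = _ := by ring
      rw [integral_add (i2.const_mul _).integrableOn ((i1 n).const_mul _).integrableOn,
        integral_const_mul, integral_const_mul, integral_mul_primitive_pow hg,
        integral_mul_rexp_primitive hg] at hle
      have e : M / n.factorial * (m x ^ (n + 1) / (n + 1)) =
          M * (m x ^ (n + 1) / (n + 1).factorial) := by
        rw [Nat.factorial_succ]; push_cast; field_simp
      rw [e] at hle
      linarith
  filter_upwards [ae_all_iff.2 step] with x hx
  refine ge_of_tendsto' (x := atTop) ?_ hx
  have := ((FloorSemiring.tendsto_pow_div_factorial_atTop (m x)).const_mul M).const_add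
    (c * Real.exp (m x))
  simpa using this

end MTM

/-! ### Volterra equations depending holomorphically on a parameter. -/

namespace MTM

/-- A dominated integral of holomorphic functions is holomorphic. -/
theorem differentiableOn_integral_of_dominated {α E : Type*} [MeasurableSpace α] {μ : Measure α}
    [NormedAddCommGroup E] [NormedSpace ℂ E] {U : Set ℂ} (hU : IsOpen U)
    {F : ℂ → α → E} {bound : α → ℝ} (hm : ∀ l ∈ U, AEStronglyMeasurable (F l) μ)
    (hd : ∀ᵐ y ∂μ, DifferentiableOn ℂ (fun l => F l y) U)
    (hb : ∀ᵐ y ∂μ, ∀ l ∈ U, ‖F l y‖ ≤ bound y) (hbi : Integrable bound μ) :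
    DifferentiableOn ℂ (fun l => ∫ y, F l y ∂μ) U := by
  intro l₀ hl₀
  obtain ⟨R, hR, hRU⟩ := Metric.isOpen_iff.1 hU l₀ hl₀
  set r := R / 2 with hr
  have hr0 : 0 < r := by positivity
  have hsub : ∀ z ∈ Metric.ball l₀ r, Metric.closedBall z (r / 2) ⊆ U := fun z hz w hw => by
    refine hRU ?_
    rw [Metric.mem_ball] at hz ⊢
    rw [Metric.mem_closedBall] at hw
    linarith [dist_triangle w z l₀]
  have hsub' : Metric.ball l₀ r ⊆ U := fun z hz => hsub z hz (Metric.mem_closedBall_self (by positivity))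
  have hda : ∀ᵐ y ∂μ, ∀ z ∈ Metric.ball l₀ r,
      HasDerivAt (fun l => F l y) (deriv (fun l => F l y) z) z := by
    filter_upwards [hd] with y hy z hz
    exact (hy.differentiableAt (hU.mem_nhds (hsub' hz))).hasDerivAt
  -- The derivative in the parameter is measurable in `y` as a limit of difference quotients along a
  -- sequence of increments tending to zero.
  have hmeas : AEStronglyMeasurable (fun y => deriv (fun l => F l y) l₀) μ := by
    set h : ℕ → ℂ := fun n => ((r / 2 * (1 / ((n : ℝ) + 1)) : ℝ) : ℂ) with hh
    have hpos : ∀ n : ℕ, 0 < r / 2 * (1 / ((n : ℝ) + 1)) := fun n => by positivity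
    have h0 : Tendsto h atTop (𝓝[≠] 0) := by
      refine tendsto_nhdsWithin_iff.2 ⟨?_, Eventually.of_forall fun n => ?_⟩
      · have := (tendsto_one_div_add_atTop_nhds_zero_nat (𝕜 := ℝ)).const_mul (r / 2)
        rw [mul_zero] at this
        have h2 := (Complex.continuous_ofReal.tendsto 0).comp this
        rwa [Complex.ofReal_zero] at h2
      · exact Complex.ofReal_ne_zero.2 (hpos n).ne'
    have hU' : ∀ n, l₀ + h n ∈ U := fun n => hsub' (by
      rw [Metric.mem_ball, dist_self_add_left, hh, Complex.norm_real, Real.norm_eq_abs,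
        abs_of_pos (hpos n)]
      have : 1 / ((n : ℝ) + 1) ≤ 1 := by
        rw [div_le_one (by positivity)]; linarith [n.cast_nonneg (α := ℝ)]
      nlinarith)
    refine aestronglyMeasurable_of_tendsto_ae atTop (f := fun n y => (h n)⁻¹ • (F (l₀ + h n) y - F l₀ y))
      (fun n => ((hm _ (hU' n)).sub (hm _ hl₀)).const_smul _) ?_
    filter_upwards [hda] with y hy
    exact (hy l₀ (Metric.mem_ball_self hr0)).tendsto_slope_zero.comp h0
  have hF0 : Integrable (F l₀) μ := hbi.mono' (hm _ hl₀) (hb.mono fun y hy => hy _ hl₀)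
  refine ((hasDerivAt_integral_of_dominated_loc_of_deriv_le (Metric.ball_mem_nhds l₀ hr0)
    ((hU.mem_nhds hl₀ |> fun h => mem_of_superset h hm)) hF0 (F' := fun l y => deriv (fun l => F l y) l)
    hmeas ?_ (hbi.div_const (r / 2)) hda).2).differentiableAt.differentiableWithinAt
  -- Cauchy's estimate on circles of radius `r / 2` bounds the derivative by `bound y / (r / 2)`, so
  -- dominating the functions themselves is enough.
  filter_upwards [hd, hb] with y hy hby z hz
  refine Complex.norm_deriv_le_of_forall_mem_sphere_norm_le (by positivity) ?_
    fun w hw => hby w (hsub z hz (Metric.sphere_subset_closedBall hw))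
  exact (hy.mono ((closure_minimal Metric.ball_subset_closedBall
    Metric.isClosed_closedBall).trans (hsub z hz))).diffContOnCl

section Volterra

variable {E : Type*} [NormedAddCommGroup E] [NormedSpace ℂ E]
  {S U : Set ℂ} {N : ℂ → ℝ → ℝ → E →L[ℂ] E} {g : ℝ → ℝ}

/-- Kernels of Volterra equations on `(-∞, x]` depending on a parameter, dominated by `g`. -/
structure IsVolterraKernel (S U : Set ℂ) (N : ℂ → ℝ → ℝ → E →L[ℂ] E) (g : ℝ → ℝ) : Prop where
  isOpen : IsOpen U
  subset : U ⊆ S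
  integrable : Integrable g
  nonneg : ∀ y, 0 ≤ g y
  measurable : ∀ l ∈ S, ∀ x, AEStronglyMeasurable (N l x)
  bound : ∀ l ∈ S, ∀ x y, y ≤ x → ‖N l x y‖ ≤ g y
  continuous : ∀ l ∈ S, ∀ y, Continuous fun x => N l x y
  continuousOn : ∀ x y, ContinuousOn (fun l => N l x y) S
  differentiableOn : ∀ x y, DifferentiableOn ℂ (fun l => N l x y) U

/-- Regularity of parameter-dependent functions on the line that Volterra operators preserve. -/
structure IsVolterraFamily (S U : Set ℂ) (w : ℂ → ℝ → E) (b : ℝ → ℝ) : Prop where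
  continuous : ∀ l ∈ S, Continuous (w l)
  bound : ∀ l ∈ S, ∀ x, ‖w l x‖ ≤ b x
  continuousOn : ∀ x, ContinuousOn (fun l => w l x) S
  differentiableOn : ∀ x, DifferentiableOn ℂ (fun l => w l x) U

theorem IsVolterraKernel.aestronglyMeasurable_apply (h : IsVolterraKernel S U N g) {l : ℂ}
    (hl : l ∈ S) (x : ℝ) {w : ℝ → E} (hw : AEStronglyMeasurable w) :
    AEStronglyMeasurable fun y => N l x y (w y) :=
  (ContinuousLinearMap.apply ℂ E).flip.aestronglyMeasurable_comp₂ (h.measurable l hl x) hw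

/-- One Picard iteration. Every regularity property passes through the integral by dominated
convergence with the same majorant `g * b`, and the new bound is the primitive of that majorant. -/
theorem IsVolterraKernel.step (h : IsVolterraKernel S U N g) {w : ℂ → ℝ → E} {b : ℝ → ℝ}
    (hw : IsVolterraFamily S U w b) (hgb : Integrable fun y => g y * b y) :
    IsVolterraFamily S U (fun l x => ∫ y in Set.Iic x, N l x y (w l y))
      (fun x => ∫ y in Set.Iic x, g y * b y) := by
  have hbd : ∀ l ∈ S, ∀ x y, y ≤ x → ‖N l x y (w l y)‖ ≤ g y * b y := fun l hl x y hy =>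
    ((N l x y).le_opNorm _).trans
      (mul_le_mul (h.bound l hl x y hy) (hw.bound l hl y) (norm_nonneg _) (h.nonneg y))
  have hae : ∀ x : ℝ, ∀ᵐ y ∂volume.restrict (Set.Iic x), y ≤ x := fun x =>
    ae_restrict_mem measurableSet_Iic
  have hmeas : ∀ l ∈ S, ∀ x, AEStronglyMeasurable fun y => N l x y (w l y) := fun l hl x =>
    h.aestronglyMeasurable_apply hl x (hw.continuous l hl).aestronglyMeasurable
  refine ⟨fun l hl => ?_, fun l hl x => ?_, fun x => ?_, fun x => ?_⟩
  -- The variable `x` occurs in the kernel and in the domain of integration. As an indicator on the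
  -- whole line, the integrand is continuous at `x₀` for every `y ≠ x₀`, that is, for almost every
  -- `y`.
  · simp_rw [← integral_indicator measurableSet_Iic]
    refine continuous_iff_continuousAt.2 fun x₀ => ?_
    refine continuousAt_of_dominated (bound := fun y => ‖g y * b y‖)
      (Eventually.of_forall fun x =>
        (hmeas l hl x).indicator (measurableSet_Iic (a := x)))
      (Eventually.of_forall fun x => Eventually.of_forall fun y => ?_) hgb.norm ?_
    · by_cases hy : y ≤ x
      · rw [Set.indicator_of_mem (by exact hy)]
        exact (hbd l hl x y hy).trans (le_abs_self _)
      · rw [Set.indicator_of_notMem (by exact hy), norm_zero]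
        positivity
    · have : ∀ᵐ y : ℝ, y ≠ x₀ := by simp [ae_iff]
      filter_upwards [this] with y hy
      rcases lt_or_gt_of_ne hy with hy | hy
      · have hc : ContinuousAt (fun x => N l x y (w l y)) x₀ :=
          ((h.continuous l hl y).clm_apply continuous_const).continuousAt
        refine hc.congr ?_
        filter_upwards [lt_mem_nhds hy] with x hx
        exact (Set.indicator_of_mem (s := Set.Iic x) (Set.mem_Iic.2 hx.le)
          (fun y => N l x y (w l y))).symm
      · have hc : ContinuousAt (fun _ => (0 : E)) x₀ := continuousAt_const
        refine hc.congr ?_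
        filter_upwards [gt_mem_nhds hy] with x hx
        exact (Set.indicator_of_notMem (s := Set.Iic x) (Set.notMem_Iic.2 hx)
          (fun y => N l x y (w l y))).symm
  · refine norm_integral_le_of_norm_le hgb.integrableOn ?_
    filter_upwards [hae x] with y hy using hbd l hl x y hy
  · refine continuousOn_of_dominated (bound := fun y => g y * b y)
      (fun l hl => (hmeas l hl x).restrict) (fun l hl => ?_) hgb.integrableOn ?_
    · filter_upwards [hae x] with y hy using hbd l hl x y hy
    · exact Eventually.of_forall fun y => (h.continuousOn x y).clm_apply (hw.continuousOn y)
  · refine differentiableOn_integral_of_dominated (bound := fun y => g y * b y) h.isOpen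
      (fun l hl => (hmeas l (h.subset hl) x).restrict) ?_ ?_ hgb.integrableOn
    · exact Eventually.of_forall fun y =>
        (h.differentiableOn x y).clm_apply (hw.differentiableOn y)
    · filter_upwards [hae x] with y hy l hl using hbd l (h.subset hl) x y hy

/-- Neumann series: the `n`-th iterate `W n` of the constant `e` is bounded by `‖e‖ m(x)^n / n!`
with `m` the primitive of `g`. Replacing `m(x)` by the full integral of `g` gives a summable bound
uniform in `x` and in `l ∈ S`, so continuity and holomorphy pass to the sum. -/
theorem IsVolterraKernel.exists_solution [CompleteSpace E] (h : IsVolterraKernel S U N g) (e : E) :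
    ∃ (Φ : ℂ → ℝ → E) (K : ℝ), IsVolterraFamily S U Φ (fun _ => K) ∧
      ∀ l ∈ S, ∀ x, Φ l x = e + ∫ y in Set.Iic x, N l x y (Φ l y) := by
  set m : ℝ → ℝ := fun x => ∫ y in Set.Iic x, g y with hm
  set K := ∫ y, g y with hK
  have hmc : Continuous m := continuous_primitive_Iic h.integrable
  have hm0 : ∀ x, 0 ≤ m x := fun x => setIntegral_nonneg measurableSet_Iic fun y _ => h.nonneg y
  have hmK : ∀ x, m x ≤ K := fun x =>
    setIntegral_le_integral h.integrable (Eventually.of_forall h.nonneg)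
  have hi : ∀ n : ℕ, Integrable fun y => g y * (‖e‖ * (m y ^ n / n.factorial)) := fun n =>
    integrable_mul_of_continuous_bdd h.integrable (continuous_const.mul ((hmc.pow n).div_const _))
      (K := ‖e‖ * (K ^ n / n.factorial)) (fun x => by
        rw [Real.norm_of_nonneg (by have := hm0 x; positivity)]
        have := hm0 x
        gcongr
        exact hmK x)
  let W : ℕ → ℂ → ℝ → E := fun n => Nat.rec (fun _ _ => e)
    (fun _ w l x => ∫ y in Set.Iic x, N l x y (w l y)) n
  have hW : ∀ n : ℕ, IsVolterraFamily S U (W n) (fun x => ‖e‖ * (m x ^ n / n.factorial)) := by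
    intro n
    induction n with
    | zero =>
      exact ⟨fun _ _ => continuous_const, fun _ _ _ => by simp [W], fun _ => continuousOn_const,
        fun _ => differentiableOn_const _⟩
    | succ n ih =>
      have h1 := h.step ih (hi n)
      refine ⟨h1.continuous, fun l hl x => (h1.bound l hl x).trans_eq ?_, h1.continuousOn,
        h1.differentiableOn⟩
      have h2 := integral_mul_primitive_pow h.integrable n x
      calc ∫ y in Set.Iic x, g y * (‖e‖ * (m y ^ n / n.factorial))
          = ∫ y in Set.Iic x, (‖e‖ / n.factorial) * (g y * m y ^ n) := by
            congr 1; ext y; ring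
        _ = _ := by
            rw [integral_const_mul, h2, Nat.factorial_succ]
            push_cast
            field_simp
            rfl
  set B : ℕ → ℝ := fun n => ‖e‖ * (K ^ n / n.factorial) with hB
  have hBs : Summable B := (Real.summable_pow_div_factorial K).mul_left _
  have hWB : ∀ n, ∀ l ∈ S, ∀ x, ‖W n l x‖ ≤ B n := fun n l hl x =>
    ((hW n).bound l hl x).trans (by
      have := hm0 x
      simp only [hB]
      gcongr
      exact hmK x)
  have hsum : ∀ l ∈ S, ∀ x, Summable fun n => W n l x := fun l hl x =>
    hBs.of_norm_bounded fun n => hWB n l hl x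
  refine ⟨fun l x => ∑' n, W n l x, ∑' n, B n, ⟨fun l hl => ?_, fun l hl x => ?_, fun x => ?_,
    fun x => ?_⟩, fun l hl x => ?_⟩
  · exact continuous_tsum (fun n => (hW n).continuous l hl) hBs fun n x => hWB n l hl x
  · exact tsum_of_norm_bounded hBs.hasSum fun n => hWB n l hl x
  · exact continuousOn_tsum (fun n => (hW n).continuousOn x) hBs fun n l hl => hWB n l hl x
  · exact Complex.differentiableOn_tsum_of_summable_norm hBs
      (fun n => (hW n).differentiableOn x) h.isOpen fun n l hl => hWB n l (h.subset hl) x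
  · beta_reduce
    -- The term of index zero is `e`; the shifted series is the integral operator applied term by
    -- term, and sum and integral are exchanged by absolute summability.
    rw [(hsum l hl x).tsum_eq_zero_add]
    congr 1
    have hae : ∀ᵐ y ∂volume.restrict (Set.Iic x), y ≤ x := ae_restrict_mem measurableSet_Iic
    have hnb : ∀ n, ∀ᵐ y ∂volume.restrict (Set.Iic x), ‖N l x y (W n l y)‖ ≤ g y * B n := fun n => by
      filter_upwards [hae] with y hy
      exact ((N l x y).le_opNorm _).trans
        (mul_le_mul (h.bound l hl x y hy) (hWB n l hl y) (norm_nonneg _) (h.nonneg y))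
    have hint : ∀ n, Integrable (fun y => N l x y (W n l y)) (volume.restrict (Set.Iic x)) :=
      fun n => (h.integrable.mul_const _).integrableOn.mono'
        (h.aestronglyMeasurable_apply hl x
          ((hW n).continuous l hl).aestronglyMeasurable).restrict (hnb n)
    have hs := hasSum_integral_of_summable_integral_norm hint (by
      refine Summable.of_nonneg_of_le (fun n => integral_nonneg fun _ => norm_nonneg _)
        (fun n => ?_) (hBs.mul_left (m x))
      rw [← integral_mul_const]
      exact integral_mono_ae (hint n).norm (h.integrable.mul_const _).integrableOn (hnb n))
    refine hs.tsum_eq.trans (integral_congr_ae (Eventually.of_forall fun y => ?_))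
    exact ((N l x y).map_tsum (hsum l hl y)).symm

end Volterra

end MTM

/-! ### Exponential integrals in the left half plane: integration by parts and a Riemann–Lebesgue
lemma. -/

namespace MTM

/-- Grönwall's inequality `gronwall_Iic` for an inequality that holds everywhere. -/
theorem gronwall_Iic_everywhere {f g : ℝ → ℝ} {c M : ℝ} (hc : 0 ≤ c) (hf : Continuous f)
    (hfM : ∀ x, |f x| ≤ M) (hg : Integrable g) (hg0 : ∀ x, 0 ≤ g x)
    (h : ∀ x, f x ≤ c + ∫ y in Set.Iic x, g y * f y) (x : ℝ) :
    f x ≤ c * Real.exp (∫ y, g y) := by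
  have h1 := gronwall_Iic hc hf.aestronglyMeasurable (Eventually.of_forall hfM) hg hg0
    (Eventually.of_forall h)
  have h2 : ∀ᵐ x, f x ≤ c * Real.exp (∫ y, g y) := by
    filter_upwards [h1] with x hx
    refine hx.trans (mul_le_mul_of_nonneg_left (Real.exp_le_exp.2 ?_) hc)
    exact setIntegral_le_integral hg (Eventually.of_forall hg0)
  have h4 : IsClosed {x | f x ≤ c * Real.exp (∫ y, g y)} := isClosed_le hf continuous_const
  exact h4.closure_subset (Measure.dense_of_ae h2 x)

/-- `∫_{-∞}^x e^{θ (x - y)} f(y) dy`. -/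
noncomputable def oscInt (θ : ℂ) (f : ℝ → ℂ) (x : ℝ) : ℂ :=
  ∫ y in Set.Iic x, Complex.exp (θ * ((x - y : ℝ) : ℂ)) * f y

theorem norm_exp_mul_ofReal_le_one {θ : ℂ} (hθ : θ.re ≤ 0) {t : ℝ} (ht : 0 ≤ t) :
    ‖Complex.exp (θ * (t : ℂ))‖ ≤ 1 := by
  rw [Complex.norm_exp, Complex.re_mul_ofReal]
  exact Real.exp_le_one_iff.2 (mul_nonpos_of_nonpos_of_nonneg hθ ht)

theorem norm_oscKernel_mul_le {θ : ℂ} (hθ : θ.re ≤ 0) (f : ℝ → ℂ) {x y : ℝ} (h : y ≤ x) :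
    ‖Complex.exp (θ * ((x - y : ℝ) : ℂ)) * f y‖ ≤ ‖f y‖ := by
  rw [norm_mul]
  exact mul_le_of_le_one_left (norm_nonneg _) (norm_exp_mul_ofReal_le_one hθ (sub_nonneg.2 h))

theorem continuous_oscKernel (θ : ℂ) (x : ℝ) :
    Continuous fun y : ℝ => Complex.exp (θ * ((x - y : ℝ) : ℂ)) := by fun_prop

theorem integrableOn_oscInt {θ : ℂ} (hθ : θ.re ≤ 0) {f : ℝ → ℂ} (hf : Integrable f) (x : ℝ) :
    IntegrableOn (fun y => Complex.exp (θ * ((x - y : ℝ) : ℂ)) * f y) (Set.Iic x) := by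
  refine Integrable.mono' hf.norm.integrableOn
    ((continuous_oscKernel θ x).aestronglyMeasurable.mul hf.1).restrict ?_
  filter_upwards [ae_restrict_mem measurableSet_Iic] with y hy using norm_oscKernel_mul_le hθ f hy

theorem oscInt_add {θ : ℂ} (hθ : θ.re ≤ 0) {f g : ℝ → ℂ} (hf : Integrable f) (hg : Integrable g)
    (x : ℝ) : oscInt θ (fun y => f y + g y) x = oscInt θ f x + oscInt θ g x := by
  simp only [oscInt, mul_add]
  exact integral_add (integrableOn_oscInt hθ hf x) (integrableOn_oscInt hθ hg x)

theorem oscInt_const_mul (θ c : ℂ) (f : ℝ → ℂ) (x : ℝ) :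
    oscInt θ (fun y => c * f y) x = c * oscInt θ f x := by
  simp only [oscInt, mul_left_comm _ c]
  exact integral_const_mul c _

theorem norm_oscInt_le {θ : ℂ} (hθ : θ.re ≤ 0) {f : ℝ → ℂ} {h : ℝ → ℝ} (hh : Integrable h)
    (H : ∀ y, ‖f y‖ ≤ h y) (x : ℝ) : ‖oscInt θ f x‖ ≤ ∫ y in Set.Iic x, h y := by
  refine norm_integral_le_of_norm_le hh.integrableOn ?_
  filter_upwards [ae_restrict_mem measurableSet_Iic] with y hy
  exact (norm_oscKernel_mul_le hθ f hy).trans (H y)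

theorem norm_integral_Iic_le {f : ℝ → ℂ} {h : ℝ → ℝ} (hh : Integrable h)
    (H : ∀ y, ‖f y‖ ≤ h y) (x : ℝ) : ‖∫ y in Set.Iic x, f y‖ ≤ ∫ y in Set.Iic x, h y :=
  norm_integral_le_of_norm_le hh.integrableOn (Eventually.of_forall H)

theorem integral_Iic_le_integral {h : ℝ → ℝ} (hh : Integrable h) (h0 : ∀ y, 0 ≤ h y) (x : ℝ) :
    ∫ y in Set.Iic x, h y ≤ ∫ y, h y :=
  setIntegral_le_integral hh (Eventually.of_forall h0)

theorem norm_oscInt_le_integral {θ : ℂ} (hθ : θ.re ≤ 0) {f : ℝ → ℂ} (hf : Integrable f) (x : ℝ) :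
    ‖oscInt θ f x‖ ≤ ∫ y, ‖f y‖ :=
  (norm_oscInt_le hθ hf.norm (fun _ => le_rfl) x).trans
    (integral_Iic_le_integral hf.norm (fun _ => norm_nonneg _) x)

theorem integrableOn_exp_kernel {θ : ℂ} (hθ : θ.re < 0) (x : ℝ) :
    IntegrableOn (fun y : ℝ => Complex.exp (θ * ((x - y : ℝ) : ℂ))) (Set.Iic x) := by
  have h := (integrableOn_exp_mul_complex_Iic (a := -θ) (by simpa using hθ) x).const_mul
    (Complex.exp (θ * x))
  refine IntegrableOn.congr_fun h (fun y _ => ?_) measurableSet_Iic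
  rw [← Complex.exp_add]
  congr 1; push_cast; ring

theorem intervalIntegral_exp_kernel {θ : ℂ} (hθ : θ ≠ 0) (x z : ℝ) :
    ∫ y in z..x, Complex.exp (θ * ((x - y : ℝ) : ℂ)) =
      θ⁻¹ * (Complex.exp (θ * ((x - z : ℝ) : ℂ)) - 1) := by
  have hd : ∀ y : ℝ, HasDerivAt (fun y : ℝ => -(θ⁻¹ * Complex.exp (θ * ((x - y : ℝ) : ℂ))))
      (Complex.exp (θ * ((x - y : ℝ) : ℂ))) y := fun y => by
    have h1 : HasDerivAt (fun y : ℝ => θ * ((x - y : ℝ) : ℂ)) (-θ) y := by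
      have := (((hasDerivAt_id y).const_sub x).ofReal_comp).const_mul θ
      simpa using this
    have h2 := (h1.cexp.const_mul θ⁻¹).neg
    convert! h2 using 1
    field_simp
  rw [intervalIntegral.integral_eq_sub_of_hasDerivAt (fun y _ => hd y)
    ((continuous_oscKernel θ x).intervalIntegrable _ _)]
  simp; ring

/-- Integration by parts in `oscInt`, for the primitive of an integrable function. -/
theorem mul_oscInt_primitive {θ : ℂ} (hθ : θ.re < 0) {f : ℝ → ℂ} (hf : Integrable f) (x : ℝ) :
    θ * oscInt θ (fun y => ∫ z in Set.Iic y, f z) x = oscInt θ f x - ∫ y in Set.Iic x, f y := by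
  have hθ0 : θ ≠ 0 := fun h => by simp [h] at hθ
  -- Since `Re θ < 0`, the kernel cut off at `x` is integrable on the line. The formula is then
  -- Fubini with `k = 1`, the inner integral of `p` being explicit.
  set p : ℝ → ℂ := (Set.Iic x).indicator fun y => Complex.exp (θ * ((x - y : ℝ) : ℂ)) with hp
  have hpi : Integrable p := (integrable_indicator_iff measurableSet_Iic).2
    (integrableOn_exp_kernel hθ x)
  have h := (integral_Iic_mul_integral_swap hpi hf (k := fun _ => (1 : ℂ)) continuous_const
    (fun _ _ => by simp) x).2
  simp only [one_mul] at h
  have h1 : oscInt θ (fun y => ∫ z in Set.Iic y, f z) x =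
      ∫ y in Set.Iic x, p y * ∫ z in Set.Iic y, f z := by
    refine setIntegral_congr_fun measurableSet_Iic fun y hy => ?_
    simp only [hp, Set.indicator_of_mem hy]
  have h2 : ∀ z ∈ Set.Iic x, f z * ∫ y in Set.Ioc z x, p y =
      θ⁻¹ * (Complex.exp (θ * ((x - z : ℝ) : ℂ)) * f z - f z) := fun z hz => by
    have : ∫ y in Set.Ioc z x, p y = ∫ y in z..x, Complex.exp (θ * ((x - y : ℝ) : ℂ)) := by
      rw [intervalIntegral.integral_of_le hz]
      refine setIntegral_congr_fun measurableSet_Ioc fun y hy => ?_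
      simp only [hp, Set.indicator_of_mem (show y ∈ Set.Iic x from hy.2)]
    rw [this, intervalIntegral_exp_kernel hθ0]
    ring
  rw [h1, h, setIntegral_congr_fun measurableSet_Iic h2, integral_const_mul,
    integral_sub (integrableOn_oscInt hθ.le hf x) hf.integrableOn, mul_inv_cancel_left₀ hθ0]
  rfl

/-- Integrability of both `F` and its derivative forces `F → 0` at `-∞`, so there is no boundary
term. -/
theorem eq_integral_Iic_deriv {F f : ℝ → ℂ} (hF : Integrable F) (hf : Integrable f)
    (hd : ∀ x, HasDerivAt F (f x) x) (x : ℝ) : F x = ∫ y in Set.Iic x, f y := by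
  have h0 := tendsto_zero_of_hasDerivAt_of_integrableOn_Iic (a := x) (fun y _ => hd y)
    hf.integrableOn hF.integrableOn
  rw [integral_Iic_of_hasDerivAt_of_tendsto' (fun y _ => hd y) hf.integrableOn h0, sub_zero]

/-- Integration by parts for the integral of `oscInt` against a differentiable function. -/
theorem mul_integral_mul_oscInt {θ : ℂ} (hθ : θ.re ≤ 0) {F f h : ℝ → ℂ} (hF : Integrable F)
    (hf : Integrable f) (hd : ∀ x, HasDerivAt F (f x) x) (hh : Integrable h) (x : ℝ) :
    θ * ∫ y in Set.Iic x, F y * oscInt θ h y =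
      F x * oscInt θ h x - (∫ y in Set.Iic x, f y * oscInt θ h y) - ∫ y in Set.Iic x, F y * h y := by
  have hk : Continuous fun t : ℝ => Complex.exp (θ * (t : ℂ)) := by fun_prop
  have hk1 : ∀ t : ℝ, 0 ≤ t → ‖Complex.exp (θ * (t : ℂ))‖ ≤ 1 :=
    fun t ht => norm_exp_mul_ofReal_le_one hθ ht
  have hFc : Continuous F := continuous_iff_continuousAt.2 fun x => (hd x).continuousAt
  have hFb : ∀ x, ‖F x‖ ≤ ∫ y, ‖f y‖ := fun x => by
    rw [eq_integral_Iic_deriv hF hf hd x]; exact norm_primitive_Iic_le hf x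
  have s1 := (integral_Iic_mul_integral_swap hF hh hk hk1 x).2
  obtain ⟨i2, s2⟩ := integral_Iic_mul_integral_swap hf hh hk hk1 x
  -- After the exchange of integrals the exponential is integrated in `y` over `[z, x]`, where the
  -- classical formula applies to `F`. Nothing is asked of `h` beyond integrability, and `Re θ = 0`
  -- is allowed.
  have key : ∀ z ∈ Set.Iic x,
      θ * (h z * ∫ y in Set.Ioc z x, Complex.exp (θ * ((y - z : ℝ) : ℂ)) * F y) =
      (F x * (Complex.exp (θ * ((x - z : ℝ) : ℂ)) * h z) -
        h z * ∫ y in Set.Ioc z x, Complex.exp (θ * ((y - z : ℝ) : ℂ)) * f y) - F z * h z := by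
    intro z hz
    rw [← intervalIntegral.integral_of_le hz, ← intervalIntegral.integral_of_le hz]
    have hde : ∀ y : ℝ, HasDerivAt (fun y : ℝ => Complex.exp (θ * ((y - z : ℝ) : ℂ)))
        (Complex.exp (θ * ((y - z : ℝ) : ℂ)) * θ) y := fun y => by
      have h1 : HasDerivAt (fun y : ℝ => θ * ((y - z : ℝ) : ℂ)) θ y := by
        have := (((hasDerivAt_id y).sub_const z).ofReal_comp).const_mul θ
        simpa using this
      exact h1.cexp
    have ibp := intervalIntegral.integral_mul_deriv_eq_deriv_mul (a := z) (b := x)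
      (fun y _ => hd y) (fun y _ => hde y) hf.intervalIntegrable
      (Continuous.intervalIntegrable (by fun_prop) _ _)
    have e1 : ∫ y in z..x, F y * (Complex.exp (θ * ((y - z : ℝ) : ℂ)) * θ) =
        θ * ∫ y in z..x, Complex.exp (θ * ((y - z : ℝ) : ℂ)) * F y := by
      rw [← intervalIntegral.integral_const_mul]
      congr 1; ext y; ring
    have e2 : ∫ y in z..x, f y * Complex.exp (θ * ((y - z : ℝ) : ℂ)) =
        ∫ y in z..x, Complex.exp (θ * ((y - z : ℝ) : ℂ)) * f y := by
      congr 1; ext y; ring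
    rw [e1, e2] at ibp
    rw [mul_left_comm, ibp]
    simp
    ring
  have i1 := (integrableOn_oscInt hθ hh x).const_mul (F x)
  have i3 : Integrable fun z => F z * h z :=
    (integrable_mul_of_continuous_bdd hh hFc hFb).congr (Eventually.of_forall fun y => mul_comm _ _)
  simp only [oscInt] at *
  rw [s1, s2, ← integral_const_mul, setIntegral_congr_fun measurableSet_Iic key,
    integral_sub (by exact i1.sub i2) i3.integrableOn, integral_sub i1 i2, integral_const_mul]

/-- Riemann–Lebesgue, uniformly in `x` and in the direction of `θ` within the open left half plane.
A smooth compactly supported `g` satisfies `‖θ‖ ‖oscInt θ g x‖ ≤ 2 ∫ ‖g'‖` by parts, and such `g`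
are dense in `L¹`, where `oscInt` is a contraction into bounded functions. -/
theorem exists_tendsto_zero_norm_oscInt_le {f : ℝ → ℂ} (hf : Integrable f) :
    ∃ δ : ℂ → ℝ, Tendsto δ (Bornology.cobounded ℂ) (𝓝 0) ∧
      ∀ θ : ℂ, θ.re < 0 → ∀ x, ‖oscInt θ f x‖ ≤ δ θ := by
  have hbdd : ∀ θ : ℂ, θ.re < 0 → BddAbove (Set.range fun x => ‖oscInt θ f x‖) := fun θ hθ =>
    ⟨∫ y, ‖f y‖, by rintro _ ⟨x, rfl⟩; exact norm_oscInt_le_integral hθ.le hf x⟩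
  classical
  -- The optimal bound is the supremum over `x`; the value `0` outside the half plane makes the
  -- limit meaningful along all of `cobounded ℂ`.
  refine ⟨fun θ => if θ.re < 0 then ⨆ x, ‖oscInt θ f x‖ else 0, ?_, fun θ hθ x => ?_⟩
  swap
  · beta_reduce
    rw [if_pos hθ]; exact le_ciSup (hbdd θ hθ) x
  rw [Metric.tendsto_nhds]
  intro ε hε
  obtain ⟨g, hgs, hgd, hgε⟩ := MemLp.exist_eLpNorm_sub_le (p := 1) (by simp) le_rfl
    (memLp_one_iff_integrable.2 hf) (ε := ε / 3) (by positivity)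
  have hgi : Integrable g := hgd.continuous.integrable_of_hasCompactSupport hgs
  have hgd1 : ContDiff ℝ 1 g := hgd.of_le (by exact_mod_cast le_top)
  have hg'c : Continuous (deriv g) := hgd1.continuous_deriv le_rfl
  have hg'i : Integrable (deriv g) := hg'c.integrable_of_hasCompactSupport hgs.deriv
  have hgD : ∀ x, HasDerivAt g (deriv g x) x := fun x =>
    (hgd1.differentiable (by simp) x).hasDerivAt
  have hfg : ∫ y, ‖f y - g y‖ ≤ ε / 3 := by
    rw [eLpNorm_one_eq_lintegral_enorm] at hgε
    have := integral_norm_eq_lintegral_enorm (hf.sub hgi).1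
    simp only [Pi.sub_apply] at this hgε
    rw [this]
    exact ENNReal.toReal_le_of_le_ofReal (by positivity) hgε
  set K := ∫ y, ‖deriv g y‖ with hK
  have hK0 : 0 ≤ K := integral_nonneg fun _ => norm_nonneg _
  -- Beyond `6 K / ε` the smooth part is at most `2 K / ‖θ‖ ≤ ε / 3`. The total `2 ε / 3` stays
  -- strictly below `ε` after the supremum is taken.
  filter_upwards [tendsto_norm_cobounded_atTop.eventually_ge_atTop (6 * K / ε + 1)] with θ hθ
  have hθp : 0 < ‖θ‖ := lt_of_lt_of_le (by positivity) hθ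
  rw [Real.dist_eq, sub_zero]
  split_ifs with hre
  · have hb : ∀ x, ‖oscInt θ f x‖ ≤ 2 * ε / 3 := fun x => by
      have e1 : oscInt θ f x = oscInt θ (fun y => f y - g y) x + oscInt θ g x := by
        have := oscInt_add hre.le (f := fun y => f y - g y) (hf.sub hgi) hgi x
        simpa only [sub_add_cancel] using this
      have e2 : g = fun y => ∫ z in Set.Iic y, deriv g z :=
        funext fun y => eq_integral_Iic_deriv hgi hg'i hgD y
      have e3 := mul_oscInt_primitive hre hg'i x
      rw [← e2] at e3
      have b1 : ‖oscInt θ (fun y => f y - g y) x‖ ≤ ε / 3 :=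
        (norm_oscInt_le_integral hre.le (hf.sub hgi) x).trans hfg
      have b2 : ‖θ‖ * ‖oscInt θ g x‖ ≤ K + K := by
        rw [← norm_mul, e3]
        exact (norm_sub_le _ _).trans (add_le_add (norm_oscInt_le_integral hre.le hg'i x)
          (norm_primitive_Iic_le hg'i x))
      have b3 : ‖oscInt θ g x‖ ≤ ε / 3 := by
        have : 6 * K / ε ≤ ‖θ‖ := by linarith
        rw [div_le_iff₀ hε] at this
        refine le_of_mul_le_mul_left (b2.trans ?_) hθp
        linarith
      rw [e1]
      linarith [norm_add_le (oscInt θ (fun y => f y - g y) x) (oscInt θ g x)]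
    have h0 : 0 ≤ ⨆ x, ‖oscInt θ f x‖ := Real.iSup_nonneg fun _ => norm_nonneg _
    rw [abs_of_nonneg h0]
    exact (ciSup_le hb).trans_lt (by linarith)
  · simpa using hε

end MTM

/-! ### The scalar Volterra system: leading order and the reduction of the first correction. -/

namespace MTM

/-- Coefficients of the Volterra system
`a = 1 + ∫ (A a + B b)`, `b = ∫ e^{θ (x - y)} (C a + D b)` on `(-∞, x]`,
where `A = A₁ + l⁻¹ A₂` and so on. -/
structure VolterraCoeff where
  (A₁ A₂ B₁ B₂ C₁ C₂ D₁ D₂ : ℝ → ℂ)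
  hA₁ : Integrable A₁
  hA₂ : Integrable A₂
  hB₁ : Integrable B₁
  hB₂ : Integrable B₂
  hC₁ : Integrable C₁
  hC₂ : Integrable C₂
  hD₁ : Integrable D₁
  hD₂ : Integrable D₂

/-- The phase `κ (l - l⁻¹)`. -/
noncomputable def phase (κ l : ℂ) : ℂ := κ * (l - l⁻¹)

theorem tendsto_phase {κ : ℂ} (hκ : κ ≠ 0) :
    Tendsto (phase κ) (Bornology.cobounded ℂ) (Bornology.cobounded ℂ) := by
  rw [← tendsto_norm_atTop_iff_cobounded]
  have h1 : Tendsto (fun l : ℂ => ‖κ‖ * (‖l‖ - 1)) (Bornology.cobounded ℂ) atTop :=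
    (tendsto_atTop_add_const_right _ (-1) tendsto_norm_cobounded_atTop).const_mul_atTop
      (norm_pos_iff.2 hκ)
  refine tendsto_atTop_mono' _ ?_ h1
  filter_upwards [tendsto_norm_cobounded_atTop.eventually_ge_atTop 1] with l hl
  rw [phase, norm_mul]
  refine mul_le_mul_of_nonneg_left ?_ (norm_nonneg _)
  have : ‖l⁻¹‖ ≤ 1 := by rw [norm_inv]; exact inv_le_one_of_one_le₀ hl
  linarith [norm_sub_norm_le l l⁻¹]

/-- The exchange rate between `θ⁻¹`, gained by each integration by parts, and the factor `l` of the
expansion. -/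
theorem tendsto_mul_inv_phase {κ : ℂ} (hκ : κ ≠ 0) :
    Tendsto (fun l => l * (phase κ l)⁻¹) (Bornology.cobounded ℂ) (𝓝 κ⁻¹) := by
  have h0 : Tendsto (fun l : ℂ => l⁻¹) (Bornology.cobounded ℂ) (𝓝 0) := tendsto_inv₀_cobounded
  have h1 : Tendsto (fun l : ℂ => (κ * (1 - l⁻¹ * l⁻¹))⁻¹) (Bornology.cobounded ℂ)
      (𝓝 (κ * (1 - 0 * 0))⁻¹) :=
    (((h0.mul h0).const_sub 1).const_mul κ).inv₀ (by simpa using hκ)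
  simp only [mul_zero, sub_zero, mul_one] at h1
  refine h1.congr' ?_
  filter_upwards [tendsto_norm_cobounded_atTop.eventually_gt_atTop 0] with l hl
  have hl0 : l ≠ 0 := norm_pos_iff.1 hl
  have : phase κ l = l * (κ * (1 - l⁻¹ * l⁻¹)) := by rw [phase]; field_simp
  rw [this, mul_inv l, mul_inv_cancel_left₀ hl0]

/-- The shape that Grönwall's inequality requires: `p` keeps the upper limit `x` and will contain
the unknown, while `k` is a source and becomes a constant. -/
theorem norm_integral_Iic_le_add {F : ℝ → ℂ} {p k : ℝ → ℝ} (hp : Integrable p) (hk : Integrable k)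
    (hk0 : ∀ y, 0 ≤ k y) (H : ∀ y, ‖F y‖ ≤ p y + k y) (x : ℝ) :
    ‖∫ y in Set.Iic x, F y‖ ≤ (∫ y in Set.Iic x, p y) + ∫ y, k y := by
  refine (norm_integral_Iic_le (hp.add hk) H x).trans ?_
  simp only [Pi.add_apply]
  rw [integral_add hp.integrableOn hk.integrableOn]
  exact add_le_add le_rfl (integral_Iic_le_integral hk hk0 x)

theorem norm_oscInt_le_add {θ : ℂ} (hθ : θ.re ≤ 0) {F : ℝ → ℂ} {p k : ℝ → ℝ} (hp : Integrable p)
    (hk : Integrable k) (hk0 : ∀ y, 0 ≤ k y) (H : ∀ y, ‖F y‖ ≤ p y + k y) (x : ℝ) :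
    ‖oscInt θ F x‖ ≤ (∫ y in Set.Iic x, p y) + ∫ y, k y := by
  refine (norm_oscInt_le hθ (hp.add hk) H x).trans ?_
  simp only [Pi.add_apply]
  rw [integral_add hp.integrableOn hk.integrableOn]
  exact add_le_add le_rfl (integral_Iic_le_integral hk hk0 x)

namespace VolterraCoeff

variable (c : VolterraCoeff)

/-- The coefficient at the spectral parameter `l`. -/
noncomputable def A (l : ℂ) (y : ℝ) : ℂ := c.A₁ y + l⁻¹ * c.A₂ y
/-- The coefficient at the spectral parameter `l`. -/
noncomputable def B (l : ℂ) (y : ℝ) : ℂ := c.B₁ y + l⁻¹ * c.B₂ y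
/-- The coefficient at the spectral parameter `l`. -/
noncomputable def C (l : ℂ) (y : ℝ) : ℂ := c.C₁ y + l⁻¹ * c.C₂ y
/-- The coefficient at the spectral parameter `l`. -/
noncomputable def D (l : ℂ) (y : ℝ) : ℂ := c.D₁ y + l⁻¹ * c.D₂ y

theorem integrable_A (l : ℂ) : Integrable (c.A l) := c.hA₁.add (c.hA₂.const_mul _)
theorem integrable_B (l : ℂ) : Integrable (c.B l) := c.hB₁.add (c.hB₂.const_mul _)
theorem integrable_C (l : ℂ) : Integrable (c.C l) := c.hC₁.add (c.hC₂.const_mul _)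
theorem integrable_D (l : ℂ) : Integrable (c.D l) := c.hD₁.add (c.hD₂.const_mul _)

theorem norm_add_inv_mul_le {l : ℂ} (hl : 1 ≤ ‖l‖) (p q : ℂ) : ‖p + l⁻¹ * q‖ ≤ ‖p‖ + ‖q‖ := by
  refine (norm_add_le _ _).trans (add_le_add le_rfl ?_)
  rw [norm_mul, norm_inv]
  exact mul_le_of_le_one_left (norm_nonneg _) (inv_le_one_of_one_le₀ hl)

/-- An integrable majorant of all coefficients. -/
noncomputable def weight (y : ℝ) : ℝ :=
  (‖c.A₁ y‖ + ‖c.A₂ y‖) + (‖c.B₁ y‖ + ‖c.B₂ y‖) + (‖c.C₁ y‖ + ‖c.C₂ y‖) + (‖c.D₁ y‖ + ‖c.D₂ y‖)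

theorem integrable_weight : Integrable c.weight :=
  (((c.hA₁.norm.add c.hA₂.norm).add (c.hB₁.norm.add c.hB₂.norm)).add
    (c.hC₁.norm.add c.hC₂.norm)).add (c.hD₁.norm.add c.hD₂.norm)

theorem weight_nonneg (y : ℝ) : 0 ≤ c.weight y := by unfold weight; positivity

/-- Bounded continuous solutions of the system. -/
structure IsSol (κ l : ℂ) (a b : ℝ → ℂ) : Prop where
  continuous_a : Continuous a
  continuous_b : Continuous b
  bdd : ∃ K, ∀ x, ‖a x‖ ≤ K ∧ ‖b x‖ ≤ K
  eq_a : ∀ x, a x = 1 + ∫ y in Set.Iic x, (c.A l y * a y + c.B l y * b y)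
  eq_b : ∀ x, b x = oscInt (phase κ l) (fun y => c.C l y * a y + c.D l y * b y) x

/-- The exponential of the primitive of the leading diagonal coefficient. -/
noncomputable def lim (x : ℝ) : ℂ := Complex.exp (∫ y in Set.Iic x, c.A₁ y)

/-- The first correction to the diagonal component, relative to `lim`. -/
noncomputable def corr (κ : ℂ) (x : ℝ) : ℂ :=
  ∫ y in Set.Iic x, (c.A₂ y - κ⁻¹ * (c.B₁ y * c.C₁ y))

/-- A bound for `lim`. -/
noncomputable def limBound : ℝ := Real.exp (∫ y, ‖c.A₁ y‖)

theorem continuous_lim : Continuous c.lim :=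
  Complex.continuous_exp.comp (continuous_primitive_Iic c.hA₁)

theorem norm_lim_le (x : ℝ) : ‖c.lim x‖ ≤ c.limBound := by
  rw [lim, Complex.norm_exp]
  exact Real.exp_le_exp.2 ((Complex.re_le_norm _).trans (norm_primitive_Iic_le c.hA₁ x))

theorem limBound_pos : 0 < c.limBound := Real.exp_pos _

/-- `lim` solves the equation for `a` with `b` and all terms in `l⁻¹` dropped. -/
theorem lim_eq (x : ℝ) : c.lim x = 1 + ∫ y in Set.Iic x, c.A₁ y * c.lim y := by
  have h := integral_mul_exp_primitive c.hA₁ x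
  simp only [lim]
  rw [h]; ring

theorem integrable_mul_lim {f : ℝ → ℂ} (hf : Integrable f) : Integrable fun y => f y * c.lim y :=
  integrable_mul_of_continuous_bdd hf c.continuous_lim c.norm_lim_le

variable {c}

theorem IsSol.integrable_mul_a {κ l : ℂ} {a b : ℝ → ℂ} (h : c.IsSol κ l a b) {f : ℝ → ℂ}
    (hf : Integrable f) : Integrable fun y => f y * a y := by
  obtain ⟨K, hK⟩ := h.bdd
  exact integrable_mul_of_continuous_bdd hf h.continuous_a fun x => (hK x).1

theorem IsSol.integrable_mul_b {κ l : ℂ} {a b : ℝ → ℂ} (h : c.IsSol κ l a b) {f : ℝ → ℂ}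
    (hf : Integrable f) : Integrable fun y => f y * b y := by
  obtain ⟨K, hK⟩ := h.bdd
  exact integrable_mul_of_continuous_bdd hf h.continuous_b fun x => (hK x).2

variable (c)

/-- The pair `(a - lim, b)` satisfies a Volterra inequality whose sources are two terms in `‖l‖⁻¹`
and the oscillatory integral of `C₁ * lim`. All of them vanish at infinity uniformly in `x`. The
bound `δ` depends on the coefficients and `κ` only, not on the solution. -/
theorem exists_leading_bound {κ : ℂ} (hκ : κ ≠ 0) :
    ∃ δ : ℂ → ℝ, Tendsto δ (Bornology.cobounded ℂ) (𝓝 0) ∧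
      ∀ l a b, 1 < ‖l‖ → (phase κ l).re < 0 → c.IsSol κ l a b →
        ∀ x, ‖a x - c.lim x‖ ≤ δ l ∧ ‖b x‖ ≤ δ l := by
  obtain ⟨δ₁, hδ₁, hosc⟩ := exists_tendsto_zero_norm_oscInt_le (c.integrable_mul_lim c.hC₁)
  set M := c.limBound with hM
  have hM0 : 0 < M := c.limBound_pos
  have hinv : Tendsto (fun l : ℂ => ‖l‖⁻¹) (Bornology.cobounded ℂ) (𝓝 0) :=
    tendsto_norm_cobounded_atTop.inv_tendsto_atTop
  refine ⟨fun l => (‖l‖⁻¹ * (M * ∫ y, ‖c.A₂ y‖) + ‖l‖⁻¹ * (M * ∫ y, ‖c.C₂ y‖) + δ₁ (phase κ l)) *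
    Real.exp (∫ y, c.weight y), ?_, fun l a b hl hre h => ?_⟩
  · have := (((hinv.mul_const (M * ∫ y, ‖c.A₂ y‖)).add
      (hinv.mul_const (M * ∫ y, ‖c.C₂ y‖))).add (hδ₁.comp (tendsto_phase hκ))).mul_const
      (Real.exp (∫ y, c.weight y))
    simpa using this
  · obtain ⟨K, hK⟩ := h.bdd
    have hl0 : 0 < ‖l‖ := by linarith
    set f : ℝ → ℝ := fun x => ‖a x - c.lim x‖ + ‖b x‖ with hf
    have hfc : Continuous f :=
      ((h.continuous_a.sub c.continuous_lim).norm.add h.continuous_b.norm)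
    have hf0 : ∀ x, 0 ≤ f x := fun x => by positivity
    have hfb : ∀ x, |f x| ≤ K + M + K := fun x => by
      rw [abs_of_nonneg (hf0 x)]
      exact add_le_add ((norm_sub_le _ _).trans (add_le_add (hK x).1 (c.norm_lim_le x))) (hK x).2
    set wa : ℝ → ℝ := fun y => (‖c.A₁ y‖ + ‖c.A₂ y‖) + (‖c.B₁ y‖ + ‖c.B₂ y‖) with hwa
    set wb : ℝ → ℝ := fun y => (‖c.C₁ y‖ + ‖c.C₂ y‖) + (‖c.D₁ y‖ + ‖c.D₂ y‖) with hwb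
    have hwai : Integrable wa := (c.hA₁.norm.add c.hA₂.norm).add (c.hB₁.norm.add c.hB₂.norm)
    have hwbi : Integrable wb := (c.hC₁.norm.add c.hC₂.norm).add (c.hD₁.norm.add c.hD₂.norm)
    have hwf : Integrable fun y => wa y * f y := integrable_mul_of_continuous_bdd hwai hfc hfb
    have hwf' : Integrable fun y => wb y * f y := integrable_mul_of_continuous_bdd hwbi hfc hfb
    -- One estimate for both rows, with `(p, q) = (A, B)` and `(p, q) = (C, D)`: once `p₁ * lim` is
    -- removed, what remains is proportional to `f` or carries `l⁻¹`.
    have pw : ∀ (p₁ p₂ q₁ q₂ : ℂ) (y : ℝ),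
        ‖(p₁ + l⁻¹ * p₂) * a y + (q₁ + l⁻¹ * q₂) * b y - p₁ * c.lim y‖ ≤
          ((‖p₁‖ + ‖p₂‖) + (‖q₁‖ + ‖q₂‖)) * f y + ‖l‖⁻¹ * M * ‖p₂‖ := by
      intro p₁ p₂ q₁ q₂ y
      have e : (p₁ + l⁻¹ * p₂) * a y + (q₁ + l⁻¹ * q₂) * b y - p₁ * c.lim y =
          (p₁ + l⁻¹ * p₂) * (a y - c.lim y) + (q₁ + l⁻¹ * q₂) * b y + l⁻¹ * c.lim y * p₂ := by ring
      rw [e]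
      refine (norm_add₃_le).trans ?_
      have h1 : ‖(p₁ + l⁻¹ * p₂) * (a y - c.lim y)‖ ≤ (‖p₁‖ + ‖p₂‖) * f y := by
        rw [norm_mul]
        exact mul_le_mul (norm_add_inv_mul_le hl.le _ _)
          (le_add_of_nonneg_right (norm_nonneg _)) (norm_nonneg _) (by positivity)
      have h2 : ‖(q₁ + l⁻¹ * q₂) * b y‖ ≤ (‖q₁‖ + ‖q₂‖) * f y := by
        rw [norm_mul]
        exact mul_le_mul (norm_add_inv_mul_le hl.le _ _)
          (le_add_of_nonneg_left (norm_nonneg _)) (norm_nonneg _) (by positivity)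
      have h3 : ‖l⁻¹ * c.lim y * p₂‖ ≤ ‖l‖⁻¹ * M * ‖p₂‖ := by
        rw [norm_mul, norm_mul, norm_inv]
        gcongr
        exact c.norm_lim_le y
      linarith
    have iA := (h.integrable_mul_a (c.integrable_A l)).add (h.integrable_mul_b (c.integrable_B l))
    have iC := (h.integrable_mul_a (c.integrable_C l)).add (h.integrable_mul_b (c.integrable_D l))
    have ea : ∀ x, ‖a x - c.lim x‖ ≤ (∫ y in Set.Iic x, wa y * f y) +
        ‖l‖⁻¹ * (M * ∫ y, ‖c.A₂ y‖) := fun x => by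
      have e : a x - c.lim x =
          ∫ y in Set.Iic x, ((c.A l y * a y + c.B l y * b y) - c.A₁ y * c.lim y) := by
        rw [integral_sub (by exact iA.integrableOn) (c.integrable_mul_lim c.hA₁).integrableOn,
          h.eq_a x, c.lim_eq x]
        ring
      rw [e, ← mul_assoc, ← integral_const_mul]
      exact norm_integral_Iic_le_add hwf (c.hA₂.norm.const_mul _)
        (fun y => by positivity) (fun y => pw _ _ _ _ y) x
    have eb : ∀ x, ‖b x‖ ≤ (∫ y in Set.Iic x, wb y * f y) +
        ‖l‖⁻¹ * (M * ∫ y, ‖c.C₂ y‖) + δ₁ (phase κ l) := fun x => by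
      -- `C₁ * lim` is not small in norm, only its oscillatory integral is, so it is separated
      -- before norms are taken.
      have e : b x = oscInt (phase κ l)
          (fun y => (c.C l y * a y + c.D l y * b y) - c.C₁ y * c.lim y) x +
          oscInt (phase κ l) (fun y => c.C₁ y * c.lim y) x := by
        rw [← oscInt_add hre.le (by exact iC.sub (c.integrable_mul_lim c.hC₁))
          (c.integrable_mul_lim c.hC₁), h.eq_b x]
        simp only [sub_add_cancel]
      rw [e, ← mul_assoc, ← integral_const_mul]
      exact (norm_add_le _ _).trans (add_le_add (norm_oscInt_le_add hre.le hwf'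
        (c.hC₂.norm.const_mul _) (fun y => by positivity) (fun y => pw _ _ _ _ y) x)
        (hosc _ hre x))
    have hδ0 : 0 ≤ δ₁ (phase κ l) := (norm_nonneg _).trans (hosc _ hre 0)
    have hg := gronwall_Iic_everywhere (f := f) (g := c.weight)
      (c := ‖l‖⁻¹ * (M * ∫ y, ‖c.A₂ y‖) + ‖l‖⁻¹ * (M * ∫ y, ‖c.C₂ y‖) + δ₁ (phase κ l))
      (by
        have h1 : 0 ≤ ∫ y, ‖c.A₂ y‖ := integral_nonneg fun _ => norm_nonneg _
        have h2 : 0 ≤ ∫ y, ‖c.C₂ y‖ := integral_nonneg fun _ => norm_nonneg _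
        positivity) hfc hfb c.integrable_weight c.weight_nonneg (fun x => by
        have e : ∫ y in Set.Iic x, c.weight y * f y =
            (∫ y in Set.Iic x, wa y * f y) + ∫ y in Set.Iic x, wb y * f y := by
          rw [← integral_add hwf.integrableOn hwf'.integrableOn]
          congr 1; ext y
          simp only [weight, hwa, hwb]; ring
        rw [e]
        have := ea x
        have := eb x
        simp only [hf] at *
        linarith)
    exact fun x => ⟨(le_add_of_nonneg_right (norm_nonneg _)).trans (hg x),
      (le_add_of_nonneg_left (norm_nonneg _)).trans (hg x)⟩

/-- The product rule for `lim * corr`: it solves the equation for `a` linearized at `lim`, with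
source `(A₂ - κ⁻¹ B₁ C₁) * lim`. This is the equation that `l (a - lim)` satisfies in the limit. -/
theorem lim_mul_corr {κ : ℂ} (hBC : Integrable fun y => c.B₁ y * c.C₁ y) (x : ℝ) :
    c.lim x * c.corr κ x = ∫ y in Set.Iic x, (c.A₁ y * c.lim y * c.corr κ y +
      (c.A₂ y - κ⁻¹ * (c.B₁ y * c.C₁ y)) * c.lim y) := by
  have hw : Integrable fun y => c.A₂ y - κ⁻¹ * (c.B₁ y * c.C₁ y) := c.hA₂.sub (hBC.const_mul _)
  have i1 := c.integrable_mul_lim c.hA₁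
  have h1 := primitive_mul_primitive i1 hw x
  have e1 : ∀ x, ∫ y in Set.Iic x, c.A₁ y * c.lim y = c.lim x - 1 := fun x => by
    rw [c.lim_eq x]; ring
  simp only [e1] at h1
  have i2 : Integrable fun y => c.A₁ y * c.lim y * c.corr κ y :=
    integrable_mul_of_continuous_bdd i1 (continuous_primitive_Iic hw) (norm_primitive_Iic_le hw)
  have i3 := c.integrable_mul_lim hw
  -- The primitive vanishing at `-∞` is `lim - 1` rather than `lim`; the missing `1` accounts for
  -- the separate term `corr κ x`.
  have e2 : ∫ y in Set.Iic x, (c.A₁ y * c.lim y * c.corr κ y +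
      (c.A₂ y - κ⁻¹ * (c.B₁ y * c.C₁ y)) * c.lim y) =
      (∫ y in Set.Iic x, (c.A₁ y * c.lim y * c.corr κ y +
      (c.A₂ y - κ⁻¹ * (c.B₁ y * c.C₁ y)) * (c.lim y - 1))) + c.corr κ x := by
    rw [corr, ← integral_add _ hw.integrableOn]
    · congr 1; ext y; ring
    · simp only [mul_sub, mul_one]
      exact (i2.add (i3.sub hw)).integrableOn
  rw [e2]
  simp only [corr] at h1 ⊢
  rw [← h1]
  ring

/-- First-order asymptotics of the diagonal component, from an equation in which the
off-diagonal component has been eliminated up to a small remainder `R`. -/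
theorem exists_first_order_bound {κ : ℂ} (hκ : κ ≠ 0)
    (hBC : Integrable fun y => c.B₁ y * c.C₁ y) :
    ∃ (δ : ℂ → ℝ) (K : ℝ), Tendsto δ (Bornology.cobounded ℂ) (𝓝 0) ∧
      ∀ l a b, 1 < ‖l‖ → (phase κ l).re < 0 → c.IsSol κ l a b → ∀ (R : ℝ → ℂ) (ρ : ℝ),
        (∀ x, ‖l * R x‖ ≤ ρ) → (∀ x, a x = 1 + (∫ y in Set.Iic x,
          (c.A₁ y + l⁻¹ * c.A₂ y - (phase κ l)⁻¹ * (c.B₁ y * c.C₁ y)) * a y) + R x) →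
        ∀ x, ‖l * (a x - c.lim x) - c.lim x * c.corr κ x‖ ≤ δ l + ρ * K := by
  obtain ⟨δ₀, hδ₀, hlead⟩ := c.exists_leading_bound hκ
  set M := c.limBound with hM
  have hM0 : 0 < M := c.limBound_pos
  set I₁ := ∫ y, ‖c.A₂ y‖ with hI₁
  set I₂ := ∫ y, ‖c.B₁ y * c.C₁ y‖ with hI₂
  have hI₁0 : 0 ≤ I₁ := integral_nonneg fun _ => norm_nonneg _
  have hI₂0 : 0 ≤ I₂ := integral_nonneg fun _ => norm_nonneg _
  set m : ℂ → ℂ := fun l => l * (phase κ l)⁻¹ with hm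
  have hmt : Tendsto m (Bornology.cobounded ℂ) (𝓝 κ⁻¹) := tendsto_mul_inv_phase hκ
  set k : ℂ → ℝ := fun l => (δ₀ l * I₁ + δ₀ l * ‖m l‖ * I₂) + ‖κ⁻¹ - m l‖ * M * I₂ with hk
  have hkt : Tendsto k (Bornology.cobounded ℂ) (𝓝 0) := by
    have h1 : Tendsto (fun l => ‖κ⁻¹ - m l‖) (Bornology.cobounded ℂ) (𝓝 0) := by
      have := (hmt.const_sub κ⁻¹).norm
      simpa using this
    have := ((hδ₀.mul_const I₁).add ((hδ₀.mul hmt.norm).mul_const I₂)).add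
      ((h1.mul_const M).mul_const I₂)
    simpa using this
  refine ⟨fun l => k l * Real.exp (∫ y, ‖c.A₁ y‖), Real.exp (∫ y, ‖c.A₁ y‖), by
    simpa using hkt.mul_const (Real.exp (∫ y, ‖c.A₁ y‖)), fun l a b hl hre h R ρ hR heq => ?_⟩
  have hl0 : l ≠ 0 := norm_pos_iff.1 (by linarith)
  obtain ⟨K, hK⟩ := h.bdd
  have hw : Integrable fun y => c.A₂ y - κ⁻¹ * (c.B₁ y * c.C₁ y) := c.hA₂.sub (hBC.const_mul _)
  have hcc : Continuous (c.corr κ) := continuous_primitive_Iic hw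
  have hcb : ∀ x, ‖c.corr κ x‖ ≤ ∫ y, ‖c.A₂ y - κ⁻¹ * (c.B₁ y * c.C₁ y)‖ :=
    norm_primitive_Iic_le hw
  have hδ0 : 0 ≤ δ₀ l := (norm_nonneg _).trans (hlead l a b hl hre h 0).1
  have hρ0 : 0 ≤ ρ := (norm_nonneg _).trans (hR 0)
  set q : ℝ → ℂ := fun x => l * (a x - c.lim x) - c.lim x * c.corr κ x with hq
  have hqc : Continuous q := (continuous_const.mul (h.continuous_a.sub c.continuous_lim)).sub
    (c.continuous_lim.mul hcc)
  have hqb : ∀ x, |‖q x‖| ≤ ‖l‖ * (K + M) + M * ∫ y, ‖c.A₂ y - κ⁻¹ * (c.B₁ y * c.C₁ y)‖ := by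
    intro x
    rw [abs_norm]
    refine (norm_sub_le _ _).trans ?_
    rw [norm_mul, norm_mul]
    gcongr
    · exact (norm_sub_le _ _).trans (add_le_add (hK x).1 (c.norm_lim_le x))
    · exact c.norm_lim_le x
    · exact hcb x
  have hqi : Integrable fun y => ‖c.A₁ y‖ * ‖q y‖ :=
    integrable_mul_of_continuous_bdd c.hA₁.norm hqc.norm hqb
  have hco : Integrable fun y => c.A₁ y + l⁻¹ * c.A₂ y - (phase κ l)⁻¹ * (c.B₁ y * c.C₁ y) :=
    (c.hA₁.add (c.hA₂.const_mul _)).sub (hBC.const_mul _)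
  have i1 := h.integrable_mul_a hco
  have i2 := c.integrable_mul_lim c.hA₁
  have i3 : Integrable fun y => c.A₁ y * c.lim y * c.corr κ y :=
    integrable_mul_of_continuous_bdd i2 hcc hcb
  have i4 := c.integrable_mul_lim hw
  have ib : Integrable fun y => (‖c.A₂ y‖ + ‖m l‖ * ‖c.B₁ y * c.C₁ y‖) * δ₀ l +
      ‖κ⁻¹ - m l‖ * M * ‖c.B₁ y * c.C₁ y‖ :=
    ((c.hA₂.norm.add (hBC.norm.const_mul _)).mul_const _).add (hBC.norm.const_mul _)
  have hbd : ∀ x, ‖q x‖ ≤ (k l + ρ) + ∫ y in Set.Iic x, ‖c.A₁ y‖ * ‖q y‖ := by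
    intro x
    have e : q x = (∫ y in Set.Iic x,
        (l * ((c.A₁ y + l⁻¹ * c.A₂ y - (phase κ l)⁻¹ * (c.B₁ y * c.C₁ y)) * a y -
          c.A₁ y * c.lim y) - (c.A₁ y * c.lim y * c.corr κ y +
          (c.A₂ y - κ⁻¹ * (c.B₁ y * c.C₁ y)) * c.lim y))) + l * R x := by
      rw [integral_sub (by exact ((i1.sub i2).const_mul l).integrableOn)
        (by exact (i3.add i4).integrableOn), integral_const_mul,
        integral_sub i1.integrableOn i2.integrableOn, ← c.lim_mul_corr hBC]
      simp only [hq]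
      rw [heq x, c.lim_eq x]
      ring
    have hn := norm_integral_Iic_le_add hqi ib (fun y => by positivity) (F := fun y =>
        (l * ((c.A₁ y + l⁻¹ * c.A₂ y - (phase κ l)⁻¹ * (c.B₁ y * c.C₁ y)) * a y -
          c.A₁ y * c.lim y) - (c.A₁ y * c.lim y * c.corr κ y +
          (c.A₂ y - κ⁻¹ * (c.B₁ y * c.C₁ y)) * c.lim y))) (fun y => by
      -- The integrand is `A₁ q`, to be absorbed by Grönwall, plus two small terms: one contains `a
      -- - lim`, the other `κ⁻¹ - m l`, where `m l = l θ⁻¹ → κ⁻¹`.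
      have e2 : l * ((c.A₁ y + l⁻¹ * c.A₂ y - (phase κ l)⁻¹ * (c.B₁ y * c.C₁ y)) * a y -
          c.A₁ y * c.lim y) - (c.A₁ y * c.lim y * c.corr κ y +
          (c.A₂ y - κ⁻¹ * (c.B₁ y * c.C₁ y)) * c.lim y) =
          c.A₁ y * q y + (c.A₂ y - m l * (c.B₁ y * c.C₁ y)) * (a y - c.lim y) +
            (κ⁻¹ - m l) * c.lim y * (c.B₁ y * c.C₁ y) := by
        simp only [hq, hm]
        field_simp
        ring
      rw [e2, ← add_assoc]
      refine (norm_add₃_le).trans (add_le_add (add_le_add (norm_mul _ _).le ?_) ?_)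
      · rw [norm_mul]
        refine mul_le_mul ((norm_sub_le _ _).trans (by rw [norm_mul])) (hlead l a b hl hre h y).1
          (norm_nonneg _) (by positivity)
      · rw [norm_mul, norm_mul]
        gcongr
        exact c.norm_lim_le y) x
    rw [integral_add (by exact (c.hA₂.norm.add (hBC.norm.const_mul _)).mul_const _)
      (hBC.norm.const_mul _), integral_mul_const, integral_add c.hA₂.norm
      (hBC.norm.const_mul _), integral_const_mul, integral_const_mul] at hn
    rw [e]
    refine (norm_add_le _ _).trans ((add_le_add hn (hR x)).trans (le_of_eq ?_))
    simp only [hk]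
    ring
  intro x
  have := gronwall_Iic_everywhere (f := fun x => ‖q x‖) (g := fun y => ‖c.A₁ y‖)
    (c := k l + ρ) (by simp only [hk]; positivity) hqc.norm hqb c.hA₁.norm
    (fun _ => norm_nonneg _) hbd x
  rw [← add_mul]
  exact this

end VolterraCoeff

end MTM

/-! ### The first correction by integration by parts, in `∫ B₁ b` or in the equation for `b`. -/

namespace MTM

namespace VolterraCoeff

variable (c : VolterraCoeff)

/-- First-order asymptotics when the coefficient `B₁` is differentiable. -/
theorem exists_first_order_bound_of_hasDerivAt_B {κ : ℂ} (hκ : κ ≠ 0) {B' : ℝ → ℂ}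
    (hB' : Integrable B') (hd : ∀ x, HasDerivAt c.B₁ (B' x) x) :
    ∃ δ : ℂ → ℝ, Tendsto δ (Bornology.cobounded ℂ) (𝓝 0) ∧
      ∀ l a b, 1 < ‖l‖ → (phase κ l).re < 0 → c.IsSol κ l a b →
        ∀ x, ‖l * (a x - c.lim x) - c.lim x * c.corr κ x‖ ≤ δ l := by
  have hBc : Continuous c.B₁ := continuous_iff_continuousAt.2 fun x => (hd x).continuousAt
  set K₁ := ∫ y, ‖B' y‖ with hK₁
  have hK₁0 : 0 ≤ K₁ := integral_nonneg fun _ => norm_nonneg _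
  have hBb : ∀ x, ‖c.B₁ x‖ ≤ K₁ := fun x => by
    rw [eq_integral_Iic_deriv c.hB₁ hB' hd x]; exact norm_primitive_Iic_le hB' x
  have hBi : ∀ {f : ℝ → ℂ}, Integrable f → Integrable fun y => c.B₁ y * f y := fun hf =>
    (integrable_mul_of_continuous_bdd hf hBc hBb).congr (Eventually.of_forall fun y => mul_comm _ _)
  have hBC : Integrable fun y => c.B₁ y * c.C₁ y := hBi c.hC₁
  obtain ⟨δ₀, hδ₀, hlead⟩ := c.exists_leading_bound hκ
  obtain ⟨δ₁, K, hδ₁, hfirst⟩ := c.exists_first_order_bound hκ hBC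
  set M := c.limBound with hM
  have hM0 : 0 < M := c.limBound_pos
  set m : ℂ → ℂ := fun l => l * (phase κ l)⁻¹ with hm
  have hmt : Tendsto m (Bornology.cobounded ℂ) (𝓝 κ⁻¹) := tendsto_mul_inv_phase hκ
  have hinv : Tendsto (fun l : ℂ => ‖l‖⁻¹) (Bornology.cobounded ℂ) (𝓝 0) :=
    tendsto_norm_cobounded_atTop.inv_tendsto_atTop
  set I₁ := ∫ y, ‖c.C₂ y‖ with hI₁
  set I₂ := ∫ y, (‖c.D₁ y‖ + ‖c.D₂ y‖) with hI₂
  set I₃ := ∫ y, ‖c.B₂ y‖ with hI₃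
  set ρ : ℂ → ℝ := fun l => ‖m l‖ * (K₁ * δ₀ l + K₁ * δ₀ l +
    (K₁ * (‖l‖⁻¹ * (M + δ₀ l)) * I₁ + K₁ * δ₀ l * I₂)) + δ₀ l * I₃ with hρ
  have hρt : Tendsto ρ (Bornology.cobounded ℂ) (𝓝 0) := by
    have := (hmt.norm.mul (((hδ₀.const_mul K₁).add (hδ₀.const_mul K₁)).add
      ((((hinv.mul (hδ₀.const_add M)).const_mul K₁).mul_const I₁).add
        ((hδ₀.const_mul K₁).mul_const I₂)))).add (hδ₀.mul_const I₃)
    simpa using this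
  refine ⟨fun l => δ₁ l + ρ l * K, by simpa using hδ₁.add (hρt.mul_const K),
    fun l a b hl hre h => ?_⟩
  have hl0 : l ≠ 0 := norm_pos_iff.1 (by linarith)
  have hθ0 : phase κ l ≠ 0 := fun h => by simp [h] at hre
  have hb : ∀ x, ‖b x‖ ≤ δ₀ l := fun x => (hlead l a b hl hre h x).2
  have hδ0 : 0 ≤ δ₀ l := (norm_nonneg _).trans (hb 0)
  have ha : ∀ x, ‖a x‖ ≤ M + δ₀ l := fun x => by
    have h1 := (hlead l a b hl hre h x).1
    have h2 := c.norm_lim_le x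
    have := norm_add_le (c.lim x) (a x - c.lim x)
    rw [add_sub_cancel] at this
    linarith
  have iD := h.integrable_mul_b (c.integrable_D l)
  have iC₂ := (h.integrable_mul_a c.hC₂).const_mul l⁻¹
  have iC₁ := h.integrable_mul_a c.hC₁
  have iS : Integrable fun y => l⁻¹ * (c.C₂ y * a y) + c.D l y * b y := iC₂.add iD
  have hh : Integrable fun y => c.C l y * a y + c.D l y * b y :=
    (h.integrable_mul_a (c.integrable_C l)).add iD
  -- `S` is what integration by parts leaves of `θ ∫ B₁ b` besides `-∫ B₁ C₁ a`. Each of its terms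
  -- contains `b` or `l⁻¹` and so vanishes at infinity; `C₁` itself is never differentiated.
  set S : ℝ → ℂ := fun x => c.B₁ x * b x - (∫ y in Set.Iic x, B' y * b y) -
    ∫ y in Set.Iic x, c.B₁ y * (l⁻¹ * (c.C₂ y * a y) + c.D l y * b y) with hS
  set T : ℝ → ℂ := fun x => ∫ y in Set.Iic x, c.B₂ y * b y with hT
  refine hfirst l a b hl hre h (fun x => (phase κ l)⁻¹ * S x + l⁻¹ * T x) (ρ l)
    (fun x => ?_) (fun x => ?_)
  · have e : l * ((phase κ l)⁻¹ * S x + l⁻¹ * T x) = m l * S x + T x := by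
      simp only [hm]; field_simp
    rw [e]
    have h1 : ‖c.B₁ x * b x‖ ≤ K₁ * δ₀ l := by
      rw [norm_mul]; exact mul_le_mul (hBb x) (hb x) (norm_nonneg _) hK₁0
    have h2 : ‖∫ y in Set.Iic x, B' y * b y‖ ≤ K₁ * δ₀ l := by
      rw [hK₁, ← integral_mul_const]
      refine (norm_integral_Iic_le (hB'.norm.mul_const _) (fun y => ?_) x).trans
        (integral_Iic_le_integral (hB'.norm.mul_const _) (fun y => by positivity) x)
      rw [norm_mul]; gcongr; exact hb y
    have h4 : ‖T x‖ ≤ δ₀ l * I₃ := by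
      rw [hI₃, ← integral_const_mul]
      refine (norm_integral_Iic_le (c.hB₂.norm.const_mul _) (fun y => ?_) x).trans
        (integral_Iic_le_integral (c.hB₂.norm.const_mul _) (fun y => by positivity) x)
      rw [norm_mul, mul_comm]; gcongr; exact hb y
    have h3 : ‖∫ y in Set.Iic x, c.B₁ y * (l⁻¹ * (c.C₂ y * a y) + c.D l y * b y)‖ ≤
        K₁ * (‖l‖⁻¹ * (M + δ₀ l)) * I₁ + K₁ * δ₀ l * I₂ := by
      have i1 := c.hC₂.norm.const_mul (K₁ * (‖l‖⁻¹ * (M + δ₀ l)))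
      have i2 : Integrable fun y => K₁ * δ₀ l * (‖c.D₁ y‖ + ‖c.D₂ y‖) :=
        (c.hD₁.norm.add c.hD₂.norm).const_mul (K₁ * δ₀ l)
      rw [hI₁, hI₂, ← integral_const_mul, ← integral_const_mul, ← integral_add i1 i2]
      refine (norm_integral_Iic_le (i1.add i2) (fun y => ?_) x).trans
        (integral_Iic_le_integral (i1.add i2) (fun y => ?_) x)
      · have j1 : ‖l⁻¹ * (c.C₂ y * a y)‖ ≤ ‖l‖⁻¹ * (M + δ₀ l) * ‖c.C₂ y‖ := by
          rw [norm_mul, norm_mul, norm_inv, mul_comm ‖c.C₂ y‖, ← mul_assoc]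
          gcongr; exact ha y
        have j2 : ‖c.D l y * b y‖ ≤ δ₀ l * (‖c.D₁ y‖ + ‖c.D₂ y‖) := by
          rw [norm_mul, mul_comm]
          exact mul_le_mul (hb y) (norm_add_inv_mul_le hl.le _ _) (norm_nonneg _) hδ0
        rw [norm_mul]
        calc ‖c.B₁ y‖ * ‖l⁻¹ * (c.C₂ y * a y) + c.D l y * b y‖
            ≤ K₁ * (‖l‖⁻¹ * (M + δ₀ l) * ‖c.C₂ y‖ + δ₀ l * (‖c.D₁ y‖ + ‖c.D₂ y‖)) :=
              mul_le_mul (hBb y) ((norm_add_le _ _).trans (add_le_add j1 j2)) (norm_nonneg _) hK₁0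
          _ = _ := by simp only [Pi.add_apply]; ring
      · simp only [Pi.add_apply]; positivity
    refine (norm_add_le _ _).trans (add_le_add ?_ h4)
    rw [norm_mul]
    exact mul_le_mul_of_nonneg_left ((norm_sub_le _ _).trans
      (add_le_add ((norm_sub_le _ _).trans (add_le_add h1 h2)) h3)) (norm_nonneg _)
  · have ibp := mul_integral_mul_oscInt hre.le c.hB₁ hB' hd hh x
    rw [← funext h.eq_b] at ibp
    have e1 : ∫ y in Set.Iic x, c.B₁ y * (c.C l y * a y + c.D l y * b y) =
        (∫ y in Set.Iic x, c.B₁ y * c.C₁ y * a y) +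
        ∫ y in Set.Iic x, c.B₁ y * (l⁻¹ * (c.C₂ y * a y) + c.D l y * b y) := by
      rw [← integral_add (h.integrable_mul_a hBC).integrableOn (hBi iS).integrableOn]
      congr 1; ext y; simp only [C]; ring
    have e2 : (phase κ l)⁻¹ * S x = (∫ y in Set.Iic x, c.B₁ y * b y) +
        (phase κ l)⁻¹ * ∫ y in Set.Iic x, c.B₁ y * c.C₁ y * a y := by
      rw [e1] at ibp
      rw [inv_mul_eq_iff_eq_mul₀ hθ0, mul_add, mul_inv_cancel_left₀ hθ0, ibp]
      simp only [hS]; ring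
    have i5 := h.integrable_mul_b c.hB₁
    have i6 := (h.integrable_mul_a hBC).const_mul (phase κ l)⁻¹
    have i7 := (h.integrable_mul_b c.hB₂).const_mul l⁻¹
    have i8 : Integrable fun y =>
        (c.A₁ y + l⁻¹ * c.A₂ y - (phase κ l)⁻¹ * (c.B₁ y * c.C₁ y)) * a y :=
      h.integrable_mul_a ((c.integrable_A l).sub (hBC.const_mul _))
    rw [e2, ← integral_const_mul, hT, ← integral_const_mul,
      ← integral_add i5.integrableOn i6.integrableOn,
      ← integral_add (by exact (i5.add i6).integrableOn) i7.integrableOn, add_assoc,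
      ← integral_add i8.integrableOn (by exact ((i5.add i6).add i7).integrableOn), h.eq_a x]
    congr 2
    ext y
    simp only [A, B]
    ring

set_option maxHeartbeats 1000000 in
/-- First-order asymptotics when the coefficient `C₁` is differentiable. -/
theorem exists_first_order_bound_of_hasDerivAt_C {κ : ℂ} (hκ : κ ≠ 0) {C' : ℝ → ℂ}
    (hC' : Integrable C') (hd : ∀ x, HasDerivAt c.C₁ (C' x) x) :
    ∃ δ : ℂ → ℝ, Tendsto δ (Bornology.cobounded ℂ) (𝓝 0) ∧
      ∀ l a b, 1 < ‖l‖ → (phase κ l).re < 0 → c.IsSol κ l a b →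
        ∀ x, ‖l * (a x - c.lim x) - c.lim x * c.corr κ x‖ ≤ δ l ∧
          ‖l * b x + κ⁻¹ * c.C₁ x * c.lim x‖ ≤ δ l := by
  have hCc : Continuous c.C₁ := continuous_iff_continuousAt.2 fun x => (hd x).continuousAt
  set K₁ := ∫ y, ‖C' y‖ with hK₁
  have hK₁0 : 0 ≤ K₁ := integral_nonneg fun _ => norm_nonneg _
  have hCe : ∀ x, c.C₁ x = ∫ y in Set.Iic x, C' y := eq_integral_Iic_deriv c.hC₁ hC' hd
  have hCb : ∀ x, ‖c.C₁ x‖ ≤ K₁ := fun x => by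
    rw [hCe x]; exact norm_primitive_Iic_le hC' x
  have hCi : ∀ {f : ℝ → ℂ}, Integrable f → Integrable fun y => f y * c.C₁ y := fun hf =>
    integrable_mul_of_continuous_bdd hf hCc hCb
  have hBC : Integrable fun y => c.B₁ y * c.C₁ y := hCi c.hB₁
  obtain ⟨δ₀, hδ₀, hlead⟩ := c.exists_leading_bound hκ
  obtain ⟨δ₁, K, hδ₁, hfirst⟩ := c.exists_first_order_bound hκ hBC
  -- The source of order zero in the equation for `β` below: `C'` and `A₁ C₁` come from the
  -- derivative of `C₁ a`, and `-D₁ C₁` from rewriting `l D₁ b` as `D₁ β - m D₁ C₁ a`.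
  set G : ℝ → ℂ := fun y => C' y + c.A₁ y * c.C₁ y - c.D₁ y * c.C₁ y with hG
  have hGi : Integrable G := (hC'.add (hCi c.hA₁)).sub (hCi c.hD₁)
  obtain ⟨δ₂, hδ₂, hosc₂⟩ := exists_tendsto_zero_norm_oscInt_le (c.integrable_mul_lim hGi)
  obtain ⟨δ₃, hδ₃, hosc₃⟩ := exists_tendsto_zero_norm_oscInt_le (c.integrable_mul_lim c.hC₂)
  set M := c.limBound with hM
  have hM0 : 0 < M := c.limBound_pos
  set m : ℂ → ℂ := fun l => l * (phase κ l)⁻¹ with hm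
  have hmt : Tendsto m (Bornology.cobounded ℂ) (𝓝 κ⁻¹) := tendsto_mul_inv_phase hκ
  have hmt0 : Tendsto (fun l => ‖κ⁻¹ - m l‖) (Bornology.cobounded ℂ) (𝓝 0) := by
    have := (hmt.const_sub κ⁻¹).norm
    simpa using this
  have hinv : Tendsto (fun l : ℂ => ‖l‖⁻¹) (Bornology.cobounded ℂ) (𝓝 0) :=
    tendsto_norm_cobounded_atTop.inv_tendsto_atTop
  set I₁ := ∫ y, ‖G y‖ with hI₁
  set I₂ := ∫ y, ‖c.A₂ y‖ with hI₂
  set I₃ := ∫ y, (‖c.B₁ y‖ + ‖c.B₂ y‖) with hI₃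
  set I₄ := ∫ y, (‖c.C₂ y‖ + ‖c.D₂ y‖) with hI₄
  set k : ℂ → ℝ := fun l => (‖m l‖ * δ₂ (phase κ l) + δ₃ (phase κ l)) +
    (‖m l‖ * δ₀ l * I₁ + ‖m l‖ * K₁ * (‖l‖⁻¹ * (M + δ₀ l)) * I₂ + ‖m l‖ * K₁ * δ₀ l * I₃ +
      δ₀ l * I₄) with hk
  have hkt : Tendsto k (Bornology.cobounded ℂ) (𝓝 0) := by
    have := ((hmt.norm.mul (hδ₂.comp (tendsto_phase hκ))).add
      (hδ₃.comp (tendsto_phase hκ))).add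
      (((((hmt.norm.mul hδ₀).mul_const I₁).add
        (((hmt.norm.mul_const K₁).mul (hinv.mul (hδ₀.const_add M))).mul_const I₂)).add
        (((hmt.norm.mul_const K₁).mul hδ₀).mul_const I₃)).add (hδ₀.mul_const I₄))
    simpa using this
  set δ₄ : ℂ → ℝ := fun l => k l * Real.exp (∫ y, ‖c.D₁ y‖) with hδ₄
  have hδ₄t : Tendsto δ₄ (Bornology.cobounded ℂ) (𝓝 0) := by simpa using hkt.mul_const _
  set ρ : ℂ → ℝ := fun l => (δ₄ l + δ₀ l) * I₃ with hρ
  have hρt : Tendsto ρ (Bornology.cobounded ℂ) (𝓝 0) := by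
    simpa using (hδ₄t.add hδ₀).mul_const I₃
  set τ : ℂ → ℝ := fun l => δ₄ l + ‖m l‖ * K₁ * δ₀ l + ‖κ⁻¹ - m l‖ * K₁ * M with hτ
  have hτt : Tendsto τ (Bornology.cobounded ℂ) (𝓝 0) := by
    simpa using (hδ₄t.add ((hmt.norm.mul_const K₁).mul hδ₀)).add
      ((hmt0.mul_const K₁).mul_const M)
  refine ⟨fun l => max (δ₁ l + ρ l * K) (τ l), by
    simpa using (hδ₁.add (hρt.mul_const K)).max hτt, fun l a b hl hre h => ?_⟩
  have hl0 : l ≠ 0 := norm_pos_iff.1 (by linarith)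
  have hθ0 : phase κ l ≠ 0 := fun h => by simp [h] at hre
  obtain ⟨Kb, hKb⟩ := h.bdd
  have har : ∀ x, ‖a x - c.lim x‖ ≤ δ₀ l := fun x => (hlead l a b hl hre h x).1
  have hb : ∀ x, ‖b x‖ ≤ δ₀ l := fun x => (hlead l a b hl hre h x).2
  have hδ0 : 0 ≤ δ₀ l := (norm_nonneg _).trans (hb 0)
  have hδ20 : 0 ≤ δ₂ (phase κ l) := (norm_nonneg _).trans (hosc₂ _ hre 0)
  have hδ30 : 0 ≤ δ₃ (phase κ l) := (norm_nonneg _).trans (hosc₃ _ hre 0)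
  have ha : ∀ x, ‖a x‖ ≤ M + δ₀ l := fun x => by
    have h1 := har x
    have h2 := c.norm_lim_le x
    have := norm_add_le (c.lim x) (a x - c.lim x)
    rw [add_sub_cancel] at this
    linarith
  -- the off-diagonal component with its main part removed, scaled by `l`
  set β : ℝ → ℂ := fun x => l * b x + m l * (c.C₁ x * a x) with hβ
  have hβc : Continuous β := (continuous_const.mul h.continuous_b).add
    (continuous_const.mul (hCc.mul h.continuous_a))
  have hβb : ∀ x, ‖β x‖ ≤ ‖l‖ * Kb + ‖m l‖ * (K₁ * Kb) := fun x => by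
    refine (norm_add_le _ _).trans ?_
    rw [norm_mul, norm_mul, norm_mul (c.C₁ x)]
    exact add_le_add (mul_le_mul_of_nonneg_left (hKb x).2 (norm_nonneg _))
      (mul_le_mul_of_nonneg_left (mul_le_mul (hCb x) (hKb x).1 (norm_nonneg _) hK₁0)
        (norm_nonneg _))
  have iH : Integrable fun y => c.A l y * a y + c.B l y * b y :=
    (h.integrable_mul_a (c.integrable_A l)).add (h.integrable_mul_b (c.integrable_B l))
  have iHC : Integrable fun y => (c.A l y * a y + c.B l y * b y) * c.C₁ y := hCi iH
  have iCa := h.integrable_mul_a hC'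
  have iP : Integrable fun y => C' y * a y + (c.A l y * a y + c.B l y * b y) * c.C₁ y :=
    iCa.add iHC
  -- Product rule for `C₁` and `a - 1`, the primitives of `C'` and of the integrand for `a` that
  -- vanish at `-∞`; adding back `C₁` restores `a`.
  have hprim : ∀ x, c.C₁ x * a x = ∫ y in Set.Iic x,
      (C' y * a y + (c.A l y * a y + c.B l y * b y) * c.C₁ y) := fun x => by
    have h1 := primitive_mul_primitive hC' iH x
    have e : ∀ x, ∫ y in Set.Iic x, (c.A l y * a y + c.B l y * b y) = a x - 1 := fun x => by
      rw [h.eq_a x]; ring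
    simp only [e, ← hCe] at h1
    have e2 : ∀ y, C' y * (a y - 1) + (c.A l y * a y + c.B l y * b y) * c.C₁ y =
        (C' y * a y + (c.A l y * a y + c.B l y * b y) * c.C₁ y) - C' y := fun y => by ring
    simp only [e2] at h1
    rw [integral_sub iP.integrableOn hC'.integrableOn, ← hCe] at h1
    linear_combination h1
  have hibp : ∀ x, phase κ l * oscInt (phase κ l) (fun y => c.C₁ y * a y) x =
      oscInt (phase κ l) (fun y => C' y * a y + (c.A l y * a y + c.B l y * b y) * c.C₁ y) x -
        c.C₁ x * a x := fun x => by
    have := mul_oscInt_primitive hre iP x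
    simpa only [← hprim] using this
  have iC₁ := h.integrable_mul_a c.hC₁
  have iC₂ := h.integrable_mul_a c.hC₂
  have iD := h.integrable_mul_b (c.integrable_D l)
  have iS : Integrable fun y => l⁻¹ * (c.C₂ y * a y) + c.D l y * b y := (iC₂.const_mul _).add iD
  -- The boundary term `-C₁ a` of the integration by parts, multiplied by `l θ⁻¹ = m l`, cancels the
  -- term added in `β`, so `β` is a pure oscillatory integral.
  have hβe : ∀ x, β x = oscInt (phase κ l) (fun y =>
      m l * (C' y * a y + (c.A l y * a y + c.B l y * b y) * c.C₁ y) +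
        l * (l⁻¹ * (c.C₂ y * a y) + c.D l y * b y)) x := fun x => by
    rw [oscInt_add hre.le (iP.const_mul _) (iS.const_mul _), oscInt_const_mul, oscInt_const_mul]
    have e1 : b x = oscInt (phase κ l) (fun y => c.C₁ y * a y) x +
        oscInt (phase κ l) (fun y => l⁻¹ * (c.C₂ y * a y) + c.D l y * b y) x := by
      rw [← oscInt_add hre.le iC₁ iS, h.eq_b x]
      congr 1; ext y; simp only [C]; ring
    have e2 := (eq_inv_mul_iff_mul_eq₀ hθ0).2 (hibp x)
    simp only [hβ, hm]
    rw [e1, e2]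
    ring
  have iGE := (c.integrable_mul_lim hGi).const_mul (m l)
  have iC₂E := c.integrable_mul_lim c.hC₂
  set F : ℝ → ℂ := fun y => m l * (C' y * a y + (c.A l y * a y + c.B l y * b y) * c.C₁ y) +
    l * (l⁻¹ * (c.C₂ y * a y) + c.D l y * b y) with hF
  have iF : Integrable F := (iP.const_mul _).add (iS.const_mul _)
  have iDβ : Integrable fun y => ‖c.D₁ y‖ * ‖β y‖ :=
    integrable_mul_of_continuous_bdd c.hD₁.norm hβc.norm (by simpa using hβb)
  have j₁ : Integrable fun y => ‖m l‖ * δ₀ l * ‖G y‖ := hGi.norm.const_mul _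
  have j₂ : Integrable fun y => ‖m l‖ * K₁ * (‖l‖⁻¹ * (M + δ₀ l)) * ‖c.A₂ y‖ :=
    c.hA₂.norm.const_mul _
  have j₃ : Integrable fun y => ‖m l‖ * K₁ * δ₀ l * (‖c.B₁ y‖ + ‖c.B₂ y‖) :=
    (c.hB₁.norm.add c.hB₂.norm).const_mul _
  have j₄ : Integrable fun y => δ₀ l * (‖c.C₂ y‖ + ‖c.D₂ y‖) :=
    (c.hC₂.norm.add c.hD₂.norm).const_mul _
  have hβd : ∀ x, ‖β x‖ ≤ k l + ∫ y in Set.Iic x, ‖c.D₁ y‖ * ‖β y‖ := fun x => by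
    have e : β x = oscInt (phase κ l)
        (fun y => F y - m l * (G y * c.lim y) - c.C₂ y * c.lim y) x +
        (m l * oscInt (phase κ l) (fun y => G y * c.lim y) x +
          oscInt (phase κ l) (fun y => c.C₂ y * c.lim y) x) := by
      rw [← oscInt_const_mul, ← oscInt_add hre.le iGE iC₂E,
        ← oscInt_add hre.le (by exact (iF.sub iGE).sub iC₂E) (by exact iGE.add iC₂E), hβe x]
      congr 1; ext y; ring
    have hn := norm_oscInt_le_add hre.le iDβ (((j₁.add j₂).add j₃).add j₄)
      (fun y => by simp only [Pi.add_apply]; positivity)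
      (F := fun y => F y - m l * (G y * c.lim y) - c.C₂ y * c.lim y) (fun y => by
      -- After `m G lim` and `C₂ lim` are left to Riemann–Lebesgue, there remain `D₁ β` for Grönwall
      -- and terms that contain `a - lim`, `b` or `l⁻¹`.
      have e2 : F y - m l * (G y * c.lim y) - c.C₂ y * c.lim y =
          c.D₁ y * β y + (m l * (a y - c.lim y) * G y +
            m l * c.C₁ y * (l⁻¹ * a y) * c.A₂ y + m l * c.C₁ y * b y * c.B l y +
            ((a y - c.lim y) * c.C₂ y + b y * c.D₂ y)) := by
        simp only [hF, hβ, hG, A, B, D]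
        field_simp
        ring
      rw [e2]
      refine (norm_add_le _ _).trans (add_le_add (norm_mul _ _).le ?_)
      refine (norm_add_le _ _).trans (add_le_add ((norm_add_le _ _).trans
        (add_le_add ((norm_add_le _ _).trans (add_le_add ?_ ?_)) ?_)) ?_)
      · beta_reduce
        rw [norm_mul, norm_mul]; gcongr; exact har y
      · beta_reduce
        rw [norm_mul, norm_mul, norm_mul, norm_mul l⁻¹, norm_inv]
        gcongr
        · exact hCb y
        · exact ha y
      · beta_reduce
        rw [norm_mul, norm_mul, norm_mul]
        gcongr
        · exact hCb y
        · exact hb y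
        · exact norm_add_inv_mul_le hl.le _ _
      · refine (norm_add_le _ _).trans ?_
        beta_reduce
        rw [norm_mul, norm_mul, mul_add]
        gcongr
        · exact har y
        · exact hb y) x
    simp only [Pi.add_apply] at hn
    rw [integral_add (by exact (j₁.add j₂).add j₃) j₄, integral_add (by exact j₁.add j₂) j₃,
      integral_add j₁ j₂, integral_const_mul, integral_const_mul, integral_const_mul,
      integral_const_mul] at hn
    have h2 : ‖m l * oscInt (phase κ l) (fun y => G y * c.lim y) x +
          oscInt (phase κ l) (fun y => c.C₂ y * c.lim y) x‖ ≤
        ‖m l‖ * δ₂ (phase κ l) + δ₃ (phase κ l) := by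
      refine (norm_add_le _ _).trans (add_le_add ?_ (hosc₃ _ hre x))
      rw [norm_mul]
      exact mul_le_mul_of_nonneg_left (hosc₂ _ hre x) (norm_nonneg _)
    rw [e]
    refine (norm_add_le _ _).trans ((add_le_add hn h2).trans (le_of_eq ?_))
    simp only [hk]
    ring
  have hI₁0 : 0 ≤ I₁ := integral_nonneg fun _ => norm_nonneg _
  have hI₂0 : 0 ≤ I₂ := integral_nonneg fun _ => norm_nonneg _
  have hI₃0 : 0 ≤ I₃ := integral_nonneg fun _ => by positivity
  have hI₄0 : 0 ≤ I₄ := integral_nonneg fun _ => by positivity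
  have hk0 : 0 ≤ k l := by simp only [hk]; positivity
  have hβδ : ∀ x, ‖β x‖ ≤ δ₄ l := gronwall_Iic_everywhere (f := fun x => ‖β x‖)
    (g := fun y => ‖c.D₁ y‖) (c := k l) hk0 hβc.norm (by simpa using hβb) c.hD₁.norm
    (fun _ => norm_nonneg _) hβd
  have hδ₄0 : 0 ≤ δ₄ l := (norm_nonneg _).trans (hβδ 0)
  refine fun x => ⟨le_max_of_le_left ?_, le_max_of_le_right ?_⟩
  · have iBβ : Integrable fun y => c.B₁ y * β y :=
      integrable_mul_of_continuous_bdd c.hB₁ hβc hβb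
    have iBb := h.integrable_mul_b c.hB₂
    -- Substituting `b = l⁻¹ β - θ⁻¹ C₁ a` in the `B₁` term of the equation for `a` produces the
    -- eliminated equation, with this remainder.
    refine hfirst l a b hl hre h
      (fun x => l⁻¹ * ∫ y in Set.Iic x, (c.B₁ y * β y + c.B₂ y * b y)) (ρ l)
      (fun x => ?_) (fun x => ?_) x
    · rw [mul_inv_cancel_left₀ hl0]
      have i1 : Integrable fun y => (δ₄ l + δ₀ l) * (‖c.B₁ y‖ + ‖c.B₂ y‖) :=
        (c.hB₁.norm.add c.hB₂.norm).const_mul _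
      simp only [hρ, hI₃]
      rw [← integral_const_mul]
      refine (norm_integral_Iic_le i1 (fun y => ?_) x).trans
        (integral_Iic_le_integral i1 (fun y => by positivity) x)
      refine (norm_add_le _ _).trans ?_
      rw [norm_mul, norm_mul]
      have p1 := mul_le_mul_of_nonneg_left (hβδ y) (norm_nonneg (c.B₁ y))
      have p2 := mul_le_mul_of_nonneg_left (hb y) (norm_nonneg (c.B₂ y))
      nlinarith [mul_nonneg hδ0 (norm_nonneg (c.B₁ y)), mul_nonneg hδ₄0 (norm_nonneg (c.B₂ y))]
    · have i8 : Integrable fun y =>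
          (c.A₁ y + l⁻¹ * c.A₂ y - (phase κ l)⁻¹ * (c.B₁ y * c.C₁ y)) * a y :=
        h.integrable_mul_a ((c.integrable_A l).sub (hBC.const_mul _))
      rw [← integral_const_mul, add_assoc, ← integral_add i8.integrableOn
        (by exact ((iBβ.add iBb).const_mul _).integrableOn), h.eq_a x]
      congr 2
      ext y
      simp only [A, B, hβ, hm]
      field_simp
      ring
  · have e : l * b x + κ⁻¹ * c.C₁ x * c.lim x =
        β x - m l * c.C₁ x * (a x - c.lim x) + (κ⁻¹ - m l) * c.C₁ x * c.lim x := by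
      simp only [hβ]; ring
    rw [e]
    refine (norm_add_le _ _).trans (add_le_add ((norm_sub_le _ _).trans
      (add_le_add (hβδ x) ?_)) ?_)
    · rw [norm_mul, norm_mul]
      gcongr
      · exact hCb x
      · exact har x
    · rw [norm_mul, norm_mul]
      gcongr
      · exact hCb x
      · exact c.norm_lim_le x

end VolterraCoeff

end MTM

/-! ### Lebesgue points. -/

namespace MTM

section LebesguePoint

/-- The averages are over intervals of length `2 r`. In this form, without division, the condition
can be fed into the estimate for exponential averages. -/
theorem isLebesguePoint_iff {f : ℝ → ℂ} {x : ℝ} :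
    IsLebesguePoint f x ↔ ∀ η : ℝ, 0 < η → ∃ δ : ℝ, 0 < δ ∧ ∀ r, 0 < r → r ≤ δ →
      ∫ y in Set.Icc (x - r) (x + r), ‖f y - f x‖ ≤ η * r := by
  have avg : ∀ r : ℝ, 0 < r → ⨍ y in Metric.closedBall x r, ‖f y - f x‖ =
      (2 * r)⁻¹ * ∫ y in Set.Icc (x - r) (x + r), ‖f y - f x‖ := fun r hr => by
    rw [setAverage_eq, Real.closedBall_eq_Icc, measureReal_def, Real.volume_Icc, smul_eq_mul,
      ENNReal.toReal_ofReal (by linarith)]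
    congr 2; ring
  have nn : ∀ r : ℝ, 0 ≤ ∫ y in Set.Icc (x - r) (x + r), ‖f y - f x‖ := fun r =>
    integral_nonneg fun _ => norm_nonneg _
  constructor
  · intro h η hη
    have h1 : ∀ᶠ r in 𝓝[>] (0 : ℝ), ⨍ y in Metric.closedBall x r, ‖f y - f x‖ < η / 2 :=
      (tendsto_order.1 h).2 _ (by positivity)
    obtain ⟨δ, hδ, hs⟩ := mem_nhdsGT_iff_exists_Ioc_subset.1 h1
    refine ⟨δ, hδ, fun r hr hrδ => ?_⟩
    have h2 : ⨍ y in Metric.closedBall x r, ‖f y - f x‖ < η / 2 := hs ⟨hr, hrδ⟩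
    rw [avg r hr, inv_mul_lt_iff₀ (by positivity)] at h2
    linarith
  · intro h
    refine tendsto_order.2 ⟨fun a ha => ?_, fun a ha => ?_⟩
    · filter_upwards [self_mem_nhdsWithin] with r hr
      rw [avg r hr]
      exact ha.trans_le (mul_nonneg (inv_nonneg.2 (by linarith [Set.mem_Ioi.1 hr])) (nn r))
    · obtain ⟨δ, hδ, hs⟩ := h a ha
      filter_upwards [Ioc_mem_nhdsGT hδ] with r hr
      rw [avg r hr.1, inv_mul_lt_iff₀ (by linarith [hr.1])]
      nlinarith [hs r hr.1 hr.2, hr.1]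

theorem isLebesguePoint_of_continuous {f : ℝ → ℂ} (hf : Continuous f) (x : ℝ) :
    IsLebesguePoint f x := by
  refine isLebesguePoint_iff.2 fun η hη => ?_
  obtain ⟨δ, hδ, h⟩ := Metric.continuous_iff.1 hf x (η / 2) (by positivity)
  refine ⟨δ / 2, by positivity, fun r hr hrδ => ?_⟩
  have h1 : ∫ y in Set.Icc (x - r) (x + r), ‖f y - f x‖ ≤
      ∫ y in Set.Icc (x - r) (x + r), η / 2 := by
    refine setIntegral_mono_on ((hf.sub continuous_const).norm.continuousOn.integrableOn_Icc)
      continuousOn_const.integrableOn_Icc measurableSet_Icc fun y hy => ?_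
    have := h y (by rw [Real.dist_eq, abs_lt]; constructor <;> linarith [hy.1, hy.2])
    rw [dist_eq_norm] at this
    exact this.le
  refine h1.trans (le_of_eq ?_)
  rw [setIntegral_const, measureReal_def, Real.volume_Icc, smul_eq_mul,
    ENNReal.toReal_ofReal (by linarith)]
  ring

/-- Lebesgue points pass to functions whose oscillation is controlled. -/
theorem IsLebesguePoint.of_norm_sub_le {f g F : ℝ → ℂ} {x : ℝ} (hf : IsLebesguePoint f x)
    (hg : IsLebesguePoint g x) (hfi : LocallyIntegrable f) (hgi : LocallyIntegrable g)
    {K L : ℝ} (hK : 0 ≤ K) (hL : 0 ≤ L)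
    (h : ∀ᵐ y, ‖F y - F x‖ ≤ K * ‖f y - f x‖ + L * ‖g y - g x‖) : IsLebesguePoint F x := by
  rw [isLebesguePoint_iff] at *
  intro η hη
  obtain ⟨δ₁, hδ₁, h₁⟩ := hf (η / (K + L + 1)) (by positivity)
  obtain ⟨δ₂, hδ₂, h₂⟩ := hg (η / (K + L + 1)) (by positivity)
  refine ⟨min δ₁ δ₂, lt_min hδ₁ hδ₂, fun r hr hrδ => ?_⟩
  have i1 : IntegrableOn (fun y => ‖f y - f x‖) (Set.Icc (x - r) (x + r)) :=
    ((hfi.integrableOn_isCompact isCompact_Icc).sub continuousOn_const.integrableOn_Icc).norm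
  have i2 : IntegrableOn (fun y => ‖g y - g x‖) (Set.Icc (x - r) (x + r)) :=
    ((hgi.integrableOn_isCompact isCompact_Icc).sub continuousOn_const.integrableOn_Icc).norm
  have h3 : ∫ y in Set.Icc (x - r) (x + r), ‖F y - F x‖ ≤
      ∫ y in Set.Icc (x - r) (x + r), (K * ‖f y - f x‖ + L * ‖g y - g x‖) :=
    integral_mono_of_nonneg (Eventually.of_forall fun _ => norm_nonneg _)
      ((i1.const_mul K).add (i2.const_mul L)) (ae_restrict_of_ae h)
  rw [integral_add (i1.const_mul K) (i2.const_mul L), integral_const_mul, integral_const_mul] at h3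
  have h4 := mul_le_mul_of_nonneg_left (h₁ r hr (hrδ.trans (min_le_left _ _))) hK
  have h5 := mul_le_mul_of_nonneg_left (h₂ r hr (hrδ.trans (min_le_right _ _))) hL
  have h6 : K * (η / (K + L + 1) * r) + L * (η / (K + L + 1) * r) ≤ η * r := by
    have : η * r = (K + L + 1) * (η / (K + L + 1) * r) := by field_simp
    have h7 : 0 ≤ η / (K + L + 1) * r := by positivity
    nlinarith
  linarith

theorem IsLebesguePoint.comp_neg {f : ℝ → ℂ} {x : ℝ} (hf : IsLebesguePoint f x) :
    IsLebesguePoint (fun y => f (-y)) (-x) := by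
  rw [isLebesguePoint_iff] at *
  intro η hη
  obtain ⟨δ, hδ, h⟩ := hf η hη
  refine ⟨δ, hδ, fun r hr hrδ => ?_⟩
  have e : ∫ y in Set.Icc (-x - r) (-x + r), ‖f (-y) - f (- -x)‖ =
      ∫ y in Set.Icc (x - r) (x + r), ‖f y - f x‖ := by
    rw [integral_Icc_eq_integral_Ioc, integral_Icc_eq_integral_Ioc,
      ← intervalIntegral.integral_of_le (by linarith),
      ← intervalIntegral.integral_of_le (by linarith),
      intervalIntegral.integral_comp_neg (fun y => ‖f y - f (- -x)‖), neg_neg]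
    congr 1 <;> ring
  rw [e]
  exact h r hr hrδ

end LebesguePoint

/-! ### Exponential kernels as approximate identities, and the pointwise limit of the off-diagonal
component. -/

section ExponentialKernel

theorem integral_Iic_exp_kernel {t : ℝ} (ht : 0 < t) (x y : ℝ) :
    IntegrableOn (fun z => t * Real.exp (-(t * (x - z)))) (Set.Iic y) ∧
      ∫ z in Set.Iic y, t * Real.exp (-(t * (x - z))) = Real.exp (-(t * (x - y))) := by
  have e : ∀ z, t * Real.exp (-(t * (x - z))) = t * Real.exp (-(t * x)) * Real.exp (t * z) :=
    fun z => by rw [mul_assoc, ← Real.exp_add]; congr 2; ring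
  simp only [e]
  refine ⟨(integrableOn_exp_mul_Iic ht y).const_mul _, ?_⟩
  rw [integral_const_mul, integral_exp_mul_Iic ht]
  field_simp
  rw [← Real.exp_add]
  congr 1; ring

/-- Exponential averages are controlled by the averages over intervals. -/
theorem integral_exp_kernel_mul_le {φ : ℝ → ℝ} (hφ : Integrable φ) (hφ0 : ∀ y, 0 ≤ φ y)
    {η δ t x : ℝ} (hη : 0 ≤ η) (ht : 0 < t)
    (H : ∀ r, 0 < r → r ≤ δ → ∫ y in Set.Ioc (x - r) x, φ y ≤ η * r) :
    ∫ y in Set.Iic x, Real.exp (-(t * (x - y))) * φ y ≤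
      4 * η / t + 2 * Real.exp (-(t / 2 * δ)) * ∫ y, φ y := by
  set I := ∫ y, φ y with hI
  have hI0 : 0 ≤ I := integral_nonneg hφ0
  set p : ℝ → ℝ := (Set.Iic x).indicator fun z => t * Real.exp (-(t * (x - z))) with hp
  have hpi : Integrable p := (integrable_indicator_iff measurableSet_Iic).2
    (integral_Iic_exp_kernel ht x x).1
  obtain ⟨hint, hsw⟩ := integral_Iic_mul_integral_swap hφ hpi (k := fun _ => (1 : ℝ))
    continuous_const (fun _ _ => by simp) x
  simp only [one_mul] at hint hsw
  -- The exponential is written as the integral of `t e^{-t(x-z)}` over `z ≤ y`. After Fubini only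
  -- the interval integrals of `φ` over `(z, x]` occur.
  have e1 : ∫ y in Set.Iic x, Real.exp (-(t * (x - y))) * φ y =
      ∫ y in Set.Iic x, φ y * ∫ z in Set.Iic y, p z := by
    refine setIntegral_congr_fun measurableSet_Iic fun y hy => ?_
    have : ∫ z in Set.Iic y, p z = Real.exp (-(t * (x - y))) := by
      rw [← (integral_Iic_exp_kernel ht x y).2]
      refine setIntegral_congr_fun measurableSet_Iic fun z hz => ?_
      simp only [hp, Set.indicator_of_mem (show z ∈ Set.Iic x from (Set.mem_Iic.1 hz).trans hy)]
    simp only [this, mul_comm]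
  obtain ⟨j1, j2⟩ := integral_Iic_exp_kernel (half_pos ht) x x
  rw [e1, hsw]
  set Q := 4 * η / t + 2 * Real.exp (-(t / 2 * δ)) * I with hQ
  have hle : ∫ z in Set.Iic x, p z * ∫ y in Set.Ioc z x, φ y ≤
      ∫ z in Set.Iic x, t / 2 * Real.exp (-(t / 2 * (x - z))) * Q := by
    refine setIntegral_mono_on hint (j1.mul_const _) measurableSet_Iic fun z hz => ?_
    simp only [hp, Set.indicator_of_mem hz]
    -- Half of the exponent pays for the integral of `φ`: through `r e^{-r} ≤ 1` with `r = t (x - z)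
    -- / 2` when `x - z ≤ δ`, and through `e^{-tδ/2}` beyond. The other half is a kernel of total
    -- mass one.
    have e2 : Real.exp (-(t * (x - z))) =
        Real.exp (-(t / 2 * (x - z))) * Real.exp (-(t / 2 * (x - z))) := by
      rw [← Real.exp_add]; congr 1; ring
    have hE : 0 < Real.exp (-(t / 2 * (x - z))) := Real.exp_pos _
    have key : Real.exp (-(t / 2 * (x - z))) * ∫ y in Set.Ioc z x, φ y ≤ Q / 2 := by
      have q1 : 0 ≤ 4 * η / t := by positivity
      have q2 : 0 ≤ 2 * Real.exp (-(t / 2 * δ)) * I := by positivity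
      rcases eq_or_lt_of_le (show z ≤ x from hz) with rfl | hzx
      · simp only [Set.Ioc_self, setIntegral_empty, mul_zero]
        positivity
      · by_cases hr : x - z ≤ δ
        · have h1 := H (x - z) (by linarith) hr
          rw [sub_sub_cancel] at h1
          have h2 : t / 2 * (x - z) * Real.exp (-(t / 2 * (x - z))) ≤ 1 := by
            rw [Real.exp_neg, ← div_eq_mul_inv, div_le_one (Real.exp_pos _)]
            linarith [Real.add_one_le_exp (t / 2 * (x - z))]
          have h3 : Real.exp (-(t / 2 * (x - z))) * (η * (x - z)) ≤ 2 * η / t := by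
            rw [le_div_iff₀ ht]
            nlinarith
          have h4 : 4 * η / t = 2 * (2 * η / t) := by ring
          have := mul_le_mul_of_nonneg_left h1 hE.le
          linarith
        · have h1 : ∫ y in Set.Ioc z x, φ y ≤ I :=
            setIntegral_le_integral hφ (Eventually.of_forall hφ0)
          have h2 : Real.exp (-(t / 2 * (x - z))) ≤ Real.exp (-(t / 2 * δ)) := by
            refine Real.exp_le_exp.2 (neg_le_neg ?_)
            exact mul_le_mul_of_nonneg_left (not_le.1 hr).le (by positivity)
          have h3 := mul_le_mul h2 h1 (integral_nonneg hφ0) (Real.exp_pos _).le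
          linarith
    rw [e2]
    calc _ = t * Real.exp (-(t / 2 * (x - z))) *
          (Real.exp (-(t / 2 * (x - z))) * ∫ y in Set.Ioc z x, φ y) := by ring
      _ ≤ t * Real.exp (-(t / 2 * (x - z))) * (Q / 2) :=
          mul_le_mul_of_nonneg_left key (by positivity)
      _ = _ := by ring
  refine hle.trans (le_of_eq ?_)
  rw [integral_mul_const, j2]
  simp

theorem norm_oscInt_le_integral_exp {θ : ℂ} {t : ℝ} (ht : 0 ≤ t) (hθ : θ.re ≤ -t) {f : ℝ → ℂ}
    {h : ℝ → ℝ} (hh : Integrable h) (H : ∀ y, ‖f y‖ ≤ h y) (x : ℝ) :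
    ‖oscInt θ f x‖ ≤ ∫ y in Set.Iic x, Real.exp (-(t * (x - y))) * h y := by
  have hi : IntegrableOn (fun y => Real.exp (-(t * (x - y))) * h y) (Set.Iic x) := by
    refine Integrable.mono' hh.norm.integrableOn
      ((by fun_prop : Continuous fun y => Real.exp (-(t * (x - y)))).aestronglyMeasurable.mul
        hh.1).restrict ?_
    filter_upwards [ae_restrict_mem measurableSet_Iic] with y hy
    rw [norm_mul, Real.norm_of_nonneg (Real.exp_pos _).le]
    refine mul_le_of_le_one_left (norm_nonneg _) (Real.exp_le_one_iff.2 ?_)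
    have : 0 ≤ t * (x - y) := mul_nonneg ht (sub_nonneg.2 hy)
    linarith
  refine norm_integral_le_of_norm_le hi ?_
  filter_upwards [ae_restrict_mem measurableSet_Iic] with y hy
  rw [norm_mul, Complex.norm_exp, Complex.re_mul_ofReal]
  refine mul_le_mul (Real.exp_le_exp.2 ?_) (H y) (norm_nonneg _) (Real.exp_pos _).le
  have : θ.re * (x - y) ≤ -t * (x - y) := mul_le_mul_of_nonneg_right hθ (sub_nonneg.2 hy)
  linarith

variable {ι : Type*} {𝓕 : Filter ι} {θ : ι → ℂ} {s : ℝ}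

theorem tendsto_norm_mul_exp_neg (hθ : Tendsto (fun i => ‖θ i‖) 𝓕 atTop) {b : ℝ} (hb : 0 < b) :
    Tendsto (fun i => ‖θ i‖ * Real.exp (-b * ‖θ i‖)) 𝓕 (𝓝 0) := by
  have := (tendsto_rpow_mul_exp_neg_mul_atTop_nhds_zero 1 b hb).comp hθ
  simpa only [Function.comp_def, Real.rpow_one] using this

/-- `-θ e^{θ (x - y)}` is an approximate identity at Lebesgue points as `θ → ∞`
in a closed sector inside the left half plane. -/
theorem tendsto_mul_oscInt_of_isLebesguePoint (hθ : Tendsto (fun i => ‖θ i‖) 𝓕 atTop)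
    (hs : 0 < s) (hre : ∀ᶠ i in 𝓕, (θ i).re ≤ -(s * ‖θ i‖)) {f : ℝ → ℂ} (hf : Integrable f)
    {x : ℝ} (hx : IsLebesguePoint f x) :
    Tendsto (fun i => θ i * oscInt (θ i) f x) 𝓕 (𝓝 (-f x)) := by
  -- The constant `f x` is not integrable on the half-line, so it is cut off to `(x - 1, x]`. Its
  -- contribution is exactly `(e^θ - 1) f x`, which tends to `-f x` in the sector.
  set w : ℝ → ℂ := (Set.Ioc (x - 1) x).indicator fun _ => f x with hw
  have hwi : Integrable w := (integrable_indicator_iff measurableSet_Ioc).2 (by simp)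
  set φ : ℝ → ℂ := fun y => f y - w y with hφ
  have hφi : Integrable φ := hf.sub hwi
  have hexp : Tendsto (fun i => Complex.exp (θ i)) 𝓕 (𝓝 0) := by
    rw [tendsto_zero_iff_norm_tendsto_zero]
    have h1 : Tendsto (fun i => Real.exp (-(s * ‖θ i‖))) 𝓕 (𝓝 0) :=
      Real.tendsto_exp_neg_atTop_nhds_zero.comp (hθ.const_mul_atTop hs)
    refine squeeze_zero' (Eventually.of_forall fun _ => norm_nonneg _) ?_ h1
    filter_upwards [hre] with i hi
    rw [Complex.norm_exp]
    exact Real.exp_le_exp.2 hi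
  have hmain : Tendsto (fun i => θ i * oscInt (θ i) φ x) 𝓕 (𝓝 0) := by
    rw [Metric.tendsto_nhds]
    intro ε hε
    -- With this constant, `‖θ‖ * (4 η / (s ‖θ‖))` equals `ε / 2`.
    obtain ⟨δ, hδ, h⟩ := isLebesguePoint_iff.1 hx (ε * s / 8) (by positivity)
    set δ' := min δ 1 with hδ'
    have hδ'0 : 0 < δ' := lt_min hδ one_pos
    have h2 := (tendsto_norm_mul_exp_neg hθ (b := s / 2 * δ') (by positivity)).mul_const
      (2 * ∫ y, ‖φ y‖)
    rw [zero_mul] at h2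
    filter_upwards [hre, hθ.eventually_gt_atTop 0, (tendsto_order.1 h2).2 (ε / 2) (by positivity)]
      with i hi hi0 hi2
    rw [dist_zero_right, norm_mul]
    have hb := integral_exp_kernel_mul_le (φ := fun y => ‖φ y‖) hφi.norm (fun _ => norm_nonneg _)
      (η := ε * s / 8) (δ := δ') (t := s * ‖θ i‖) (x := x) (by positivity) (by positivity)
      (fun r hr hrδ => by
        refine le_trans ?_ (h r hr (hrδ.trans (min_le_left _ _)))
        have e : ∫ y in Set.Ioc (x - r) x, ‖φ y‖ = ∫ y in Set.Ioc (x - r) x, ‖f y - f x‖ := by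
          refine setIntegral_congr_fun measurableSet_Ioc fun y hy => ?_
          have hy' : y ∈ Set.Ioc (x - 1) x :=
            ⟨by linarith [hy.1, hrδ.trans (min_le_right δ 1)], hy.2⟩
          simp only [hφ, hw, Set.indicator_of_mem hy']
        rw [e]
        refine setIntegral_mono_set ?_ (Eventually.of_forall fun _ => norm_nonneg _) ?_
        · exact (hf.integrableOn.sub continuousOn_const.integrableOn_Icc).norm
        · exact (Set.Ioc_subset_Icc_self.trans
            (Set.Icc_subset_Icc_right (by linarith))).eventuallyLE)
    have hn := norm_oscInt_le_integral_exp (by positivity) hi hφi.norm (fun _ => le_rfl) x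
    have := mul_le_mul_of_nonneg_left (hn.trans hb) (norm_nonneg (θ i))
    have e1 : ‖θ i‖ * (4 * (ε * s / 8) / (s * ‖θ i‖) +
        2 * Real.exp (-(s * ‖θ i‖ / 2 * δ')) * ∫ y, ‖φ y‖) =
        ε / 2 + ‖θ i‖ * Real.exp (-(s / 2 * δ') * ‖θ i‖) * (2 * ∫ y, ‖φ y‖) := by
      have : -(s * ‖θ i‖ / 2 * δ') = -(s / 2 * δ') * ‖θ i‖ := by ring
      rw [this]
      field_simp
      ring
    linarith
  have hlim := (hmain.add (hexp.const_mul (f x))).sub_const (f x)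
  simp only [mul_zero, add_zero, zero_sub] at hlim
  refine hlim.congr' ?_
  filter_upwards [hre, hθ.eventually_gt_atTop 0] with i hi hi0
  have hθ0 : θ i ≠ 0 := norm_pos_iff.1 hi0
  have hneg : (θ i).re ≤ 0 := hi.trans (by nlinarith)
  have e1 : oscInt (θ i) f x = oscInt (θ i) φ x + oscInt (θ i) w x := by
    rw [← oscInt_add hneg hφi hwi]
    simp [hφ]
  have e2 : oscInt (θ i) w x = (θ i)⁻¹ * (Complex.exp (θ i) - 1) * f x := by
    have h1 : oscInt (θ i) w x =
        ∫ y in (x - 1)..x, Complex.exp (θ i * ((x - y : ℝ) : ℂ)) * f x := by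
      rw [oscInt, intervalIntegral.integral_of_le (by linarith),
        ← integral_indicator measurableSet_Iic, ← integral_indicator measurableSet_Ioc]
      congr 1; ext y
      by_cases hy : y ∈ Set.Ioc (x - 1) x
      · rw [Set.indicator_of_mem (show y ∈ Set.Iic x from hy.2), Set.indicator_of_mem hy, hw,
          Set.indicator_of_mem hy]
      · rw [Set.indicator_of_notMem hy]
        by_cases hy2 : y ∈ Set.Iic x
        · rw [Set.indicator_of_mem hy2, hw, Set.indicator_of_notMem hy, mul_zero]
        · rw [Set.indicator_of_notMem hy2]
    rw [h1, intervalIntegral.integral_mul_const, intervalIntegral_exp_kernel hθ0]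
    simp
  rw [e1, e2]
  field_simp
  ring

end ExponentialKernel

namespace VolterraCoeff

variable (c : VolterraCoeff)

/-- First-order asymptotics of the off-diagonal component at Lebesgue points of `C₁`. -/
theorem tendsto_mul_offdiag {κ : ℂ} (hκ : κ ≠ 0) {𝓕 : Filter ℂ}
    (h𝓕 : 𝓕 ≤ Bornology.cobounded ℂ) {s : ℝ} (hs : 0 < s)
    (hre : ∀ᶠ l in 𝓕, (phase κ l).re ≤ -(s * ‖phase κ l‖)) {x : ℝ}
    (hx : IsLebesguePoint c.C₁ x) {K δ : ℝ} (hδ : 0 < δ)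
    (hK : ∀ᵐ y, |y - x| ≤ δ → ‖c.C₁ y‖ + ‖c.C₂ y‖ + (‖c.D₁ y‖ + ‖c.D₂ y‖) ≤ K)
    {a b : ℂ → ℝ → ℂ} (hsol : ∀ᶠ l in 𝓕, c.IsSol κ l (a l) (b l)) :
    Tendsto (fun l => l * b l x) 𝓕 (𝓝 (-(κ⁻¹ * c.C₁ x * c.lim x))) := by
  have hphase : Tendsto (fun l => ‖phase κ l‖) 𝓕 atTop :=
    (tendsto_norm_cobounded_atTop.comp (tendsto_phase hκ)).mono_left h𝓕
  obtain ⟨δ₀, hδ₀, hlead⟩ := c.exists_leading_bound hκ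
  set M := c.limBound with hM
  have hM0 : 0 < M := c.limBound_pos
  set G : ℝ → ℝ := fun y => ‖c.C₁ y‖ + ‖c.C₂ y‖ + (‖c.D₁ y‖ + ‖c.D₂ y‖) with hG
  have hGi : Integrable G := (c.hC₁.norm.add c.hC₂.norm).add (c.hD₁.norm.add c.hD₂.norm)
  have hG0 : ∀ y, 0 ≤ G y := fun y => by positivity
  have hinv : Tendsto (fun l : ℂ => ‖l‖⁻¹) 𝓕 (𝓝 0) :=
    (tendsto_norm_cobounded_atTop.inv_tendsto_atTop).mono_left h𝓕
  set η : ℂ → ℝ := fun l => δ₀ l + ‖l‖⁻¹ * (M + δ₀ l) with hη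
  have hηt : Tendsto η 𝓕 (𝓝 0) := by
    have h0 := hδ₀.mono_left h𝓕
    simpa using h0.add (hinv.mul (h0.const_add M))
  have hK0 : 0 ≤ max K 0 := le_max_right _ _
  have hCE : IsLebesguePoint (fun y => c.C₁ y * c.lim y) x := by
    refine hx.of_norm_sub_le (isLebesguePoint_of_continuous c.continuous_lim x)
      c.hC₁.locallyIntegrable c.continuous_lim.locallyIntegrable hM0.le (norm_nonneg (c.C₁ x))
      (Eventually.of_forall fun y => ?_)
    have e : c.C₁ y * c.lim y - c.C₁ x * c.lim x =
        c.lim y * (c.C₁ y - c.C₁ x) + c.C₁ x * (c.lim y - c.lim x) := by ring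
    rw [e]
    refine (norm_add_le _ _).trans ?_
    rw [norm_mul, norm_mul]
    gcongr
    exact c.norm_lim_le y
  have hmain := tendsto_mul_oscInt_of_isLebesguePoint hphase hs hre
    (c.integrable_mul_lim c.hC₁) hCE
  set rest : ℂ → ℝ → ℂ := fun l y => c.C l y * a l y + c.D l y * b l y - c.C₁ y * c.lim y with hrest
  -- Multiplication by `θ` is harmless: `rest l` is at most `η l * G`, and since `G` is bounded near
  -- `x`, the sector keeps `‖θ‖` times the exponential average of `G` bounded. The factor `η l` then
  -- tends to zero.
  have hrest0 : Tendsto (fun l => phase κ l * oscInt (phase κ l) (rest l) x) 𝓕 (𝓝 0) := by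
    have hbound : Tendsto (fun l => η l * (4 * max K 0 / s + ‖phase κ l‖ *
        Real.exp (-(s / 2 * δ) * ‖phase κ l‖) * (2 * ∫ y, G y))) 𝓕 (𝓝 0) := by
      have := hηt.mul (((tendsto_norm_mul_exp_neg hphase (b := s / 2 * δ)
        (by positivity)).mul_const (2 * ∫ y, G y)).const_add (4 * max K 0 / s))
      simpa using this
    refine squeeze_zero_norm' ?_ hbound
    filter_upwards [hre, hphase.eventually_gt_atTop 0, hsol,
      h𝓕 (tendsto_norm_cobounded_atTop.eventually_gt_atTop 1)] with l hl hl0 h hl1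
    have hneg : (phase κ l).re < 0 := hl.trans_lt (by nlinarith)
    have hle := hlead l (a l) (b l) hl1 hneg h
    have hδ0 : 0 ≤ δ₀ l := (norm_nonneg _).trans (hle 0).1
    have ha : ∀ x, ‖a l x‖ ≤ M + δ₀ l := fun x => by
      have h1 := (hle x).1
      have h2 := c.norm_lim_le x
      have := norm_add_le (c.lim x) (a l x - c.lim x)
      rw [add_sub_cancel] at this
      linarith
    have hη0 : 0 ≤ η l := by simp only [hη]; positivity
    have hr : ∀ y, ‖rest l y‖ ≤ η l * G y := fun y => by
      have e : rest l y = c.C₁ y * (a l y - c.lim y) + l⁻¹ * a l y * c.C₂ y + c.D l y * b l y := by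
        simp only [hrest, C]; ring
      rw [e]
      refine norm_add₃_le.trans ?_
      have h1 : ‖c.C₁ y * (a l y - c.lim y)‖ ≤ η l * ‖c.C₁ y‖ := by
        rw [norm_mul, mul_comm]
        refine mul_le_mul_of_nonneg_right ((hle y).1.trans ?_) (norm_nonneg _)
        simp only [hη]; exact le_add_of_nonneg_right (by positivity)
      have h2 : ‖l⁻¹ * a l y * c.C₂ y‖ ≤ η l * ‖c.C₂ y‖ := by
        rw [norm_mul, norm_mul, norm_inv]
        refine mul_le_mul_of_nonneg_right ?_ (norm_nonneg _)
        refine (mul_le_mul_of_nonneg_left (ha y) (by positivity)).trans ?_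
        simp only [hη]; exact le_add_of_nonneg_left hδ0
      have h3 : ‖c.D l y * b l y‖ ≤ η l * (‖c.D₁ y‖ + ‖c.D₂ y‖) := by
        rw [norm_mul, mul_comm]
        refine mul_le_mul ((hle y).2.trans ?_) (norm_add_inv_mul_le hl1.le _ _) (norm_nonneg _) hη0
        simp only [hη]; exact le_add_of_nonneg_right (by positivity)
      simp only [hG]
      linarith
    have hb := integral_exp_kernel_mul_le hGi hG0 (η := max K 0) (δ := δ)
      (t := s * ‖phase κ l‖) (x := x) hK0 (by positivity) (fun r hr hrδ => by
        have : ∫ y in Set.Ioc (x - r) x, G y ≤ ∫ y in Set.Ioc (x - r) x, max K 0 := by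
          refine setIntegral_mono_on_ae hGi.integrableOn (by simp) measurableSet_Ioc ?_
          filter_upwards [hK] with y hy hym
          refine (hy ?_).trans (le_max_left _ _)
          rw [abs_le]; constructor <;> linarith [hym.1, hym.2]
        refine this.trans (le_of_eq ?_)
        rw [setIntegral_const, measureReal_def, Real.volume_Ioc, smul_eq_mul,
          ENNReal.toReal_ofReal (by linarith)]
        ring)
    have hn := norm_oscInt_le_integral_exp (by positivity) hl (hGi.const_mul (η l)) hr x
    simp only [mul_left_comm _ (η l)] at hn
    rw [integral_const_mul] at hn
    rw [norm_mul]
    refine (mul_le_mul_of_nonneg_left (hn.trans (mul_le_mul_of_nonneg_left hb hη0))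
      (norm_nonneg _)).trans (le_of_eq ?_)
    have : -(s * ‖phase κ l‖ / 2 * δ) = -(s / 2 * δ) * ‖phase κ l‖ := by ring
    rw [this]
    field_simp
  have hm : Tendsto (fun l => l * (phase κ l)⁻¹) 𝓕 (𝓝 κ⁻¹) :=
    (tendsto_mul_inv_phase hκ).mono_left h𝓕
  have hlim := hm.mul (hmain.add hrest0)
  have e : κ⁻¹ * (-(c.C₁ x * c.lim x) + 0) = -(κ⁻¹ * c.C₁ x * c.lim x) := by ring
  rw [e] at hlim
  refine hlim.congr' ?_
  filter_upwards [hre, hphase.eventually_gt_atTop 0, hsol] with l hl hl0 h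
  have hneg : (phase κ l).re < 0 := hl.trans_lt (by nlinarith)
  have hθ0 : phase κ l ≠ 0 := norm_pos_iff.1 hl0
  have i1 := c.integrable_mul_lim c.hC₁
  have i2 : Integrable (rest l) := ((h.integrable_mul_a (c.integrable_C l)).add
    (h.integrable_mul_b (c.integrable_D l))).sub i1
  have e2 : b l x = oscInt (phase κ l) (fun y => c.C₁ y * c.lim y) x +
      oscInt (phase κ l) (rest l) x := by
    rw [← oscInt_add hneg.le i1 i2, h.eq_b x]
    simp [hrest]
  rw [e2]
  field_simp

end VolterraCoeff

end MTM

/-! ### Existence and uniqueness for the scalar system. -/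

namespace MTM

namespace VolterraCoeff

variable (c : VolterraCoeff)

/-- The kernel of the Volterra system as an operator on `ℂ × ℂ`. -/
noncomputable def kernel (κ l : ℂ) (x y : ℝ) : ℂ × ℂ →L[ℂ] ℂ × ℂ :=
  c.A l y • (ContinuousLinearMap.inl ℂ ℂ ℂ ∘L ContinuousLinearMap.fst ℂ ℂ ℂ) +
  c.B l y • (ContinuousLinearMap.inl ℂ ℂ ℂ ∘L ContinuousLinearMap.snd ℂ ℂ ℂ) +
  (Complex.exp (phase κ l * ((x - y : ℝ) : ℂ)) * c.C l y) •
    (ContinuousLinearMap.inr ℂ ℂ ℂ ∘L ContinuousLinearMap.fst ℂ ℂ ℂ) +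
  (Complex.exp (phase κ l * ((x - y : ℝ) : ℂ)) * c.D l y) •
    (ContinuousLinearMap.inr ℂ ℂ ℂ ∘L ContinuousLinearMap.snd ℂ ℂ ℂ)

theorem kernel_apply (κ l : ℂ) (x y : ℝ) (p : ℂ × ℂ) : c.kernel κ l x y p =
    (c.A l y * p.1 + c.B l y * p.2,
      Complex.exp (phase κ l * ((x - y : ℝ) : ℂ)) * (c.C l y * p.1 + c.D l y * p.2)) := by
  ext
  · simp [kernel]
  · simp [kernel]; ring

/-- Only two properties of `S` matter: `‖l‖ > 1` bounds the `l⁻¹` terms and keeps `l ≠ 0`, and `Re θ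
≤ 0` bounds the exponential by one on `y ≤ x`. -/
theorem isVolterraKernel {κ : ℂ} {S U : Set ℂ} (hU : IsOpen U) (hUS : U ⊆ S)
    (hS : ∀ l ∈ S, 1 < ‖l‖ ∧ (phase κ l).re ≤ 0) :
    IsVolterraKernel S U (c.kernel κ) (fun y => 2 * c.weight y) where
  isOpen := hU
  subset := hUS
  integrable := c.integrable_weight.const_mul 2
  nonneg := fun y => mul_nonneg zero_le_two (c.weight_nonneg y)
  measurable := fun l _ x => by
    have hE := (continuous_oscKernel (phase κ l) x).aestronglyMeasurable (μ := volume)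
    exact ((((c.integrable_A l).1.smul_const _).add ((c.integrable_B l).1.smul_const _)).add
      ((hE.mul (c.integrable_C l).1).smul_const _)).add
      ((hE.mul (c.integrable_D l).1).smul_const _)
  bound := fun l hl x y hyx => by
    have hl1 := (hS l hl).1.le
    have hE : ∀ z : ℂ, ‖Complex.exp (phase κ l * ((x - y : ℝ) : ℂ)) * z‖ ≤ ‖z‖ := fun z =>
      norm_oscKernel_mul_le (hS l hl).2 (fun _ => z) hyx
    refine ContinuousLinearMap.opNorm_le_bound _
      (mul_nonneg zero_le_two (c.weight_nonneg y)) fun p => ?_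
    have hA := norm_add_inv_mul_le hl1 (c.A₁ y) (c.A₂ y)
    have hB := norm_add_inv_mul_le hl1 (c.B₁ y) (c.B₂ y)
    have hC := norm_add_inv_mul_le hl1 (c.C₁ y) (c.C₂ y)
    have hD := norm_add_inv_mul_le hl1 (c.D₁ y) (c.D₂ y)
    have h1 : ‖p.1‖ ≤ ‖p‖ := norm_fst_le p
    have h2 : ‖p.2‖ ≤ ‖p‖ := norm_snd_le p
    have hA' := mul_le_mul hA h1 (norm_nonneg _) (by positivity)
    have hB' := mul_le_mul hB h2 (norm_nonneg _) (by positivity)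
    have hC' := mul_le_mul hC h1 (norm_nonneg _) (by positivity)
    have hD' := mul_le_mul hD h2 (norm_nonneg _) (by positivity)
    have hw : c.weight y * ‖p‖ = (‖c.A₁ y‖ + ‖c.A₂ y‖) * ‖p‖ + (‖c.B₁ y‖ + ‖c.B₂ y‖) * ‖p‖ +
      (‖c.C₁ y‖ + ‖c.C₂ y‖) * ‖p‖ + (‖c.D₁ y‖ + ‖c.D₂ y‖) * ‖p‖ := by
      unfold weight; ring
    have nA : 0 ≤ (‖c.A₁ y‖ + ‖c.A₂ y‖) * ‖p‖ := by positivity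
    have nB : 0 ≤ (‖c.B₁ y‖ + ‖c.B₂ y‖) * ‖p‖ := by positivity
    have nC : 0 ≤ (‖c.C₁ y‖ + ‖c.C₂ y‖) * ‖p‖ := by positivity
    have nD : 0 ≤ (‖c.D₁ y‖ + ‖c.D₂ y‖) * ‖p‖ := by positivity
    rw [kernel_apply, Prod.norm_def, mul_assoc, hw]
    refine max_le ?_ ((hE _).trans ?_)
    · refine (norm_add_le _ _).trans ?_
      rw [norm_mul, norm_mul]
      simp only [A, B]
      linarith
    · refine (norm_add_le _ _).trans ?_
      rw [norm_mul, norm_mul]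
      simp only [C, D]
      linarith
  continuous := fun l _ y => by
    have hE : Continuous fun x : ℝ => Complex.exp (phase κ l * ((x - y : ℝ) : ℂ)) := by fun_prop
    exact ((continuous_const.add continuous_const).add
      ((hE.mul continuous_const).smul continuous_const)).add
      ((hE.mul continuous_const).smul continuous_const)
  continuousOn := fun x y => by
    have h0 : ∀ l ∈ S, l ≠ 0 := fun l hl => norm_pos_iff.1 (by linarith [(hS l hl).1])
    have hi : ContinuousOn (fun l : ℂ => l⁻¹) S := continuousOn_id.inv₀ h0
    have hp : ∀ p q : ℂ, ContinuousOn (fun l : ℂ => p + l⁻¹ * q) S := fun p q =>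
      continuousOn_const.add (hi.mul continuousOn_const)
    have hE : ContinuousOn (fun l : ℂ => Complex.exp (phase κ l * ((x - y : ℝ) : ℂ))) S :=
      ((continuousOn_const.mul (continuousOn_id.sub hi)).mul continuousOn_const).cexp
    exact ((((hp _ _).smul continuousOn_const).add ((hp _ _).smul continuousOn_const)).add
      ((hE.mul (hp _ _)).smul continuousOn_const)).add ((hE.mul (hp _ _)).smul continuousOn_const)
  differentiableOn := fun x y => by
    have h0 : ∀ l ∈ U, l ≠ 0 := fun l hl => norm_pos_iff.1 (by linarith [(hS l (hUS hl)).1])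
    have hi : DifferentiableOn ℂ (fun l : ℂ => l⁻¹) U := differentiableOn_id.inv h0
    have hp : ∀ p q : ℂ, DifferentiableOn ℂ (fun l : ℂ => p + l⁻¹ * q) U := fun p q =>
      (differentiableOn_const _).add (hi.mul (differentiableOn_const _))
    have hE : DifferentiableOn ℂ (fun l : ℂ => Complex.exp (phase κ l * ((x - y : ℝ) : ℂ))) U :=
      (((differentiableOn_const _).mul (differentiableOn_id.sub hi)).mul
        (differentiableOn_const _)).cexp
    exact ((((hp _ _).smul (differentiableOn_const _)).add
      ((hp _ _).smul (differentiableOn_const _))).add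
      ((hE.mul (hp _ _)).smul (differentiableOn_const _))).add
      ((hE.mul (hp _ _)).smul (differentiableOn_const _))

/-- Existence of solutions, with analytic dependence on the spectral parameter. -/
theorem exists_isSol {κ : ℂ} {S U : Set ℂ} (hU : IsOpen U) (hUS : U ⊆ S)
    (hS : ∀ l ∈ S, 1 < ‖l‖ ∧ (phase κ l).re ≤ 0) :
    ∃ a b : ℂ → ℝ → ℂ, (∀ l ∈ S, c.IsSol κ l (a l) (b l)) ∧
      (∀ x, ContinuousOn (fun l => a l x) S ∧ ContinuousOn (fun l => b l x) S) ∧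
      ∀ x, DifferentiableOn ℂ (fun l => a l x) U ∧ DifferentiableOn ℂ (fun l => b l x) U := by
  obtain ⟨Φ, K, hΦ, heq⟩ := (c.isVolterraKernel hU hUS hS).exists_solution ((1, 0) : ℂ × ℂ)
  refine ⟨fun l x => (Φ l x).1, fun l x => (Φ l x).2, fun l hl => ?_,
    fun x => ⟨(hΦ.continuousOn x).fst, (hΦ.continuousOn x).snd⟩,
    fun x => ⟨(hΦ.differentiableOn x).fst, (hΦ.differentiableOn x).snd⟩⟩
  have hca := (hΦ.continuous l hl).fst
  have hcb := (hΦ.continuous l hl).snd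
  have hKa : ∀ x, ‖(Φ l x).1‖ ≤ K := fun x => (norm_fst_le _).trans (hΦ.bound l hl x)
  have hKb : ∀ x, ‖(Φ l x).2‖ ≤ K := fun x => (norm_snd_le _).trans (hΦ.bound l hl x)
  have i1 : Integrable fun y => c.A l y * (Φ l y).1 + c.B l y * (Φ l y).2 :=
    (integrable_mul_of_continuous_bdd (c.integrable_A l) hca hKa).add
      (integrable_mul_of_continuous_bdd (c.integrable_B l) hcb hKb)
  have i2 : Integrable fun y => c.C l y * (Φ l y).1 + c.D l y * (Φ l y).2 :=
    (integrable_mul_of_continuous_bdd (c.integrable_C l) hca hKa).add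
      (integrable_mul_of_continuous_bdd (c.integrable_D l) hcb hKb)
  have key : ∀ x, Φ l x = (1 + ∫ y in Set.Iic x, (c.A l y * (Φ l y).1 + c.B l y * (Φ l y).2),
      oscInt (phase κ l) (fun y => c.C l y * (Φ l y).1 + c.D l y * (Φ l y).2) x) := fun x => by
    rw [heq l hl x]
    simp only [kernel_apply]
    rw [integral_pair i1.integrableOn (integrableOn_oscInt (hS l hl).2 i2 x)]
    simp only [Prod.mk_add_mk, zero_add]
    rfl
  exact ⟨hca, hcb, ⟨K, fun x => ⟨hKa x, hKb x⟩⟩, fun x => congrArg Prod.fst (key x),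
    fun x => congrArg Prod.snd (key x)⟩

variable {c}

/-- Uniqueness in `L^∞`. -/
theorem IsSol.ae_eq {κ l : ℂ} {a b a' b' : ℝ → ℂ} (h : c.IsSol κ l a b) (hl : 1 < ‖l‖)
    (hre : (phase κ l).re ≤ 0) (hma : AEStronglyMeasurable a') (hmb : AEStronglyMeasurable b')
    {K : ℝ} (hK : ∀ᵐ x, ‖a' x‖ ≤ K ∧ ‖b' x‖ ≤ K)
    (heqa : ∀ᵐ x, a' x = 1 + ∫ y in Set.Iic x, (c.A l y * a' y + c.B l y * b' y))
    (heqb : ∀ᵐ x, b' x = oscInt (phase κ l) (fun y => c.C l y * a' y + c.D l y * b' y) x) :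
    ∀ᵐ x, a' x = a x ∧ b' x = b x := by
  obtain ⟨L, hL⟩ := h.bdd
  set f : ℝ → ℝ := fun x => ‖a' x - a x‖ + ‖b' x - b x‖ with hf
  have hda := hma.sub h.continuous_a.aestronglyMeasurable
  have hdb := hmb.sub h.continuous_b.aestronglyMeasurable
  have hfm : AEStronglyMeasurable f := hda.norm.add hdb.norm
  have hf0 : ∀ x, 0 ≤ f x := fun x => by positivity
  have hfb : ∀ᵐ x, |f x| ≤ (K + L) + (K + L) := by
    filter_upwards [hK] with x hx
    rw [abs_of_nonneg (hf0 x)]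
    exact add_le_add ((norm_sub_le _ _).trans (add_le_add hx.1 (hL x).1))
      ((norm_sub_le _ _).trans (add_le_add hx.2 (hL x).2))
  have iA' : ∀ {p : ℝ → ℂ}, Integrable p → Integrable fun y => p y * a' y := fun hp =>
    hp.mul_bdd (c := K) hma (hK.mono fun x hx => hx.1)
  have iB' : ∀ {p : ℝ → ℂ}, Integrable p → Integrable fun y => p y * b' y := fun hp =>
    hp.mul_bdd (c := K) hmb (hK.mono fun x hx => hx.2)
  set wa : ℝ → ℝ := fun y => (‖c.A₁ y‖ + ‖c.A₂ y‖) + (‖c.B₁ y‖ + ‖c.B₂ y‖) with hwa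
  set wb : ℝ → ℝ := fun y => (‖c.C₁ y‖ + ‖c.C₂ y‖) + (‖c.D₁ y‖ + ‖c.D₂ y‖) with hwb
  have hwai : Integrable wa := (c.hA₁.norm.add c.hA₂.norm).add (c.hB₁.norm.add c.hB₂.norm)
  have hwbi : Integrable wb := (c.hC₁.norm.add c.hC₂.norm).add (c.hD₁.norm.add c.hD₂.norm)
  have hwf : Integrable fun y => wa y * f y := hwai.mul_bdd hfm hfb
  have hwf' : Integrable fun y => wb y * f y := hwbi.mul_bdd hfm hfb
  have pw : ∀ (p₁ p₂ q₁ q₂ : ℂ) (y : ℝ),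
      ‖(p₁ + l⁻¹ * p₂) * a' y + (q₁ + l⁻¹ * q₂) * b' y -
        ((p₁ + l⁻¹ * p₂) * a y + (q₁ + l⁻¹ * q₂) * b y)‖ ≤
        ((‖p₁‖ + ‖p₂‖) + (‖q₁‖ + ‖q₂‖)) * f y := by
    intro p₁ p₂ q₁ q₂ y
    have e : (p₁ + l⁻¹ * p₂) * a' y + (q₁ + l⁻¹ * q₂) * b' y -
        ((p₁ + l⁻¹ * p₂) * a y + (q₁ + l⁻¹ * q₂) * b y) =
        (p₁ + l⁻¹ * p₂) * (a' y - a y) + (q₁ + l⁻¹ * q₂) * (b' y - b y) := by ring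
    rw [e, add_mul (‖p₁‖ + ‖p₂‖)]
    refine (norm_add_le _ _).trans (add_le_add ?_ ?_)
    · rw [norm_mul]
      exact mul_le_mul (norm_add_inv_mul_le hl.le _ _)
        (le_add_of_nonneg_right (norm_nonneg _)) (norm_nonneg _) (by positivity)
    · rw [norm_mul]
      exact mul_le_mul (norm_add_inv_mul_le hl.le _ _)
        (le_add_of_nonneg_left (norm_nonneg _)) (norm_nonneg _) (by positivity)
  have i1 : Integrable fun y => c.A l y * a y + c.B l y * b y :=
    (h.integrable_mul_a (c.integrable_A l)).add (h.integrable_mul_b (c.integrable_B l))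
  have i1' : Integrable fun y => c.A l y * a' y + c.B l y * b' y :=
    (iA' (c.integrable_A l)).add (iB' (c.integrable_B l))
  have i2 : Integrable fun y => c.C l y * a y + c.D l y * b y :=
    (h.integrable_mul_a (c.integrable_C l)).add (h.integrable_mul_b (c.integrable_D l))
  have i2' : Integrable fun y => c.C l y * a' y + c.D l y * b' y :=
    (iA' (c.integrable_C l)).add (iB' (c.integrable_D l))
  -- The difference of two solutions has no source, so Grönwall with constant `0` makes it vanish
  -- almost everywhere.
  have hineq : ∀ᵐ x, f x ≤ 0 + ∫ y in Set.Iic x, c.weight y * f y := by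
    filter_upwards [heqa, heqb] with x ha hb
    have e : ∫ y in Set.Iic x, c.weight y * f y =
        (∫ y in Set.Iic x, wa y * f y) + ∫ y in Set.Iic x, wb y * f y := by
      rw [← integral_add hwf.integrableOn hwf'.integrableOn]
      congr 1; ext y
      simp only [weight, hwa, hwb]; ring
    rw [zero_add, e]
    refine add_le_add ?_ ?_
    · rw [ha, h.eq_a x, add_sub_add_left_eq_sub, ← integral_sub i1'.integrableOn i1.integrableOn]
      exact norm_integral_Iic_le hwf (fun y => pw _ _ _ _ y) x
    · have e2 : oscInt (phase κ l) (fun y => c.C l y * a' y + c.D l y * b' y) x - b x =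
          oscInt (phase κ l) (fun y => (c.C l y * a' y + c.D l y * b' y) -
            (c.C l y * a y + c.D l y * b y)) x := by
        rw [h.eq_b x, sub_eq_iff_eq_add, ← oscInt_add hre (by exact i2'.sub i2) i2]
        simp only [sub_add_cancel]
      rw [hb, e2]
      exact norm_oscInt_le hre hwf' (fun y => pw _ _ _ _ y) x
  filter_upwards [gronwall_Iic le_rfl hfm hfb c.integrable_weight c.weight_nonneg hineq] with x hx
  rw [zero_mul] at hx
  have h1 := norm_nonneg (a' x - a x)
  have h2 := norm_nonneg (b' x - b x)
  exact ⟨sub_eq_zero.1 (norm_eq_zero.1 (by linarith)), sub_eq_zero.1 (norm_eq_zero.1 (by linarith))⟩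

/-- Changing the coefficients on null sets does not change the solutions. -/
theorem IsSol.congr_ae {κ l : ℂ} {a b : ℝ → ℂ} (h : c.IsSol κ l a b) {c' : VolterraCoeff}
    (hA : c.A l =ᵐ[volume] c'.A l) (hB : c.B l =ᵐ[volume] c'.B l) (hC : c.C l =ᵐ[volume] c'.C l)
    (hD : c.D l =ᵐ[volume] c'.D l) : c'.IsSol κ l a b where
  continuous_a := h.continuous_a
  continuous_b := h.continuous_b
  bdd := h.bdd
  eq_a := fun x => by
    rw [h.eq_a x]
    congr 1
    refine integral_congr_ae (ae_restrict_of_ae ?_)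
    filter_upwards [hA, hB] with y h1 h2
    rw [h1, h2]
  eq_b := fun x => by
    rw [h.eq_b x]
    refine integral_congr_ae (ae_restrict_of_ae ?_)
    filter_upwards [hC, hD] with y h1 h2
    simp only [h1, h2]

end VolterraCoeff

end MTM

/-! ### Integrability of the potentials, reflection of the line, and the sign of the phase. -/

namespace MTM

section Potentials

theorem exists_ae_norm_le {E : Type*} [NormedAddCommGroup E] {f : ℝ → E} (hf : MemLp f ∞ volume) :
    ∃ K : ℝ, 0 ≤ K ∧ ∀ᵐ y, ‖f y‖ ≤ K := by
  have h := hf.2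
  rw [eLpNorm_exponent_top] at h
  refine ⟨(eLpNormEssSup f volume).toReal, ENNReal.toReal_nonneg, ?_⟩
  filter_upwards [enorm_ae_le_eLpNormEssSup f volume] with y hy
  rw [← toReal_enorm]
  exact ENNReal.toReal_mono h.ne hy

variable {u v vx : ℝ → ℂ}

theorem integrable_norm_sq (hu1 : MemLp u 1 volume) (huinf : MemLp u ∞ volume) :
    Integrable fun y => ‖u y‖ ^ 2 := by
  obtain ⟨K, -, hK⟩ := exists_ae_norm_le huinf
  have hu := memLp_one_iff_integrable.1 hu1
  refine (hu.norm.mul_bdd (c := K) hu.1.norm (by simpa using hK)).congr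
    (Eventually.of_forall fun y => (sq _).symm)

theorem integrable_Q1 (hu1 : MemLp u 1 volume) (huinf : MemLp u ∞ volume)
    (hv1 : MemLp v 1 volume) (hvinf : MemLp v ∞ volume) (hvx1 : MemLp vx 1 volume) (i k : Fin 2) :
    Integrable fun y => Q1 u v vx y i k := by
  obtain ⟨K, -, hK⟩ := exists_ae_norm_le hvinf
  have hu := memLp_one_iff_integrable.1 hu1
  have hv := memLp_one_iff_integrable.1 hv1
  have hw := memLp_one_iff_integrable.1 hvx1
  have i1 : Integrable fun y => ((‖u y‖ ^ 2 + ‖v y‖ ^ 2 : ℝ) : ℂ) :=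
    ((integrable_norm_sq hu1 huinf).add (integrable_norm_sq hv1 hvinf)).ofReal
  have i2 : Integrable fun y => conj (v y) := Complex.conjLIE.toContinuousLinearEquiv.integrable_comp_iff.2 hv
  have i3 : Integrable fun y => Complex.I / 2 * ((‖u y‖ ^ 2 : ℝ) : ℂ) * v y :=
    ((integrable_norm_sq hu1 huinf).ofReal.const_mul (Complex.I / 2)).mul_bdd (c := K) hv.1 hK
  fin_cases i <;> fin_cases k
  · exact i1.const_mul _
  · exact i2.const_mul _
  · exact (hw.add i3).add (hu.const_mul _)
  · exact i1.const_mul _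

theorem integrable_Q2 (hu1 : MemLp u 1 volume) (hv1 : MemLp v 1 volume)
    (hvinf : MemLp v ∞ volume) (i k : Fin 2) : Integrable fun y => Q2 u v y i k := by
  obtain ⟨K, hK0, hK⟩ := exists_ae_norm_le hvinf
  have hu := memLp_one_iff_integrable.1 hu1
  have hv := memLp_one_iff_integrable.1 hv1
  have i1 : Integrable fun y => conj (u y) := Complex.conjLIE.toContinuousLinearEquiv.integrable_comp_iff.2 hu
  have i2 : Integrable fun y => conj (u y) * v y := i1.mul_bdd (c := K) hv.1 hK
  have i3 : Integrable fun y => conj (u y) * v y ^ 2 :=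
    i1.mul_bdd (c := K ^ 2) (hv.1.pow 2) (by
      filter_upwards [hK] with y hy
      rw [norm_pow]; gcongr)
  fin_cases i <;> fin_cases k
  · exact i2.const_mul _
  · exact i1.neg.const_mul _
  · exact (hv.add i3).const_mul _
  · exact i2.neg.const_mul _

end Potentials

section Reflection

/-- The orientation of the half-line ending at `s`. -/
noncomputable def LineEnd.sgn : LineEnd → ℝ
  | .plus => -1
  | .minus => 1

theorem LineEnd.sgn_mul_sgn (s : LineEnd) : s.sgn * s.sgn = 1 := by cases s <;> simp [LineEnd.sgn]

theorem LineEnd.sgn_mul_sgn_mul (s : LineEnd) (x : ℝ) : s.sgn * (s.sgn * x) = x := by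
  rw [← mul_assoc, s.sgn_mul_sgn, one_mul]

theorem LineEnd.sgn_ne_zero (s : LineEnd) : s.sgn ≠ 0 := by cases s <;> simp [LineEnd.sgn]

theorem LineEnd.measurePreserving (s : LineEnd) :
    MeasurePreserving (fun x : ℝ => s.sgn * x) volume volume := by
  cases s
  · simpa [LineEnd.sgn] using Measure.measurePreserving_neg (volume : Measure ℝ)
  · simpa [LineEnd.sgn, Function.id_def] using MeasurePreserving.id (volume : Measure ℝ)

theorem LineEnd.ae_comp (s : LineEnd) {p : ℝ → Prop} (h : ∀ᵐ x, p x) : ∀ᵐ x, p (s.sgn * x) :=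
  s.measurePreserving.quasiMeasurePreserving.ae h

theorem LineEnd.integrable_comp (s : LineEnd) {E : Type*} [NormedAddCommGroup E] {f : ℝ → E}
    (hf : Integrable f) : Integrable fun y => f (s.sgn * y) :=
  hf.comp_mul_left' s.sgn_ne_zero

/-- Integration from `+∞` becomes integration from `-∞` under `y ↦ -y`, at the price of a sign; both
normalizations are thereby served by one theory. -/
theorem intFrom_eq {E : Type*} [NormedAddCommGroup E] [NormedSpace ℝ E]
    (s : LineEnd) (x : ℝ) (f : ℝ → E) :
    intFrom s x f = ∫ y in Set.Iic (s.sgn * x), s.sgn • f (s.sgn * y) := by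
  cases s
  · simp only [intFrom, LineEnd.sgn, neg_mul, one_mul, neg_smul, one_smul]
    rw [integral_neg, integral_comp_neg_Iic (-x) f, neg_neg]
  · simp [intFrom, LineEnd.sgn]

theorem IsLebesguePoint.comp_sgn {f : ℝ → ℂ} {x : ℝ} (hf : IsLebesguePoint f x) (s : LineEnd) :
    IsLebesguePoint (fun y => f (s.sgn * y)) (s.sgn * x) := by
  cases s
  · simpa [LineEnd.sgn] using hf.comp_neg
  · simpa [LineEnd.sgn] using hf

/-- The sign in the exponent of `e^{z σ̂₃}` acting on the off-diagonal entry of column `j`. -/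
noncomputable def colSgn (j : Fin 2) : ℝ := if j = 0 then -1 else 1

theorem halfPlaneSign_eq (s : LineEnd) (j : Fin 2) : halfPlaneSign s j = s.sgn * colSgn j := by
  cases s <;> fin_cases j <;> simp [halfPlaneSign, LineEnd.sgn, colSgn]

/-- The constant `κ` for which the off-diagonal entry of column `j`, normalized at `s`,
carries the phase `κ (l - l⁻¹)`. -/
noncomputable def phaseConst (s : LineEnd) (j : Fin 2) : ℂ :=
  ((halfPlaneSign s j : ℝ) : ℂ) * (Complex.I / 2)

theorem halfPlaneSign_mul_self (s : LineEnd) (j : Fin 2) :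
    halfPlaneSign s j * halfPlaneSign s j = 1 := by
  cases s <;> fin_cases j <;> simp [halfPlaneSign]

theorem phaseConst_ne_zero (s : LineEnd) (j : Fin 2) : phaseConst s j ≠ 0 := by
  have : halfPlaneSign s j ≠ 0 := fun h => by simpa [h] using halfPlaneSign_mul_self s j
  simpa [phaseConst] using this

/-- The origin of the domains: the exponential decays precisely on the side where `halfPlaneSign s j
* l.im` is positive. -/
theorem re_phase_phaseConst (s : LineEnd) (j : Fin 2) (l : ℂ) :
    (phase (phaseConst s j) l).re =
      -(halfPlaneSign s j * l.im) * (1 + (Complex.normSq l)⁻¹) / 2 := by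
  simp only [phase, phaseConst, Complex.mul_re, Complex.mul_im, Complex.ofReal_re,
    Complex.ofReal_im, Complex.sub_re, Complex.sub_im, Complex.inv_im, Complex.inv_re,
    Complex.div_ofNat_re, Complex.div_ofNat_im, Complex.I_re, Complex.I_im]
  ring

theorem re_phase_nonpos {s : LineEnd} {j : Fin 2} {l : ℂ} (hl : l ∈ closedDomain s j) :
    (phase (phaseConst s j) l).re ≤ 0 := by
  rw [re_phase_phaseConst]
  have h1 := hl.2
  have h2 : 0 ≤ (Complex.normSq l)⁻¹ := inv_nonneg.2 (Complex.normSq_nonneg l)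
  have := mul_nonneg h1 (by linarith : 0 ≤ 1 + (Complex.normSq l)⁻¹)
  linarith

theorem re_phase_neg {s : LineEnd} {j : Fin 2} {l : ℂ} (hl : l ∈ openDomain s j) :
    (phase (phaseConst s j) l).re < 0 := by
  rw [re_phase_phaseConst]
  have h1 := hl.2
  have h2 : 0 ≤ (Complex.normSq l)⁻¹ := inv_nonneg.2 (Complex.normSq_nonneg l)
  have := mul_pos h1 (by linarith : 0 < 1 + (Complex.normSq l)⁻¹)
  linarith

/-- For `‖l‖ > 1` one has `‖θ‖ ≤ ‖l‖`, while `Re θ ≤ -|Im l| / 2`; hence the aperture `ε / 2` for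
the phase. -/
theorem re_phase_le_of_sector {s : LineEnd} {j : Fin 2} {l : ℂ} {ε : ℝ} (hε : 0 < ε)
    (hl : l ∈ openDomain s j) (hlε : ε * ‖l‖ ≤ |l.im|) :
    (phase (phaseConst s j) l).re ≤ -(ε / 2 * ‖phase (phaseConst s j) l‖) := by
  have hs : |halfPlaneSign s j| = 1 := by
    cases s <;> fin_cases j <;> simp [halfPlaneSign]
  have h1 : halfPlaneSign s j * l.im = |l.im| := by
    rw [← abs_of_pos hl.2, abs_mul, hs, one_mul]
  have h2 : 0 ≤ (Complex.normSq l)⁻¹ := inv_nonneg.2 (Complex.normSq_nonneg l)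
  have hn : ‖phase (phaseConst s j) l‖ ≤ ‖l‖ := by
    rw [phase, phaseConst, norm_mul, norm_mul, Complex.norm_real, Real.norm_eq_abs, hs, one_mul,
      norm_div, Complex.norm_I, Complex.norm_two]
    have h3 := norm_sub_le l l⁻¹
    have h4 : ‖l⁻¹‖ ≤ 1 := by rw [norm_inv]; exact inv_le_one_of_one_le₀ hl.1.le
    linarith [hl.1]
  rw [re_phase_phaseConst, h1]
  have h5 := mul_nonneg (abs_nonneg l.im) h2
  have h6 := mul_le_mul_of_nonneg_left hn hε.le
  nlinarith

theorem openDomain_subset (s : LineEnd) (j : Fin 2) : openDomain s j ⊆ closedDomain s j :=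
  fun _ hl => ⟨hl.1, hl.2.le⟩

theorem isOpen_openDomain (s : LineEnd) (j : Fin 2) : IsOpen (openDomain s j) :=
  (isOpen_lt continuous_const continuous_norm).inter
    (isOpen_lt continuous_const (continuous_const.mul Complex.continuous_im))

end Reflection

section Columns

theorem expSigmaHatCol_self (z : ℂ) (j : Fin 2) (w : Fin 2 → ℂ) : expSigmaHatCol z j w j = w j := by
  fin_cases j <;>
    simp [expSigmaHatCol, expSigma3, dotProduct, ← mul_assoc, ← Complex.exp_add]

/-- In `Fin 2` the index `1 - j` is the one other than `j`. The off-diagonal factor is `e^{-2z}` in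
column `0` and `e^{2z}` in column `1`. -/
theorem expSigmaHatCol_other (z : ℂ) (j : Fin 2) (w : Fin 2 → ℂ) :
    expSigmaHatCol z j w (1 - j) = Complex.exp (2 * colSgn j * z) * w (1 - j) := by
  fin_cases j <;>
    simp [expSigmaHatCol, expSigma3, dotProduct, ← mul_assoc, ← Complex.exp_add,
      colSgn, two_mul]

theorem mulVec_eq (M : Matrix (Fin 2) (Fin 2) ℂ) (w : Fin 2 → ℂ) (i j : Fin 2) :
    (M *ᵥ w) i = M i j * w j + M i (1 - j) * w (1 - j) := by
  fin_cases j <;> simp [Matrix.mulVec, dotProduct, add_comm]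

theorem eq_or_eq_one_sub (i j : Fin 2) : i = j ∨ i = 1 - j := by
  fin_cases i <;> fin_cases j <;> simp

theorem one_sub_ne (j : Fin 2) : 1 - j ≠ j := by fin_cases j <;> simp

end Columns

end MTM

/-! ### Translation between the column equations and the scalar system. -/

namespace MTM

variable {u v vx : ℝ → ℂ}

/-- The coefficients of the system for column `j` normalized at `s`, reflected to `(-∞, x]`. -/
noncomputable def jostCoeff (h₁ : ∀ i k, Integrable fun y => Q1 u v vx y i k)
    (h₂ : ∀ i k, Integrable fun y => Q2 u v y i k) (s : LineEnd) (j : Fin 2) : VolterraCoeff where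
  A₁ y := s.sgn * Q1 u v vx (s.sgn * y) j j
  A₂ y := s.sgn * Q2 u v (s.sgn * y) j j
  B₁ y := s.sgn * Q1 u v vx (s.sgn * y) j (1 - j)
  B₂ y := s.sgn * Q2 u v (s.sgn * y) j (1 - j)
  C₁ y := s.sgn * Q1 u v vx (s.sgn * y) (1 - j) j
  C₂ y := s.sgn * Q2 u v (s.sgn * y) (1 - j) j
  D₁ y := s.sgn * Q1 u v vx (s.sgn * y) (1 - j) (1 - j)
  D₂ y := s.sgn * Q2 u v (s.sgn * y) (1 - j) (1 - j)
  hA₁ := (s.integrable_comp (h₁ _ _)).const_mul _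
  hA₂ := (s.integrable_comp (h₂ _ _)).const_mul _
  hB₁ := (s.integrable_comp (h₁ _ _)).const_mul _
  hB₂ := (s.integrable_comp (h₂ _ _)).const_mul _
  hC₁ := (s.integrable_comp (h₁ _ _)).const_mul _
  hC₂ := (s.integrable_comp (h₂ _ _)).const_mul _
  hD₁ := (s.integrable_comp (h₁ _ _)).const_mul _
  hD₂ := (s.integrable_comp (h₂ _ _)).const_mul _

variable (h₁ : ∀ i k, Integrable fun y => Q1 u v vx y i k)
  (h₂ : ∀ i k, Integrable fun y => Q2 u v y i k)

theorem LineEnd.memLp_comp (s : LineEnd) {E : Type*} [NormedAddCommGroup E] {f : ℝ → E}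
    (hf : MemLp f ∞ volume) : MemLp (fun y => f (s.sgn * y)) ∞ volume :=
  hf.comp_measurePreserving s.measurePreserving

/-- Stated for every essentially bounded `Ψ`, so that it serves to build a solution and also to
recognize a competing one. -/
theorem volterraRHS_apply (s : LineEnd) (j : Fin 2) {l : ℂ} (hl : l ∈ closedDomain s j)
    {Ψ : ℝ → Fin 2 → ℂ} (hΨ : MemLp Ψ ∞ volume) (x : ℝ) :
    volterraRHS u v vx s j l Ψ x j = 1 + ∫ y in Set.Iic (s.sgn * x),
      ((jostCoeff h₁ h₂ s j).A l y * Ψ (s.sgn * y) j +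
        (jostCoeff h₁ h₂ s j).B l y * Ψ (s.sgn * y) (1 - j)) ∧
    volterraRHS u v vx s j l Ψ x (1 - j) = oscInt (phase (phaseConst s j) l) (fun y =>
      (jostCoeff h₁ h₂ s j).C l y * Ψ (s.sgn * y) j +
        (jostCoeff h₁ h₂ s j).D l y * Ψ (s.sgn * y) (1 - j)) (s.sgn * x) := by
  set c := jostCoeff h₁ h₂ s j with hc
  obtain ⟨K, -, hK⟩ := exists_ae_norm_le hΨ
  have hΨ' := s.memLp_comp hΨ
  have hm : ∀ i, AEStronglyMeasurable (fun y => Ψ (s.sgn * y) i) volume := fun i =>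
    (continuous_apply i).comp_aestronglyMeasurable hΨ'.1
  have hb : ∀ i, ∀ᵐ y, ‖Ψ (s.sgn * y) i‖ ≤ K := fun i => by
    filter_upwards [s.ae_comp hK] with y hy using (norm_le_pi_norm _ i).trans hy
  have iP : ∀ {p : ℝ → ℂ} (i), Integrable p → Integrable fun y => p y * Ψ (s.sgn * y) i :=
    fun i hp => hp.mul_bdd (c := K) (hm i) (hb i)
  have iA : Integrable fun y => c.A l y * Ψ (s.sgn * y) j + c.B l y * Ψ (s.sgn * y) (1 - j) :=
    (iP _ (c.integrable_A l)).add (iP _ (c.integrable_B l))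
  have iC : Integrable fun y => c.C l y * Ψ (s.sgn * y) j + c.D l y * Ψ (s.sgn * y) (1 - j) :=
    (iP _ (c.integrable_C l)).add (iP _ (c.integrable_D l))
  set F : ℝ → Fin 2 → ℂ := fun y => s.sgn • expSigmaHatCol
    (Complex.I / 4 * (l - l⁻¹) * ((x - s.sgn * y : ℝ) : ℂ)) j
      ((Q1 u v vx (s.sgn * y) + l⁻¹ • Q2 u v (s.sgn * y)) *ᵥ Ψ (s.sgn * y)) with hF
  have e1 : ∀ y, F y j = c.A l y * Ψ (s.sgn * y) j + c.B l y * Ψ (s.sgn * y) (1 - j) := fun y => by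
    simp only [hF, Pi.smul_apply, Complex.real_smul, expSigmaHatCol_self, mulVec_eq _ _ _ j,
      Matrix.add_apply, Matrix.smul_apply, smul_eq_mul, VolterraCoeff.A, VolterraCoeff.B, hc,
      jostCoeff]
    ring
  have hss : (s.sgn : ℂ) * s.sgn = 1 := by exact_mod_cast s.sgn_mul_sgn
  have e2 : ∀ y, F y (1 - j) = Complex.exp (phase (phaseConst s j) l *
      ((s.sgn * x - y : ℝ) : ℂ)) * (c.C l y * Ψ (s.sgn * y) j +
        c.D l y * Ψ (s.sgn * y) (1 - j)) := fun y => by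
    -- Since `sgn² = 1`, one has `x - sgn y = sgn (sgn x - y)`; the extra sign is absorbed into
    -- `phaseConst`.
    have e3 : 2 * (colSgn j : ℂ) * (Complex.I / 4 * (l - l⁻¹) * ((x - s.sgn * y : ℝ) : ℂ)) =
        phase (phaseConst s j) l * ((s.sgn * x - y : ℝ) : ℂ) := by
      simp only [phase, phaseConst, halfPlaneSign_eq]
      push_cast
      linear_combination (-(colSgn j : ℂ) * Complex.I / 2 * (l - l⁻¹) * x) * hss
    simp only [hF, Pi.smul_apply, Complex.real_smul, expSigmaHatCol_other, mulVec_eq _ _ _ j, e3,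
      Matrix.add_apply, Matrix.smul_apply, smul_eq_mul, VolterraCoeff.C, VolterraCoeff.D, hc,
      jostCoeff]
    ring
  have iF : ∀ i, Integrable (fun y => F y i) (volume.restrict (Set.Iic (s.sgn * x))) := fun i => by
    rcases eq_or_eq_one_sub i j with rfl | rfl
    · simp only [e1]; exact iA.integrableOn
    · simp only [e2]; exact integrableOn_oscInt (re_phase_nonpos hl) iC _
  have hV : ∀ i, volterraRHS u v vx s j l Ψ x i =
      stdVec j i + ∫ y in Set.Iic (s.sgn * x), F y i := fun i => by
    rw [volterraRHS, Pi.add_apply, intFrom_eq, ← eval_integral iF i]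
  refine ⟨?_, ?_⟩
  · rw [hV]; simp only [e1]; simp [stdVec]
  · rw [hV]; simp only [e2]; simp [stdVec, one_sub_ne, oscInt]

theorem lim_jostCoeff (s : LineEnd) (j : Fin 2) (x : ℝ) :
    (jostCoeff h₁ h₂ s j).lim (s.sgn * x) = PhiInf u v s j x := by
  rw [VolterraCoeff.lim, PhiInf, intFrom_eq, ← integral_complex_ofReal, ← integral_const_mul]
  congr 1
  congr 1
  ext y
  fin_cases j <;> simp [jostCoeff, Q1] <;> ring

/-- A column assembled from its diagonal and off-diagonal components. -/
noncomputable def column (s : LineEnd) (j : Fin 2) (a b : ℝ → ℂ) (x : ℝ) : Fin 2 → ℂ :=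
  fun i => if i = j then a (s.sgn * x) else b (s.sgn * x)

theorem column_self (s : LineEnd) (j : Fin 2) (a b : ℝ → ℂ) (x : ℝ) :
    column s j a b x j = a (s.sgn * x) := by simp [column]

theorem column_other (s : LineEnd) (j : Fin 2) (a b : ℝ → ℂ) (x : ℝ) :
    column s j a b x (1 - j) = b (s.sgn * x) := by simp [column, one_sub_ne]

variable {h₁ h₂}

theorem VolterraCoeff.IsSol.memLp_column {c : VolterraCoeff} {κ l : ℂ} {a b : ℝ → ℂ}
    (h : c.IsSol κ l a b) (s : LineEnd) (j : Fin 2) : MemLp (column s j a b) ∞ volume := by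
  obtain ⟨K, hK⟩ := h.bdd
  have hs : Continuous fun x : ℝ => s.sgn * x := continuous_const.mul continuous_id
  refine memLp_top_of_bound (C := K) (Continuous.aestronglyMeasurable ?_)
    (Eventually.of_forall fun x => ?_)
  · refine continuous_pi fun i => ?_
    by_cases hi : i = j
    · simpa [column, hi, Function.comp_def] using h.continuous_a.comp hs
    · simpa [column, hi, Function.comp_def] using h.continuous_b.comp hs
  · refine (pi_norm_le_iff_of_nonneg ((norm_nonneg _).trans (hK 0).1)).2 fun i => ?_
    by_cases hi : i = j
    · simpa [column, hi] using (hK _).1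
    · simpa [column, hi] using (hK _).2

theorem column_eq_volterraRHS {s : LineEnd} {j : Fin 2} {l : ℂ} (hl : l ∈ closedDomain s j)
    {a b : ℝ → ℂ} (h : (jostCoeff h₁ h₂ s j).IsSol (phaseConst s j) l a b) (x : ℝ) :
    column s j a b x = volterraRHS u v vx s j l (column s j a b) x := by
  obtain ⟨e1, e2⟩ := volterraRHS_apply h₁ h₂ s j hl (h.memLp_column s j) x
  simp only [column_self, column_other, s.sgn_mul_sgn_mul] at e1 e2
  ext i
  rcases eq_or_eq_one_sub i j with rfl | rfl
  · rw [e1, column_self, h.eq_a]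
  · rw [e2, column_other, h.eq_b]

theorem ae_eq_column {s : LineEnd} {j : Fin 2} {l : ℂ} (hl : l ∈ closedDomain s j)
    {a b : ℝ → ℂ} (h : (jostCoeff h₁ h₂ s j).IsSol (phaseConst s j) l a b)
    {Ψ : ℝ → Fin 2 → ℂ} (hΨ : MemLp Ψ ∞ volume)
    (heq : ∀ᵐ x, Ψ x = volterraRHS u v vx s j l Ψ x) : Ψ =ᵐ[volume] column s j a b := by
  obtain ⟨K, -, hK⟩ := exists_ae_norm_le hΨ
  have hm : ∀ i, AEStronglyMeasurable (fun y => Ψ (s.sgn * y) i) volume := fun i =>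
    (continuous_apply i).comp_aestronglyMeasurable (s.memLp_comp hΨ).1
  have key := h.ae_eq hl.1 (re_phase_nonpos hl) (hm j) (hm (1 - j)) (K := K) (by
    filter_upwards [s.ae_comp hK] with y hy
    exact ⟨(norm_le_pi_norm _ _).trans hy, (norm_le_pi_norm _ _).trans hy⟩) (by
    filter_upwards [s.ae_comp heq] with x hx
    have := (volterraRHS_apply h₁ h₂ s j hl hΨ (s.sgn * x)).1
    rw [s.sgn_mul_sgn_mul] at this
    rw [← this, ← hx]) (by
    filter_upwards [s.ae_comp heq] with x hx
    have := (volterraRHS_apply h₁ h₂ s j hl hΨ (s.sgn * x)).2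
    rw [s.sgn_mul_sgn_mul] at this
    rw [← this, ← hx])
  filter_upwards [s.ae_comp key] with x hx
  rw [s.sgn_mul_sgn_mul] at hx
  ext i
  rcases eq_or_eq_one_sub i j with rfl | rfl
  · rw [column_self, hx.1]
  · rw [column_other, hx.2]

/-- Integration by parts shows that the classical derivative is also a weak one, and testing against
smooth functions determines a locally integrable function. This gives `v_x` a meaning at each point.
-/
theorem IsWeakDeriv.ae_eq_deriv (hw : IsWeakDeriv v vx)
    (hvx : LocallyIntegrable vx) (hv1 : ContDiff ℝ 1 v) : vx =ᵐ[volume] deriv v := by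
  have hd : Continuous (deriv v) := hv1.continuous_deriv le_rfl
  refine ae_eq_of_integral_contDiff_smul_eq hvx hd.locallyIntegrable fun g hg hgs => ?_
  have h1 := hw g hg hgs
  have hg1 : ContDiff ℝ 1 g := hg.of_le (by exact_mod_cast le_top)
  have hgc : Continuous fun x => ((g x : ℝ) : ℂ) := Complex.continuous_ofReal.comp hg.continuous
  have hgdc : Continuous fun x => ((deriv g x : ℝ) : ℂ) :=
    Complex.continuous_ofReal.comp (hg1.continuous_deriv le_rfl)
  have hs : HasCompactSupport fun x => ((g x : ℝ) : ℂ) := hgs.comp_left Complex.ofReal_zero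
  have hs' : HasCompactSupport fun x => ((deriv g x : ℝ) : ℂ) :=
    hgs.deriv.comp_left Complex.ofReal_zero
  have h2 := integral_mul_deriv_eq_deriv_mul_of_integrable
    (u := fun x => ((g x : ℝ) : ℂ)) (v := v) (u' := fun x => ((deriv g x : ℝ) : ℂ))
    (v' := deriv v)
    (fun x _ => ((hg1.differentiable (by simp) x).hasDerivAt).ofReal_comp)
    (fun x _ => (hv1.differentiable (by simp) x).hasDerivAt)
    ((hgc.mul hd).integrable_of_hasCompactSupport hs.mul_right)
    ((hgdc.mul hv1.continuous).integrable_of_hasCompactSupport hs'.mul_right)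
    ((hgc.mul hv1.continuous).integrable_of_hasCompactSupport hs.mul_right)
  simp only [Complex.real_smul]
  rw [h2, h1, neg_neg]

end MTM

/-! ### The coefficients of the columns: derivatives, bounds and the correction integral. -/

namespace MTM

variable {u v w : ℝ → ℂ}

theorem inv_phaseConst (s : LineEnd) (j : Fin 2) :
    (phaseConst s j)⁻¹ = s.sgn * colSgn j * (-2 * Complex.I) := by
  refine inv_eq_of_mul_eq_one_right ?_
  have h : (halfPlaneSign s j : ℂ) * halfPlaneSign s j = 1 := by
    exact_mod_cast halfPlaneSign_mul_self s j
  rw [halfPlaneSign_eq] at h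
  simp only [phaseConst, halfPlaneSign_eq]
  push_cast at h ⊢
  linear_combination h - s.sgn * colSgn j * (s.sgn * colSgn j) * Complex.I_mul_I

/-- The only off-diagonal entry of `Q₁` free of `u`. It is `B₁` for column `0` and `C₁` for column
`1`, which decides where integration by parts is possible. -/
theorem hasDerivAt_Q1_offdiag (hv : ContDiff ℝ 1 v) (s : LineEnd) (x : ℝ) :
    HasDerivAt (fun y => (s.sgn : ℂ) * Q1 u v w (s.sgn * y) 0 1)
      (-(Complex.I / 2) * conj (deriv v (s.sgn * x))) x := by
  have h1 : HasDerivAt (fun y => v (s.sgn * y)) (s.sgn • deriv v (s.sgn * x)) x := by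
    have h0 : HasDerivAt (fun y : ℝ => s.sgn * y) s.sgn x := by
      simpa using (hasDerivAt_id x).const_mul s.sgn
    exact HasDerivAt.scomp x (hv.differentiable (by simp) (s.sgn * x)).hasDerivAt h0
  have h2 := (h1.star.const_mul (-(Complex.I / 2))).const_mul (s.sgn : ℂ)
  have hss : (s.sgn : ℂ) * s.sgn = 1 := by exact_mod_cast s.sgn_mul_sgn
  convert! h2 using 1
  simp only [Complex.real_smul, star_mul', RCLike.star_def, Complex.conj_ofReal]
  linear_combination (Complex.I / 2 * conj (deriv v (s.sgn * x))) * hss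

theorem integrable_deriv_Q1_offdiag (hv : Integrable (deriv v)) (s : LineEnd) :
    Integrable fun y => -(Complex.I / 2) * conj (deriv v (s.sgn * y)) :=
  (Complex.conjLIE.toContinuousLinearEquiv.integrable_comp_iff.2
    (s.integrable_comp hv)).const_mul _

theorem norm_Q1_le {K : ℝ} {y : ℝ} (hu : ‖u y‖ ≤ K) (hv : ‖v y‖ ≤ K) (hw : ‖w y‖ ≤ K)
    (i k : Fin 2) : ‖Q1 u v w y i k‖ ≤ 2 * K + K ^ 2 + K ^ 3 := by
  have hK : 0 ≤ K := (norm_nonneg _).trans hu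
  have hu2 : ‖u y‖ ^ 2 ≤ K ^ 2 := by gcongr
  have hv2 : ‖v y‖ ^ 2 ≤ K ^ 2 := by gcongr
  have hK2 : 0 ≤ K ^ 2 := by positivity
  have hK3 : 0 ≤ K ^ 3 := by positivity
  have hd : ‖Complex.I / 4 * ((‖u y‖ ^ 2 + ‖v y‖ ^ 2 : ℝ) : ℂ)‖ ≤ 2 * K + K ^ 2 + K ^ 3 := by
    rw [norm_mul, Complex.norm_real, Real.norm_of_nonneg (by positivity)]
    simp only [norm_div, Complex.norm_I, Complex.norm_ofNat]
    linarith
  fin_cases i <;> fin_cases k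
  · exact hd
  · have : ‖-(Complex.I / 2) * conj (v y)‖ ≤ 2 * K + K ^ 2 + K ^ 3 := by
      simp only [norm_mul, norm_neg, norm_div, Complex.norm_I, Complex.norm_ofNat,
        RCLike.norm_conj]
      linarith
    exact this
  · have : ‖w y + Complex.I / 2 * ((‖u y‖ ^ 2 : ℝ) : ℂ) * v y + Complex.I / 2 * u y‖ ≤
        2 * K + K ^ 2 + K ^ 3 := by
      refine norm_add₃_le.trans ?_
      rw [norm_mul, norm_mul, norm_mul, Complex.norm_real, Real.norm_of_nonneg (by positivity)]
      simp only [norm_div, Complex.norm_I, Complex.norm_ofNat]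
      have := mul_le_mul hu2 hv (norm_nonneg _) hK2
      nlinarith
    exact this
  · have : ‖-(Complex.I / 4) * ((‖u y‖ ^ 2 + ‖v y‖ ^ 2 : ℝ) : ℂ)‖ ≤ 2 * K + K ^ 2 + K ^ 3 := by
      rw [neg_mul, norm_neg]; exact hd
    exact this

theorem norm_Q2_le {K : ℝ} {y : ℝ} (hu : ‖u y‖ ≤ K) (hv : ‖v y‖ ≤ K) (i k : Fin 2) :
    ‖Q2 u v y i k‖ ≤ 2 * K + K ^ 2 + K ^ 3 := by
  have hK : 0 ≤ K := (norm_nonneg _).trans hu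
  have hv2 : ‖v y‖ ^ 2 ≤ K ^ 2 := by gcongr
  have huv : ‖u y‖ * ‖v y‖ ≤ K * K := mul_le_mul hu hv (norm_nonneg _) hK
  have huv2 : ‖u y‖ * ‖v y‖ ^ 2 ≤ K * K ^ 2 := mul_le_mul hu hv2 (by positivity) hK
  have hK2 : 0 ≤ K ^ 2 := by positivity
  have hK3 : 0 ≤ K ^ 3 := by positivity
  have hs : ∀ z : ℂ, ‖z‖ ≤ 2 * K + K ^ 2 + K ^ 3 →
      ‖-(Complex.I / 2) • z‖ ≤ 2 * K + K ^ 2 + K ^ 3 := fun z hz => by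
    simp only [norm_smul, norm_neg, norm_div, Complex.norm_I, Complex.norm_ofNat]
    linarith [norm_nonneg z]
  have h1 : ‖conj (u y) * v y‖ ≤ 2 * K + K ^ 2 + K ^ 3 := by
    rw [norm_mul, RCLike.norm_conj]; nlinarith
  fin_cases i <;> fin_cases k <;> refine hs _ ?_
  · exact h1
  · exact (by rw [norm_neg, RCLike.norm_conj]; linarith :
      ‖-conj (u y)‖ ≤ 2 * K + K ^ 2 + K ^ 3)
  · have : ‖v y + conj (u y) * v y ^ 2‖ ≤ 2 * K + K ^ 2 + K ^ 3 := by
      refine (norm_add_le _ _).trans ?_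
      rw [norm_mul, norm_pow, RCLike.norm_conj]
      nlinarith
    exact this
  · exact (by rw [norm_neg]; exact h1 : ‖-(conj (u y) * v y)‖ ≤ 2 * K + K ^ 2 + K ^ 3)

/-- The product `B₁ C₁` is the same for both columns, while `κ⁻¹` and the diagonal of `Q₂` change
sign with `j`; so one integral serves both, up to `colSgn j`. -/
theorem corr_jostCoeff {h₁ : ∀ i k, Integrable fun y => Q1 u v (deriv v) y i k}
    {h₂ : ∀ i k, Integrable fun y => Q2 u v y i k} (s : LineEnd) (j : Fin 2) (x : ℝ) :
    (jostCoeff h₁ h₂ s j).corr (phaseConst s j) (s.sgn * x) = colSgn j * corrInt u v s x := by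
  have hss : (s.sgn : ℂ) * s.sgn = 1 := by exact_mod_cast s.sgn_mul_sgn
  rw [VolterraCoeff.corr, corrInt, intFrom_eq, inv_phaseConst, ← integral_const_mul]
  congr 1
  ext y
  simp only [Complex.real_smul]
  set S : ℂ := ((s.sgn : ℝ) : ℂ)
  set q := deriv v (s.sgn * y) + Complex.I / 2 * ((‖u (s.sgn * y)‖ ^ 2 : ℝ) : ℂ) * v (s.sgn * y) +
    Complex.I / 2 * u (s.sgn * y) with hq
  fin_cases j
  · change S * (-(Complex.I / 2) * (conj (u (s.sgn * y)) * v (s.sgn * y))) -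
      S * ((if (0 : Fin 2) = 0 then -1 else 1 : ℝ) : ℂ) * (-2 * Complex.I) *
        ((S * (-(Complex.I / 2) * conj (v (s.sgn * y)))) * (S * q)) =
      ((if (0 : Fin 2) = 0 then -1 else 1 : ℝ) : ℂ) * (S * _)
    rw [if_pos rfl]
    push_cast
    linear_combination (S * S * S * conj (v (s.sgn * y)) * q) * Complex.I_mul_I -
      S * conj (v (s.sgn * y)) * q * hss
  · change S * (-(Complex.I / 2) * -(conj (u (s.sgn * y)) * v (s.sgn * y))) -
      S * ((if (1 : Fin 2) = 0 then -1 else 1 : ℝ) : ℂ) * (-2 * Complex.I) *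
        ((S * q) * (S * (-(Complex.I / 2) * conj (v (s.sgn * y))))) =
      ((if (1 : Fin 2) = 0 then -1 else 1 : ℝ) : ℂ) * (S * _)
    rw [if_neg (by decide)]
    push_cast
    linear_combination -(S * S * S * conj (v (s.sgn * y)) * q) * Complex.I_mul_I +
      S * conj (v (s.sgn * y)) * q * hss

end MTM

/-! ### Limits of the columns at infinity. -/

namespace MTM

variable {u v vx : ℝ → ℂ}

/-- `v` and `v_x` are continuous, and `u` is essentially bounded, so the oscillation of `|u|² v + u`
at `x` is controlled almost everywhere by those of `u` and `v`. -/
theorem IsLebesguePoint.sgn_mul_Q1_offdiag (s : LineEnd) {x : ℝ} (hx : IsLebesguePoint u x)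
    (hu1 : MemLp u 1 volume) (huinf : MemLp u ∞ volume) (hvinf : MemLp v ∞ volume)
    (hv : ContDiff ℝ 1 v) (hd : Integrable (deriv v))
    (hQ : Integrable fun y => Q1 u v (deriv v) y 1 0) :
    IsLebesguePoint (fun y => (s.sgn : ℂ) * Q1 u v (deriv v) y 1 0) x := by
  obtain ⟨Ku, hKu0, hKu⟩ := exists_ae_norm_le huinf
  obtain ⟨Kv, hKv0, hKv⟩ := exists_ae_norm_le hvinf
  have hdc : Continuous (deriv v) := hv.continuous_deriv le_rfl
  set g : ℝ → ℂ := fun y =>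
    Complex.I / 2 * ((‖u y‖ ^ 2 : ℝ) : ℂ) * v y + Complex.I / 2 * u y with hg
  have hQg : ∀ y, Q1 u v (deriv v) y 1 0 = deriv v y + g y := fun y => by
    simp only [hg, ← add_assoc]; rfl
  have hgi : Integrable g := by
    refine (hQ.sub hd).congr (Eventually.of_forall fun y => ?_)
    simp only [Pi.sub_apply, hQg]; ring
  have hgx : IsLebesguePoint g x := by
    refine hx.of_norm_sub_le (isLebesguePoint_of_continuous hv.continuous x)
      (memLp_one_iff_integrable.1 hu1).locallyIntegrable hv.continuous.locallyIntegrable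
      -- From `||u y|² - |u x|²| ≤ (Ku + |u x|) |u y - u x|` and `|v y| ≤ Kv`, plus `1` for the
      -- linear term in `u`; the factor `1/2` of the entry is not exploited.
      (K := (Ku + ‖u x‖) * Kv + 1) (L := ‖u x‖ ^ 2) (by positivity) (by positivity) ?_
    filter_upwards [hKu, hKv] with y hy hy'
    have e : g y - g x = Complex.I / 2 * ((((‖u y‖ ^ 2 - ‖u x‖ ^ 2 : ℝ) : ℂ) * v y +
        ((‖u x‖ ^ 2 : ℝ) : ℂ) * (v y - v x)) + (u y - u x)) := by
      simp only [hg]; push_cast; ring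
    have h1 : |‖u y‖ ^ 2 - ‖u x‖ ^ 2| ≤ (Ku + ‖u x‖) * ‖u y - u x‖ := by
      rw [sq_sub_sq, abs_mul, abs_of_nonneg (by positivity)]
      exact mul_le_mul (by linarith) (abs_norm_sub_norm_le _ _) (abs_nonneg _) (by positivity)
    have h2 : ‖((‖u y‖ ^ 2 - ‖u x‖ ^ 2 : ℝ) : ℂ) * v y‖ ≤ (Ku + ‖u x‖) * ‖u y - u x‖ * Kv := by
      rw [norm_mul, Complex.norm_real, Real.norm_eq_abs]
      exact mul_le_mul h1 hy' (norm_nonneg _) (by positivity)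
    have h3 : ‖((‖u x‖ ^ 2 : ℝ) : ℂ) * (v y - v x)‖ = ‖u x‖ ^ 2 * ‖v y - v x‖ := by
      rw [norm_mul, Complex.norm_real, Real.norm_of_nonneg (by positivity)]
    rw [e, norm_mul, norm_div, Complex.norm_I, Complex.norm_two]
    have h4 := norm_add_le (((‖u y‖ ^ 2 - ‖u x‖ ^ 2 : ℝ) : ℂ) * v y +
      ((‖u x‖ ^ 2 : ℝ) : ℂ) * (v y - v x)) (u y - u x)
    have h5 := norm_add_le (((‖u y‖ ^ 2 - ‖u x‖ ^ 2 : ℝ) : ℂ) * v y)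
      (((‖u x‖ ^ 2 : ℝ) : ℂ) * (v y - v x))
    have h6 := norm_nonneg ((((‖u y‖ ^ 2 - ‖u x‖ ^ 2 : ℝ) : ℂ) * v y +
        ((‖u x‖ ^ 2 : ℝ) : ℂ) * (v y - v x)) + (u y - u x))
    linarith
  refine hgx.of_norm_sub_le (isLebesguePoint_of_continuous hdc x) hgi.locallyIntegrable
    hdc.locallyIntegrable zero_le_one zero_le_one (Eventually.of_forall fun y => ?_)
  have e : (s.sgn : ℂ) * Q1 u v (deriv v) y 1 0 - s.sgn * Q1 u v (deriv v) x 1 0 =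
      s.sgn * ((g y - g x) + (deriv v y - deriv v x)) := by
    rw [hQg, hQg]; ring
  have hs : ‖(s.sgn : ℂ)‖ = 1 := by cases s <;> simp [LineEnd.sgn]
  rw [e, norm_mul, hs, one_mul, one_mul, one_mul]
  exact norm_add_le _ _

/-- The derivative of `v` is continuous and need not be bounded on the line, so the bound is local,
by compactness of the unit ball around `x`. -/
theorem exists_ae_bound_jostCoeff {h₁ : ∀ i k, Integrable fun y => Q1 u v (deriv v) y i k}
    {h₂ : ∀ i k, Integrable fun y => Q2 u v y i k} (huinf : MemLp u ∞ volume)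
    (hvinf : MemLp v ∞ volume) (hv : ContDiff ℝ 1 v) (s : LineEnd) (j : Fin 2) (x : ℝ) :
    ∃ K : ℝ, ∀ᵐ y, |y - s.sgn * x| ≤ 1 →
      ‖(jostCoeff h₁ h₂ s j).C₁ y‖ + ‖(jostCoeff h₁ h₂ s j).C₂ y‖ +
        (‖(jostCoeff h₁ h₂ s j).D₁ y‖ + ‖(jostCoeff h₁ h₂ s j).D₂ y‖) ≤ K := by
  obtain ⟨Ku, -, hKu⟩ := exists_ae_norm_le huinf
  obtain ⟨Kv, -, hKv⟩ := exists_ae_norm_le hvinf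
  obtain ⟨Kw, hKw⟩ := (isCompact_closedBall x 1).exists_bound_of_continuousOn
    (hv.continuous_deriv le_rfl).continuousOn
  have hs : |s.sgn| = 1 := by cases s <;> simp [LineEnd.sgn]
  set K := max (max Ku Kv) Kw with hK
  refine ⟨4 * (2 * K + K ^ 2 + K ^ 3), ?_⟩
  filter_upwards [s.ae_comp hKu, s.ae_comp hKv] with y hu' hv' hy
  have hb : s.sgn * y ∈ Metric.closedBall x 1 := by
    rw [Metric.mem_closedBall, Real.dist_eq]
    have e : s.sgn * y - x = s.sgn * (y - s.sgn * x) := by rw [mul_sub, s.sgn_mul_sgn_mul]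
    rwa [e, abs_mul, hs, one_mul]
  have k1 : ‖u (s.sgn * y)‖ ≤ K := hu'.trans ((le_max_left _ _).trans (le_max_left _ _))
  have k2 : ‖v (s.sgn * y)‖ ≤ K := hv'.trans ((le_max_right _ _).trans (le_max_left _ _))
  have k3 : ‖deriv v (s.sgn * y)‖ ≤ K := (hKw _ hb).trans (le_max_right _ _)
  have n1 := fun i k => norm_Q1_le (w := deriv v) k1 k2 k3 i k
  have n2 := fun i k => norm_Q2_le k1 k2 i k
  simp only [jostCoeff, norm_mul, Complex.norm_real, Real.norm_eq_abs, hs, one_mul]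
  linarith [n1 (1 - j) j, n2 (1 - j) j, n1 (1 - j) (1 - j), n2 (1 - j) (1 - j)]

theorem VolterraCoeff.IsSol.congr_jostCoeff {vx' : ℝ → ℂ}
    {h₁ : ∀ i k, Integrable fun y => Q1 u v vx y i k}
    {h₁' : ∀ i k, Integrable fun y => Q1 u v vx' y i k}
    {h₂ : ∀ i k, Integrable fun y => Q2 u v y i k} {s : LineEnd} {j : Fin 2} {κ l : ℂ}
    {a b : ℝ → ℂ} (h : (jostCoeff h₁ h₂ s j).IsSol κ l a b) (hvx : vx =ᵐ[volume] vx') :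
    (jostCoeff h₁' h₂ s j).IsSol κ l a b := by
  have hQ : ∀ᵐ y, Q1 u v vx (s.sgn * y) = Q1 u v vx' (s.sgn * y) := by
    filter_upwards [s.ae_comp hvx] with y hy
    simp only [Q1, hy]
  refine h.congr_ae ?_ ?_ ?_ ?_ <;> filter_upwards [hQ] with y hy
  · simp only [VolterraCoeff.A, jostCoeff, hy]
  · simp only [VolterraCoeff.B, jostCoeff, hy]
  · simp only [VolterraCoeff.C, jostCoeff, hy]
  · simp only [VolterraCoeff.D, jostCoeff, hy]

theorem tendsto_atInfinity_of_norm_sub_le {s : LineEnd} {j : Fin 2} {f : ℂ → ℂ} {p : ℂ} {δ : ℂ → ℝ}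
    (hδ : Tendsto δ (Bornology.cobounded ℂ) (𝓝 0)) (h : ∀ l ∈ openDomain s j, ‖f l - p‖ ≤ δ l) :
    Tendsto f (atInfinity s j) (𝓝 p) := by
  rw [tendsto_iff_norm_sub_tendsto_zero]
  refine squeeze_zero' (Eventually.of_forall fun _ => norm_nonneg _) ?_ (hδ.mono_left inf_le_left)
  filter_upwards [mem_inf_of_right (mem_principal_self (openDomain s j))] with l hl using h l hl

theorem PhiInf_ne_zero (u v : ℝ → ℂ) (s : LineEnd) (j : Fin 2) (x : ℝ) : PhiInf u v s j x ≠ 0 :=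
  Complex.exp_ne_zero _

section Limits

variable {h₁ : ∀ i k, Integrable fun y => Q1 u v vx y i k}
  {h₂ : ∀ i k, Integrable fun y => Q2 u v y i k} {s : LineEnd} {j : Fin 2} {a b : ℂ → ℝ → ℂ}

theorem tendsto_column
    (h : ∀ l ∈ openDomain s j, (jostCoeff h₁ h₂ s j).IsSol (phaseConst s j) l (a l) (b l))
    (x : ℝ) : Tendsto (fun l => (PhiInf u v s j x)⁻¹ • column s j (a l) (b l) x)
      (atInfinity s j) (𝓝 (stdVec j)) := by
  obtain ⟨δ, hδ, hb⟩ := (jostCoeff h₁ h₂ s j).exists_leading_bound (phaseConst_ne_zero s j)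
  have ha' : Tendsto (fun l => a l (s.sgn * x)) (atInfinity s j) (𝓝 (PhiInf u v s j x)) :=
    tendsto_atInfinity_of_norm_sub_le hδ fun l hl => by
      rw [← lim_jostCoeff h₁ h₂]
      exact (hb l _ _ hl.1 (re_phase_neg hl) (h l hl) _).1
  have hb' : Tendsto (fun l => b l (s.sgn * x)) (atInfinity s j) (𝓝 0) :=
    tendsto_atInfinity_of_norm_sub_le hδ fun l hl => by
      rw [sub_zero]
      exact (hb l _ _ hl.1 (re_phase_neg hl) (h l hl) _).2
  refine tendsto_pi_nhds.2 fun i => ?_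
  rcases eq_or_eq_one_sub i j with rfl | rfl
  · simpa [column_self, stdVec, PhiInf_ne_zero] using ha'.const_mul (PhiInf u v s i x)⁻¹
  · simpa [column_other, stdVec, one_sub_ne] using hb'.const_mul (PhiInf u v s j x)⁻¹

end Limits

section Corrections

variable {h₁ : ∀ i k, Integrable fun y => Q1 u v (deriv v) y i k}
  {h₂ : ∀ i k, Integrable fun y => Q2 u v y i k} {s : LineEnd} {a b : ℂ → ℝ → ℂ}

theorem tendsto_mul_inv_PhiInf_mul_sub_one {j : Fin 2} {x : ℝ} {δ : ℂ → ℝ}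
    (hδ : Tendsto δ (Bornology.cobounded ℂ) (𝓝 0))
    (hb : ∀ l ∈ openDomain s j,
      ‖l * (a l (s.sgn * x) - (jostCoeff h₁ h₂ s j).lim (s.sgn * x)) -
        (jostCoeff h₁ h₂ s j).lim (s.sgn * x) *
          (jostCoeff h₁ h₂ s j).corr (phaseConst s j) (s.sgn * x)‖ ≤ δ l) :
    Tendsto (fun l => l * ((PhiInf u v s j x)⁻¹ * a l (s.sgn * x) - 1)) (atInfinity s j)
      (𝓝 (colSgn j * corrInt u v s x)) := by
  simp only [lim_jostCoeff, corr_jostCoeff] at hb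
  have h0 := PhiInf_ne_zero u v s j x
  have := (tendsto_atInfinity_of_norm_sub_le hδ hb).const_mul (PhiInf u v s j x)⁻¹
  rw [inv_mul_cancel_left₀ h0] at this
  refine this.congr fun l => ?_
  field_simp

/-- Here `C₁` contains `u` and has no derivative, so the version with a differentiable `B₁` is used;
it gives the limit at every `x`. -/
theorem tendsto_mul_column_zero_diag
    (h : ∀ l ∈ openDomain s 0, (jostCoeff h₁ h₂ s 0).IsSol (phaseConst s 0) l (a l) (b l))
    (hv : ContDiff ℝ 1 v) (hd : Integrable (deriv v)) (x : ℝ) :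
    Tendsto (fun l => l * ((PhiInf u v s 0 x)⁻¹ * column s 0 (a l) (b l) x 0 - 1))
      (atInfinity s 0) (𝓝 (-corrInt u v s x)) := by
  obtain ⟨δ, hδ, hb⟩ := (jostCoeff h₁ h₂ s 0).exists_first_order_bound_of_hasDerivAt_B
    (phaseConst_ne_zero s 0) (integrable_deriv_Q1_offdiag hd s) (hasDerivAt_Q1_offdiag hv s)
  have := tendsto_mul_inv_PhiInf_mul_sub_one hδ fun l hl =>
    hb l _ _ hl.1 (re_phase_neg hl) (h l hl) (s.sgn * x)
  simpa [colSgn, column] using this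

theorem tendsto_mul_column_zero_offdiag
    (h : ∀ l ∈ openDomain s 0, (jostCoeff h₁ h₂ s 0).IsSol (phaseConst s 0) l (a l) (b l))
    (hu1 : MemLp u 1 volume) (huinf : MemLp u ∞ volume) (hvinf : MemLp v ∞ volume)
    (hv : ContDiff ℝ 1 v) (hd : Integrable (deriv v)) {x : ℝ} (hx : IsLebesguePoint u x)
    {ε : ℝ} (hε : 0 < ε) :
    Tendsto (fun l => l * ((PhiInf u v s 0 x)⁻¹ * column s 0 (a l) (b l) x 1))
      (atInfinitySector s 0 ε)
      (𝓝 (-2 * Complex.I * deriv v x + ((‖u x‖ ^ 2 : ℝ) : ℂ) * v x + u x)) := by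
  obtain ⟨K, hK⟩ := exists_ae_bound_jostCoeff (h₁ := h₁) (h₂ := h₂) huinf hvinf hv s 0 x
  have hmem : ∀ᶠ l in atInfinitySector s 0 ε, l ∈ openDomain s 0 ∧ ε * ‖l‖ ≤ |l.im| :=
    mem_inf_of_right (mem_principal_self _)
  have hC : IsLebesguePoint (jostCoeff h₁ h₂ s 0).C₁ (s.sgn * x) :=
    (hx.sgn_mul_Q1_offdiag s hu1 huinf hvinf hv hd (h₁ 1 0)).comp_sgn s
  have key := ((jostCoeff h₁ h₂ s 0).tendsto_mul_offdiag (phaseConst_ne_zero s 0)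
    (inf_le_left : atInfinitySector s 0 ε ≤ _) (half_pos hε)
    (hmem.mono fun l hl => re_phase_le_of_sector hε hl.1 hl.2) hC one_pos hK
    (hmem.mono fun l hl => h l hl.1)).const_mul (PhiInf u v s 0 x)⁻¹
  have hss : (s.sgn : ℂ) * s.sgn = 1 := by exact_mod_cast s.sgn_mul_sgn
  have hC₁ : (phaseConst s 0)⁻¹ * (jostCoeff h₁ h₂ s 0).C₁ (s.sgn * x) =
      2 * Complex.I * (deriv v x + Complex.I / 2 * ((‖u x‖ ^ 2 : ℝ) : ℂ) * v x +
        Complex.I / 2 * u x) := by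
    change (phaseConst s 0)⁻¹ * (s.sgn * Q1 u v (deriv v) (s.sgn * (s.sgn * x)) 1 0) =
      2 * Complex.I * Q1 u v (deriv v) x 1 0
    rw [inv_phaseConst, s.sgn_mul_sgn_mul, colSgn, if_pos rfl]
    push_cast
    linear_combination (2 * Complex.I * Q1 u v (deriv v) x 1 0) * hss
  have hl : (PhiInf u v s 0 x)⁻¹ * -((phaseConst s 0)⁻¹ * (jostCoeff h₁ h₂ s 0).C₁ (s.sgn * x) *
      (jostCoeff h₁ h₂ s 0).lim (s.sgn * x)) =
      -2 * Complex.I * deriv v x + ((‖u x‖ ^ 2 : ℝ) : ℂ) * v x + u x := by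
    rw [hC₁, lim_jostCoeff, ← neg_mul, mul_comm (-_), inv_mul_cancel_left₀ (PhiInf_ne_zero u v _ _ x)]
    linear_combination -(((‖u x‖ ^ 2 : ℝ) : ℂ) * v x + u x) * Complex.I_mul_I
  rw [hl] at key
  refine key.congr fun l => ?_
  simp only [column]
  rw [if_neg (by decide)]
  ring

/-- Here `C₁` is a multiple of `v̄`, so both components converge at every `x` and without a sector.
-/
theorem tendsto_smul_column_one
    (h : ∀ l ∈ openDomain s 1, (jostCoeff h₁ h₂ s 1).IsSol (phaseConst s 1) l (a l) (b l))
    (hv : ContDiff ℝ 1 v) (hd : Integrable (deriv v)) (x : ℝ) :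
    Tendsto (fun l => l • ((PhiInf u v s 1 x)⁻¹ • column s 1 (a l) (b l) x - stdVec 1))
      (atInfinity s 1) (𝓝 ![conj (v x), corrInt u v s x]) := by
  obtain ⟨δ, hδ, hb⟩ := (jostCoeff h₁ h₂ s 1).exists_first_order_bound_of_hasDerivAt_C
    (phaseConst_ne_zero s 1) (integrable_deriv_Q1_offdiag hd s) (hasDerivAt_Q1_offdiag hv s)
  have hdiag := tendsto_mul_inv_PhiInf_mul_sub_one hδ fun l hl =>
    (hb l _ _ hl.1 (re_phase_neg hl) (h l hl) (s.sgn * x)).1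
  have hss : (s.sgn : ℂ) * s.sgn = 1 := by exact_mod_cast s.sgn_mul_sgn
  have hC₁ : (phaseConst s 1)⁻¹ * (jostCoeff h₁ h₂ s 1).C₁ (s.sgn * x) = -conj (v x) := by
    change (phaseConst s 1)⁻¹ *
      (s.sgn * (-(Complex.I / 2) * conj (v (s.sgn * (s.sgn * x))))) = _
    rw [inv_phaseConst, s.sgn_mul_sgn_mul, colSgn, if_neg (by decide)]
    push_cast
    linear_combination (s.sgn * s.sgn * conj (v x)) * Complex.I_mul_I - conj (v x) * hss
  have hoff : Tendsto (fun l => l * b l (s.sgn * x)) (atInfinity s 1)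
      (𝓝 (PhiInf u v s 1 x * conj (v x))) :=
    tendsto_atInfinity_of_norm_sub_le hδ fun l hl => by
      refine le_of_eq_of_le ?_ (hb l _ _ hl.1 (re_phase_neg hl) (h l hl) (s.sgn * x)).2
      rw [hC₁, lim_jostCoeff]
      congr 1
      ring
  have hoff' := hoff.const_mul (PhiInf u v s 1 x)⁻¹
  rw [inv_mul_cancel_left₀ (PhiInf_ne_zero u v _ _ x)] at hoff'
  refine tendsto_pi_nhds.2 fun i => ?_
  fin_cases i
  · refine hoff'.congr fun l => ?_
    simp [column, stdVec]
    ring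
  · simpa [column, stdVec, colSgn] using hdiag

end Corrections

end MTM

/-! ### Assembly of the theorem. -/

theorem theorem2p1 (u v vx : ℝ → ℂ)
    (hu1 : MemLp u 1 volume) (huinf : MemLp u ∞ volume)
    (hv1 : MemLp v 1 volume) (hvinf : MemLp v ∞ volume)
    (hvx : MTM.IsWeakDeriv v vx) (hvx1 : MemLp vx 1 volume) :
    ∃ Φ : MTM.LineEnd → Fin 2 → ℝ → ℂ → (Fin 2 → ℂ),
      -- unique solvability in `L^∞`, for real `l` with `|l| > 1` and in the half-plane domain
      (∀ s j, ∀ l ∈ MTM.closedDomain s j,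
        MemLp (fun x => Φ s j x l) ∞ volume ∧
        (∀ x, Φ s j x l = MTM.volterraRHS u v vx s j l (fun y => Φ s j y l) x) ∧
        ∀ Ψ : ℝ → Fin 2 → ℂ, MemLp Ψ ∞ volume →
          (∀ᵐ x, Ψ x = MTM.volterraRHS u v vx s j l Ψ x) →
          Ψ =ᵐ[volume] fun x => Φ s j x l) ∧
      -- analytic continuation from `ℝ ∖ [-1,1]`
      (∀ s j x, AnalyticOnNhd ℂ (Φ s j x) (MTM.openDomain s j) ∧
        ContinuousOn (Φ s j x) (MTM.closedDomain s j)) ∧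
      -- leading limits
      (∀ s j x, Tendsto (fun l => (MTM.PhiInf u v s j x)⁻¹ • Φ s j x l)
        (MTM.atInfinity s j) (𝓝 (MTM.stdVec j))) ∧
      -- first-order corrections
      (ContDiff ℝ 1 v →
        (∀ s x, Tendsto (fun l => l * ((MTM.PhiInf u v s 0 x)⁻¹ * Φ s 0 x l 0 - 1))
          (MTM.atInfinity s 0) (𝓝 (-MTM.corrInt u v s x))) ∧
        (∀ s x, MTM.IsLebesguePoint u x → ∀ ε : ℝ, 0 < ε →
          Tendsto (fun l => l * ((MTM.PhiInf u v s 0 x)⁻¹ * Φ s 0 x l 1))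
            (MTM.atInfinitySector s 0 ε)
            (𝓝 (-2 * Complex.I * deriv v x + ((‖u x‖ ^ 2 : ℝ) : ℂ) * v x + u x))) ∧
        (∀ s x, Tendsto
          (fun l => l • ((MTM.PhiInf u v s 1 x)⁻¹ • Φ s 1 x l - MTM.stdVec 1))
          (MTM.atInfinity s 1) (𝓝 ![conj (v x), MTM.corrInt u v s x]))) := by
  have h₁ := MTM.integrable_Q1 hu1 huinf hv1 hvinf hvx1
  have h₂ := MTM.integrable_Q2 hu1 hv1 hvinf
  choose a b hsol hcont hdiff using fun (s : MTM.LineEnd) (j : Fin 2) =>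
    (MTM.jostCoeff h₁ h₂ s j).exists_isSol (κ := MTM.phaseConst s j)
      (MTM.isOpen_openDomain s j) (MTM.openDomain_subset s j)
      fun l hl => ⟨hl.1, MTM.re_phase_nonpos hl⟩
  refine ⟨fun s j x l => MTM.column s j (a s j l) (b s j l) x, fun s j l hl =>
    ⟨(hsol s j l hl).memLp_column s j, MTM.column_eq_volterraRHS hl (hsol s j l hl),
      fun Ψ hΨ heq => MTM.ae_eq_column hl (hsol s j l hl) hΨ heq⟩, fun s j x => ⟨?_, ?_⟩,
    fun s j x => MTM.tendsto_column (fun l hl => hsol s j l (MTM.openDomain_subset s j hl)) x,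
    fun hv => ?_⟩
  · refine DifferentiableOn.analyticOnNhd (differentiableOn_pi.2 fun i => ?_)
      (MTM.isOpen_openDomain s j)
    rcases MTM.eq_or_eq_one_sub i j with rfl | rfl
    · simpa only [MTM.column_self] using (hdiff s i _).1
    · simpa only [MTM.column_other] using (hdiff s j _).2
  · refine continuousOn_pi.2 fun i => ?_
    rcases MTM.eq_or_eq_one_sub i j with rfl | rfl
    · simpa only [MTM.column_self] using (hcont s i _).1
    · simpa only [MTM.column_other] using (hcont s j _).2
  -- The weak derivative may be replaced by the classical one: the integrals do not see null sets,
  -- so the same functions `a` and `b` solve the system built from `deriv v`.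
  · have hae : vx =ᵐ[volume] deriv v :=
      hvx.ae_eq_deriv (memLp_one_iff_integrable.1 hvx1).locallyIntegrable hv
    have hd1 : MemLp (deriv v) 1 volume := hvx1.ae_eq hae
    have hd : Integrable (deriv v) := memLp_one_iff_integrable.1 hd1
    have h₁' := MTM.integrable_Q1 hu1 huinf hv1 hvinf hd1
    have hsol' : ∀ s j, ∀ l ∈ MTM.openDomain s j,
        (MTM.jostCoeff h₁' h₂ s j).IsSol (MTM.phaseConst s j) l (a s j l) (b s j l) :=
      fun s j l hl => (hsol s j l (MTM.openDomain_subset s j hl)).congr_jostCoeff hae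
    exact ⟨fun s x => MTM.tendsto_mul_column_zero_diag (hsol' s 0) hv hd x,
      fun s x hx ε hε =>
        MTM.tendsto_mul_column_zero_offdiag (hsol' s 0) hu1 huinf hvinf hv hd hx hε,
      fun s x => MTM.tendsto_smul_column_one (hsol' s 1) hv hd x⟩
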